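/- All vector spaces are over $\mathbb C$; modules over Lie superalgebras are $\mathbb Z_2$-graded, "simple" means nonzero without nonzero proper graded submodules, and isomorphisms preserve parity. Let $\mathcal A=\mathbb C[t^{\pm1}]\otimes\Lambda(1)$ with $t$ even and $\xi$ odd, and let $\mathcal W$ be the Lie superalgebra of superderivations of $\mathcal A$, with basis $d_i=t^{i+1}\frac{\partial}{\partial t}$, $h_i=t^i\xi\frac{\partial}{\partial\xi}$, $Q_i=t^i\frac{\partial}{\partial\xi}$, $G_i=t^{i+1}\xi\frac{\partial}{\partial t}$ ($i\in\mathbb Z$). Let $\mathfrak g$ be a finite-dimensional Lie superalgebra with $[\mathfrak g,\mathfrak g]=\mathfrak g$. Let $\mathfrak g\otimes\mathcal A$ have the bracket $[x\otimes a,y\otimes b]=(-1)^{|a||y|}[x,y]\otimes ab$, let $\mathcal W$ act on it by $w(x\otimes a)=(-1)^{|w||x|}x\otimes w(a)$, and put $\mathcal L=\mathcal W\ltimes(\mathfrak g\otimes\mathcal A)$ and $\widetilde{\mathcal L}=\mathcal W\ltimes((\mathfrak g\otimes\mathcal A)\oplus\mathcal A)$, where the summand $\mathcal A$ is abelian, commutes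 with $\mathfrak g\otimes\mathcal A$, and carries the natural action of $\mathcal W$. An $\mathcal{AL}$-module is an $\widetilde{\mathcal L}$-module on which $1\in\mathcal A$ acts as the identity and $(fg)v=f(gv)$ for all $f,g\in\mathcal A$. It is a weight module if $d_0$ acts diagonalizably, and $\mathrm{supp}(M)$ denotes the set of eigenvalues of $d_0$ on $M$. Let $\mathfrak m$ be the ideal of $\mathcal A$ generated by $t-1$ and $\xi$, and let $\mathfrak a_0=\mathfrak m\,\{t\tfrac{\partial}{\partial t},\tfrac{\partial}{\partial\xi}\}\ltimes(\mathfrak g\otimes\mathcal A)\subset\mathcal L$, a Lie subsuperalgebra, spanned by all $d_i-d_0$, $Q_i-Q_0$, $h_i$, $G_i$, $x\otimes t^i$, $x\otimes t^i\xi$. For $\lambda\in\mathbb C$ and an $\mathfrak a_0$-module $V$ let $\Gamma(\lambda,V)=\mathcal A\otimes V$ with the actions, for homogeneous $a\in\mathcal A$, $x\in\mathfrak g$, and $f\in\mathcal A$, $v\in V$, \begin{align*} f\circ(a\otimes v)&=fa\otimes v,\\ d_i\circ(a\otimes v)&=t^ia\otimes(d_i-d_0)v+t^i(\lambda a+d_0(a))\otimes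 v,\\ Q_i\circ(a\otimes v)&=(-1)^{|a|}t^ia\otimes(Q_i-Q_0)v+t^iQ_0(a)\otimes v,\\ h_i\circ(a\otimes v)&=t^ia\otimes h_iv+(-1)^{|a|}t^i\xi a\otimes(Q_i-Q_0)v+t^i\xi Q_0(a)\otimes v,\\ G_i\circ(a\otimes v)&=(-1)^{|a|}t^ia\otimes G_iv+t^i\xi a\otimes(d_i-d_0)v+t^i\xi(\lambda a+d_0(a))\otimes v,\\ (x\otimes t^i)\circ(a\otimes v)&=(-1)^{|a||x|}t^ia\otimes(x\otimes t^i)v,\\ (x\otimes t^i\xi)\circ(a\otimes v)&=(-1)^{(|a|+1)|x|}t^i\xi a\otimes(x\otimes t^i)v+(-1)^{|a|(|x|+1)}t^ia\otimes(x\otimes t^i\xi)v. \end{align*} Lemma. (1) For any $\lambda\in\mathbb C$ and any simple $\mathfrak a_0$-module $V$, $\Gamma(\lambda,V)$ is a simple weight $\mathcal{AL}$-module. (2) Any simple weight $\mathcal{AL}$-module $M$ is isomorphic to $\Gamma(\lambda,V)$ for some $\lambda\in\mathrm{supp}(M)$ and some simple $\mathfrak a_0$-module $V$. -/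

import Mathlib

open scoped TensorProduct LaurentPolynomial

universe u v w

namespace SuperAffine
noncomputable section

/-- The sign `(-1) ^ p` of a parity `p`. -/
def sgn (p : ZMod 2) : ℂ := if p = 0 then 1 else -1

theorem sgn_add (p q : ZMod 2) : sgn (p + q) = sgn p * sgn q := by
  have h : ∀ p q : ZMod 2, p + q = 0 ↔ (p = 0 ↔ q = 0) := by decide
  unfold sgn
  by_cases hp : p = 0 <;> by_cases hq : q = 0 <;> simp [h, hp, hq]

theorem sgn_mul_self (p : ZMod 2) : sgn p * sgn p = 1 := by
  unfold sgn; split_ifs <;> simp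

/-- A super vector space over `ℂ`: a vector space `V = V₀ ⊕ V₁`. -/
class SuperSpace (V : Type*) [AddCommGroup V] [Module ℂ V] where
  part : ZMod 2 → Submodule ℂ V
  isCompl_part : IsCompl (part 0) (part 1)

open SuperSpace (part)

theorem parity_cases (p : ZMod 2) : p = 0 ∨ p = 1 := by revert p; decide

theorem one_add_one : (1 : ZMod 2) + 1 = 0 := by decide

theorem isCompl_part' (V : Type*) [AddCommGroup V] [Module ℂ V] [SuperSpace V] (p : ZMod 2) :
    IsCompl (part p : Submodule ℂ V) (part (p + 1)) := by
  rcases parity_cases p with rfl | rfl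
  · exact SuperSpace.isCompl_part
  · exact SuperSpace.isCompl_part.symm

/-- The projection of a super vector space onto its component of parity `p`. -/
def proj {V : Type*} [AddCommGroup V] [Module ℂ V] [SuperSpace V] (p : ZMod 2) : V →ₗ[ℂ] V :=
  (part p).projection (part (p + 1)) (isCompl_part' V p)

section basics
variable {V : Type*} [AddCommGroup V] [Module ℂ V] [SuperSpace V]

theorem proj_mem (p : ZMod 2) (v : V) : proj p v ∈ (part p : Submodule ℂ V) :=
  Submodule.projection_apply_mem _ _

theorem proj_of_mem {p q : ZMod 2} {v : V} (hv : v ∈ (part q : Submodule ℂ V)) :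
    proj p v = if p = q then v else 0 := by
  split_ifs with h
  · subst h; exact Submodule.projection_apply_of_mem_left _ hv
  · have : q = p + 1 := by revert h; clear hv; revert p q; decide
    subst this
    exact (Submodule.projection_apply_eq_zero_iff _).2 hv

theorem proj_add_proj (v : V) : proj 0 v + proj 1 v = v :=
  Submodule.projection_add_projection_eq_self _ v

end basics

/-- The direct sum of two super vector spaces. -/
instance instSuperSpaceProd (V W : Type*) [AddCommGroup V] [Module ℂ V] [SuperSpace V]
    [AddCommGroup W] [Module ℂ W] [SuperSpace W] : SuperSpace (V × W) where
  part p := (part p).prod (part p)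
  isCompl_part := by
    have hV := SuperSpace.isCompl_part (V := V)
    have hW := SuperSpace.isCompl_part (V := W)
    constructor
    · rw [disjoint_iff, Submodule.prod_inf_prod, hV.inf_eq_bot, hW.inf_eq_bot]; simp
    · rw [codisjoint_iff, Submodule.prod_sup_prod, hV.sup_eq_top, hW.sup_eq_top]; simp

/-- The tensor product of two super vector spaces, `|v ⊗ w| = |v| + |w|`. -/
instance instSuperSpaceTensor (V W : Type*) [AddCommGroup V] [Module ℂ V] [SuperSpace V]
    [AddCommGroup W] [Module ℂ W] [SuperSpace W] : SuperSpace (V ⊗[ℂ] W) where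
  part p := ⨆ q : ZMod 2, Submodule.map₂ (TensorProduct.mk ℂ V W) (part q) (part (p - q))
  isCompl_part := by
    constructor
    · let θ : V ⊗[ℂ] W →ₗ[ℂ] V ⊗[ℂ] W := TensorProduct.map (proj 0 - proj 1) (proj 0 - proj 1)
      have key : ∀ p : ZMod 2,
          (⨆ q : ZMod 2, Submodule.map₂ (TensorProduct.mk ℂ V W) (part q) (part (p - q))) ≤
            LinearMap.ker (θ - sgn p • LinearMap.id) := by
        intro p
        refine iSup_le fun q => Submodule.map₂_le.2 fun v hv w hw => ?_
        simp only [LinearMap.mem_ker, LinearMap.sub_apply, θ, TensorProduct.mk_apply,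
          TensorProduct.map_tmul, proj_of_mem hv, proj_of_mem hw, LinearMap.smul_apply,
          LinearMap.id_apply]
        rcases parity_cases p with rfl | rfl <;> rcases parity_cases q with rfl | rfl <;>
          simp [sgn, TensorProduct.neg_tmul, TensorProduct.tmul_neg]
      refine (Submodule.disjoint_def).2 fun x h0 h1 => ?_
      have e0 := key 0 h0
      have e1 := key 1 h1
      simp only [LinearMap.mem_ker, LinearMap.sub_apply, LinearMap.smul_apply, LinearMap.id_apply,
        sgn] at e0 e1
      have e : (2 : ℂ) • x = 0 := by
        have := congrArg₂ (fun a b => b - a) e0 e1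
        simp at this
        rw [two_smul]; simpa using this
      simpa using e
    · rw [codisjoint_iff, eq_top_iff]
      intro x _
      induction x using TensorProduct.induction_on with
      | zero => exact Submodule.zero_mem _
      | add x y hx hy => exact Submodule.add_mem _ (hx trivial) (hy trivial)
      | tmul v w =>
        have key : ∀ p q : ZMod 2, (proj p v) ⊗ₜ[ℂ] (proj q w) ∈
            (⨆ q : ZMod 2, Submodule.map₂ (TensorProduct.mk ℂ V W) (part q) (part (0 - q))) ⊔
            (⨆ q : ZMod 2, Submodule.map₂ (TensorProduct.mk ℂ V W) (part q) (part (1 - q))) := by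
          intro p q
          have : ∀ r : ZMod 2, r - p = q → (proj p v) ⊗ₜ[ℂ] (proj q w) ∈
            (⨆ q : ZMod 2, Submodule.map₂ (TensorProduct.mk ℂ V W) (part q) (part (r - q))) := by
            intro r hr
            exact Submodule.mem_iSup_of_mem p
              (Submodule.apply_mem_map₂ _ (proj_mem p v) (hr ▸ proj_mem _ w))
          have h2 : p + q = 0 ∨ p + q = 1 := parity_cases _
          rcases h2 with h | h
          · exact Submodule.mem_sup_left (this 0 (by rw [← h]; ring))
          · exact Submodule.mem_sup_right (this 1 (by rw [← h]; ring))
        rw [← proj_add_proj v, ← proj_add_proj w]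
        simp only [TensorProduct.add_tmul, TensorProduct.tmul_add]
        exact Submodule.add_mem _ (Submodule.add_mem _ (key _ _) (key _ _))
          (Submodule.add_mem _ (key _ _) (key _ _))

/-- A Lie superalgebra over `ℂ`: a bilinear bracket that is additive on parities, satisfies
`[x, y] = -(-1) ^ (|x| |y|) [y, x]` and the super Jacobi identity. -/
class LieSuperalgebra (L : Type*) [AddCommGroup L] [Module ℂ L] [SuperSpace L] where
  br : L →ₗ[ℂ] L →ₗ[ℂ] L
  br_mem : ∀ {p q : ZMod 2} {x y : L}, x ∈ (part p : Submodule ℂ L) → y ∈ (part q : Submodule ℂ L) →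
    br x y ∈ (part (p + q) : Submodule ℂ L)
  br_skew : ∀ {p q : ZMod 2} {x y : L}, x ∈ (part p : Submodule ℂ L) →
    y ∈ (part q : Submodule ℂ L) → br x y = -(sgn (p * q) • br y x)
  br_jacobi : ∀ {p q : ZMod 2} {x y : L}, x ∈ (part p : Submodule ℂ L) →
    y ∈ (part q : Submodule ℂ L) → ∀ z : L,
    br x (br y z) = br (br x y) z + sgn (p * q) • br y (br x z)

open LieSuperalgebra (br)

/-- `𝒜 = ℂ[t, t⁻¹] ⊗ Λ(1)`, elements `f + g ξ` with `f, g` Laurent polynomials and `ξ ^ 2 = 0`. -/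
abbrev A : Type := DualNumber ℂ[T;T⁻¹]

namespace A

/-- `f` is even and `g ξ` is odd. -/
instance : SuperSpace A where
  part p := if p = 0 then LinearMap.ker ((TrivSqZeroExt.sndHom ℂ[T;T⁻¹] ℂ[T;T⁻¹]).restrictScalars ℂ)
    else LinearMap.ker ((TrivSqZeroExt.fstHom ℂ ℂ[T;T⁻¹] ℂ[T;T⁻¹]).toLinearMap)
  isCompl_part := by
    simp only [if_true, one_ne_zero, if_false]
    constructor
    · refine (Submodule.disjoint_def).2 fun x h0 h1 => ?_
      exact TrivSqZeroExt.ext (by simpa using h1) (by simpa using h0)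
    · rw [codisjoint_iff, eq_top_iff]
      intro x _
      rw [← TrivSqZeroExt.inl_fst_add_inr_snd_eq x]
      exact Submodule.add_mem_sup (by simp) (by simp)

/-- The even basis element `t ^ i`. -/
def t (i : ℤ) : A := TrivSqZeroExt.inl (LaurentPolynomial.T i)

/-- The odd basis element `t ^ i ξ`. -/
def tξ (i : ℤ) : A := TrivSqZeroExt.inr (LaurentPolynomial.T i)

/-- The linear map on `𝒜` with `t ^ i ↦ u i` and `t ^ i ξ ↦ w i`. -/
def lift {E : Type*} [AddCommGroup E] [Module ℂ E] (u w : ℤ → E) : A →ₗ[ℂ] E :=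
  Finsupp.linearCombination ℂ u ∘ₗ (AddMonoidAlgebra.coeffLinearEquiv ℂ).toLinearMap ∘ₗ
      (TrivSqZeroExt.fstHom ℂ ℂ[T;T⁻¹] ℂ[T;T⁻¹]).toLinearMap +
    Finsupp.linearCombination ℂ w ∘ₗ (AddMonoidAlgebra.coeffLinearEquiv ℂ).toLinearMap ∘ₗ
      (TrivSqZeroExt.sndHom ℂ[T;T⁻¹] ℂ[T;T⁻¹]).restrictScalars ℂ

theorem lift_t {E : Type*} [AddCommGroup E] [Module ℂ E] (u w : ℤ → E) (i : ℤ) :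
    lift u w (t i) = u i := by
  have : (LaurentPolynomial.T i : ℂ[T;T⁻¹]).coeff = Finsupp.single i 1 := rfl
  simp [lift, t, this]

theorem lift_tξ {E : Type*} [AddCommGroup E] [Module ℂ E] (u w : ℤ → E) (i : ℤ) :
    lift u w (tξ i) = w i := by
  have : (LaurentPolynomial.T i : ℂ[T;T⁻¹]).coeff = Finsupp.single i 1 := rfl
  simp [lift, tξ, this]

theorem laurent_hom_ext {E : Type*} [AddCommGroup E] [Module ℂ E] {f g : ℂ[T;T⁻¹] →ₗ[ℂ] E}
    (h : ∀ i, f (LaurentPolynomial.T i) = g (LaurentPolynomial.T i)) : f = g := by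
  refine LinearMap.ext fun x => ?_
  induction x using AddMonoidAlgebra.induction_linear with
  | zero => simp
  | add x y hx hy => simp [hx, hy]
  | single i r =>
    have : (AddMonoidAlgebra.single i r : ℂ[T;T⁻¹]) = r • LaurentPolynomial.T i := by
      rw [LaurentPolynomial.single_eq_C_mul_T, LaurentPolynomial.smul_eq_C_mul]
    rw [this, map_smul, map_smul, h]

theorem hom_ext {E : Type*} [AddCommGroup E] [Module ℂ E] {f g : A →ₗ[ℂ] E}
    (h : ∀ i, f (t i) = g (t i)) (h' : ∀ i, f (tξ i) = g (tξ i)) : f = g := by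
  have e1 : f ∘ₗ ((TrivSqZeroExt.inlAlgHom ℂ ℂ[T;T⁻¹] ℂ[T;T⁻¹]).toLinearMap) =
      g ∘ₗ ((TrivSqZeroExt.inlAlgHom ℂ ℂ[T;T⁻¹] ℂ[T;T⁻¹]).toLinearMap) :=
    laurent_hom_ext h
  have e2 : f ∘ₗ ((TrivSqZeroExt.inrHom ℂ[T;T⁻¹] ℂ[T;T⁻¹]).restrictScalars ℂ) =
      g ∘ₗ ((TrivSqZeroExt.inrHom ℂ[T;T⁻¹] ℂ[T;T⁻¹]).restrictScalars ℂ) :=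
    laurent_hom_ext h'
  refine LinearMap.ext fun x => ?_
  rw [← TrivSqZeroExt.inl_fst_add_inr_snd_eq x, map_add, map_add]
  exact congrArg₂ _ (DFunLike.congr_fun e1 x.fst) (DFunLike.congr_fun e2 x.snd)

/-- The Euler derivation `t d/dt` of the Laurent polynomials. -/
def euler : ℂ[T;T⁻¹] →ₗ[ℂ] ℂ[T;T⁻¹] :=
  Finsupp.linearCombination ℂ (fun i : ℤ => (i : ℂ) • LaurentPolynomial.T i) ∘ₗ
    (AddMonoidAlgebra.coeffLinearEquiv ℂ).toLinearMap

theorem euler_T (i : ℤ) : euler (LaurentPolynomial.T i) = (i : ℂ) • LaurentPolynomial.T i := by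
  have : (LaurentPolynomial.T i : ℂ[T;T⁻¹]).coeff = Finsupp.single i 1 := rfl
  simp [euler, this]

theorem euler_mul (f g : ℂ[T;T⁻¹]) : euler (f * g) = euler f * g + f * euler g := by
  have : (LinearMap.mul ℂ ℂ[T;T⁻¹]).compr₂ euler =
      (LinearMap.mul ℂ ℂ[T;T⁻¹]) ∘ₗ euler + (LinearMap.mul ℂ ℂ[T;T⁻¹]).compl₂ euler := by
    refine laurent_hom_ext fun i => laurent_hom_ext fun j => ?_
    simp only [LinearMap.compr₂_apply, LinearMap.add_apply, LinearMap.comp_apply,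
      LinearMap.compl₂_apply, LinearMap.mul_apply', euler_T, ← LaurentPolynomial.T_add,
      smul_mul_assoc, mul_smul_comm]
    push_cast
    module
  exact DFunLike.congr_fun (DFunLike.congr_fun this f) g

/-- The even superderivation `t ∂/∂t` of `𝒜`. -/
def D : A →ₗ[ℂ] A where
  toFun a := TrivSqZeroExt.inl (euler a.fst) + TrivSqZeroExt.inr (euler a.snd)
  map_add' a b := by ext <;> simp
  map_smul' c a := by ext <;> simp

/-- The odd superderivation `∂/∂ξ` of `𝒜`. -/
def dξ : A →ₗ[ℂ] A where
  toFun a := TrivSqZeroExt.inl a.snd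
  map_add' a b := by ext <;> simp
  map_smul' c a := by ext <;> simp

@[simp] theorem fst_D (a : A) : (D a).fst = euler a.fst := by simp [D]
@[simp] theorem snd_D (a : A) : (D a).snd = euler a.snd := by simp [D]
@[simp] theorem fst_dξ (a : A) : (dξ a).fst = a.snd := by simp [dξ]
@[simp] theorem snd_dξ (a : A) : (dξ a).snd = 0 := by simp [dξ]

theorem mem_part_zero {a : A} : a ∈ (part 0 : Submodule ℂ A) ↔ a.snd = 0 := by
  simp [part]

theorem mem_part_one {a : A} : a ∈ (part 1 : Submodule ℂ A) ↔ a.fst = 0 := by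
  simp [part]

theorem mul_mem {p q : ZMod 2} {a b : A} (ha : a ∈ (part p : Submodule ℂ A))
    (hb : b ∈ (part q : Submodule ℂ A)) : a * b ∈ (part (p + q) : Submodule ℂ A) := by
  rcases parity_cases p with rfl | rfl <;> rcases parity_cases q with rfl | rfl <;>
    simp [mem_part_zero, mem_part_one, one_add_one] at * <;> simp [*]

theorem mul_comm_super {p q : ZMod 2} {a b : A} (ha : a ∈ (part p : Submodule ℂ A))
    (hb : b ∈ (part q : Submodule ℂ A)) : a * b = sgn (p * q) • (b * a) := by
  rcases parity_cases p with rfl | rfl <;> rcases parity_cases q with rfl | rfl <;>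
    simp [mem_part_zero, mem_part_one] at ha hb <;>
    refine TrivSqZeroExt.ext ?_ ?_ <;> simp [ha, hb, sgn] <;> try ring

end A

section general
variable {V W Z : Type*} [AddCommGroup V] [Module ℂ V] [SuperSpace V] [AddCommGroup W] [Module ℂ W]
  [SuperSpace W] [AddCommGroup Z] [Module ℂ Z]

/-- The super-antisymmetrization of a bilinear map: on homogeneous elements it is
`(x, y) ↦ B x y - (-1) ^ (|x| |y|) B y x`. -/
def superComm (B : V →ₗ[ℂ] V →ₗ[ℂ] Z) : V →ₗ[ℂ] V →ₗ[ℂ] Z :=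
  ∑ p : ZMod 2, ∑ q : ZMod 2, (B.compl₁₂ (proj p) (proj q) -
    sgn (p * q) • (B.compl₁₂ (proj q) (proj p)).flip)

theorem sum_parity {M : Type*} [AddCommMonoid M] (f : ZMod 2 → M) : ∑ p, f p = f 0 + f 1 :=
  Fin.sum_univ_two f

theorem superComm_apply (B : V →ₗ[ℂ] V →ₗ[ℂ] Z) {p q : ZMod 2} {x y : V}
    (hx : x ∈ (part p : Submodule ℂ V)) (hy : y ∈ (part q : Submodule ℂ V)) :
    superComm B x y = B x y - sgn (p * q) • B y x := by
  rcases parity_cases p with rfl | rfl <;> rcases parity_cases q with rfl | rfl <;>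
    simp [superComm, sum_parity, proj_of_mem hx, proj_of_mem hy]

theorem hom_ext_parts {f g : V →ₗ[ℂ] Z} (h : ∀ p, ∀ x ∈ (part p : Submodule ℂ V), f x = g x) :
    f = g := by
  refine LinearMap.ext fun x => ?_
  rw [← proj_add_proj x, map_add, map_add, h 0 _ (proj_mem _ _), h 1 _ (proj_mem _ _)]

theorem eq_on_part_tensor {f g : V ⊗[ℂ] W →ₗ[ℂ] Z} {p : ZMod 2}
    (h : ∀ i j, i + j = p → ∀ v ∈ (part i : Submodule ℂ V), ∀ w ∈ (part j : Submodule ℂ W),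
      f (v ⊗ₜ w) = g (v ⊗ₜ w)) {x : V ⊗[ℂ] W} (hx : x ∈ (part p : Submodule ℂ (V ⊗[ℂ] W))) :
    f x = g x := by
  have : (part p : Submodule ℂ (V ⊗[ℂ] W)) ≤ LinearMap.ker (f - g) :=
    iSup_le fun q => Submodule.map₂_le.2 fun v hv w hw => by
      simpa [sub_eq_zero] using h q (p - q) (by ring) v hv w hw
  simpa [sub_eq_zero] using this hx

theorem tmul_mem {p q : ZMod 2} {v : V} {w : W} (hv : v ∈ (part p : Submodule ℂ V))
    (hw : w ∈ (part q : Submodule ℂ W)) : v ⊗ₜ w ∈ (part (p + q) : Submodule ℂ (V ⊗[ℂ] W)) :=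
  Submodule.mem_iSup_of_mem p (Submodule.apply_mem_map₂ _ hv (by rwa [add_sub_cancel_left]))

theorem map_mem_of_part_tensor (f : V ⊗[ℂ] W →ₗ[ℂ] Z) {p : ZMod 2} {S : Submodule ℂ Z}
    (h : ∀ i j, i + j = p → ∀ v ∈ (part i : Submodule ℂ V), ∀ w ∈ (part j : Submodule ℂ W),
      f (v ⊗ₜ w) ∈ S) {x : V ⊗[ℂ] W} (hx : x ∈ (part p : Submodule ℂ (V ⊗[ℂ] W))) :
    f x ∈ S := by
  have : (part p : Submodule ℂ (V ⊗[ℂ] W)) ≤ S.comap f :=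
    iSup_le fun q => Submodule.map₂_le.2 fun v hv w hw => h q (p - q) (by ring) v hv w hw
  exact this hx

/-- A Lie superalgebra built from an even bilinear map `B` and an even super-antisymmetric
bilinear map `C`. -/
@[reducible] def lieOfLeftSymm (B C : V →ₗ[ℂ] V →ₗ[ℂ] V)
    (B_mem : ∀ {p q : ZMod 2} {x y : V}, x ∈ (part p : Submodule ℂ V) →
      y ∈ (part q : Submodule ℂ V) → B x y ∈ (part (p + q) : Submodule ℂ V))
    (C_mem : ∀ {p q : ZMod 2} {x y : V}, x ∈ (part p : Submodule ℂ V) →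
      y ∈ (part q : Submodule ℂ V) → C x y ∈ (part (p + q) : Submodule ℂ V))
    (C_skew : ∀ {p q : ZMod 2} {x y : V}, x ∈ (part p : Submodule ℂ V) →
      y ∈ (part q : Submodule ℂ V) → C x y = -(sgn (p * q) • C y x))
    (C_jacobi : ∀ {p q r : ZMod 2} {x y z : V}, x ∈ (part p : Submodule ℂ V) →
      y ∈ (part q : Submodule ℂ V) → z ∈ (part r : Submodule ℂ V) →
      C x (C y z) = C (C x y) z + sgn (p * q) • C y (C x z))
    (BC : ∀ x y z : V, B (C x y) z = 0)
    (B_C : ∀ {p q r : ZMod 2} {x y z : V}, x ∈ (part p : Submodule ℂ V) →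
      y ∈ (part q : Submodule ℂ V) → z ∈ (part r : Submodule ℂ V) →
      B x (C y z) = C (B x y) z + sgn (p * q) • C y (B x z))
    (B_symm : ∀ {p q r : ZMod 2} {x y z : V}, x ∈ (part p : Submodule ℂ V) →
      y ∈ (part q : Submodule ℂ V) → z ∈ (part r : Submodule ℂ V) →
      B (B x y) z - sgn (p * q) • B (B y x) z = B x (B y z) - sgn (p * q) • B y (B x z)) :
    LieSuperalgebra V where
  br := superComm B + C
  br_mem hx hy := by
    rw [LinearMap.add_apply, LinearMap.add_apply, superComm_apply B hx hy]
    exact Submodule.add_mem _ (Submodule.sub_mem _ (B_mem hx hy)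
      (Submodule.smul_mem _ _ (by rw [add_comm]; exact B_mem hy hx))) (C_mem hx hy)
  br_skew {p q x y} hx hy := by
    simp only [LinearMap.add_apply, superComm_apply B hx hy, superComm_apply B hy hx, C_skew hx hy]
    rcases parity_cases p with rfl | rfl <;> rcases parity_cases q with rfl | rfl <;>
      simp [sgn] <;> module
  br_jacobi {p q x y} hx hy z := by
    suffices h : (superComm B + C) x ∘ₗ (superComm B + C) y =
        (superComm B + C) ((superComm B + C) x y) +
          sgn (p * q) • (superComm B + C) y ∘ₗ (superComm B + C) x from
      DFunLike.congr_fun h z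
    refine hom_ext_parts fun r z hz => ?_
    have hxy := B_mem hx hy
    have hyx := B_mem hy hx
    have hyz := B_mem hy hz
    have hzy := B_mem hz hy
    have hxz := B_mem hx hz
    have hzx := B_mem hz hx
    have cxy := C_mem hx hy
    have cyz := C_mem hy hz
    have cxz := C_mem hx hz
    simp only [LinearMap.add_apply, LinearMap.comp_apply, LinearMap.smul_apply,
      superComm_apply B hx hy, superComm_apply B hx hz, superComm_apply B hy hz, map_add, map_sub,
      map_smul, LinearMap.sub_apply,
      superComm_apply B hx hyz, superComm_apply B hx hzy, superComm_apply B hy hxz,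
      superComm_apply B hy hzx, superComm_apply B hxy hz, superComm_apply B hyx hz,
      superComm_apply B cxy hz, superComm_apply B hx cyz, superComm_apply B hy cxz, BC]
    have e1 := B_symm hx hy hz
    have e2 := B_symm hx hz hy
    have e3 := B_symm hy hz hx
    have e4 := B_C hx hy hz
    have e5 := B_C hy hx hz
    have e6 := B_C hz hx hy
    have e7 := C_jacobi hx hy hz
    have e8 := C_skew hzx hy
    clear C_skew C_jacobi BC B_C B_symm B_mem C_mem hx hy hz hxy hyx hyz hzy hxz hzx cxy cyz cxz
    simp only [mul_add, add_mul, sgn_add, mul_comm r p, mul_comm r q, mul_comm q p] at *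
    have hs := sgn_mul_self (p * q)
    have ha := sgn_mul_self (p * r)
    have hb := sgn_mul_self (q * r)
    generalize sgn (p * q) = s at *
    generalize sgn (p * r) = a at *
    generalize sgn (q * r) = b at *
    linear_combination (norm := skip) (-1 : ℂ) • e1 + b • e2 - (s * a) • e3 + e4 - s • e5 +
      (a * b) • e6 + e7 + (a * b) • e8
    match_scalars <;> grind

end general

/-- The Witt superalgebra `𝒲 = 𝒜 Δ` of superderivations of `𝒜`; the pair `(f, g)` stands for
the superderivation `f t ∂/∂t + g ∂/∂ξ`. -/
def Witt : Type := A × A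

namespace Witt

instance : AddCommGroup Witt := inferInstanceAs (AddCommGroup (A × A))
instance : Module ℂ Witt := inferInstanceAs (Module ℂ (A × A))

/-- The coefficient of `t ∂/∂t`. -/
def coeffD : Witt →ₗ[ℂ] A := LinearMap.fst ℂ A A

/-- The coefficient of `∂/∂ξ`. -/
def coeffξ : Witt →ₗ[ℂ] A := LinearMap.snd ℂ A A

/-- The superderivation `f t ∂/∂t + g ∂/∂ξ`. -/
def mk (f g : A) : Witt := (f, g)

@[simp] theorem coeffD_mk (f g : A) : coeffD (mk f g) = f := rfl
@[simp] theorem coeffξ_mk (f g : A) : coeffξ (mk f g) = g := rfl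

theorem ext {w w' : Witt} (h : coeffD w = coeffD w') (h' : coeffξ w = coeffξ w') : w = w' :=
  Prod.ext h h'

/-- `∂/∂ξ` is odd, so `f t ∂/∂t + g ∂/∂ξ` has parity `p` when `f` has parity `p` and `g` has
parity `p + 1`. -/
instance : SuperSpace Witt where
  part p := (part p).comap coeffD ⊓ (part (p + 1)).comap coeffξ
  isCompl_part := by
    constructor
    · refine (Submodule.disjoint_def).2 fun w h0 h1 => ?_
      exact ext ((Submodule.disjoint_def).1 (isCompl_part' A 0).disjoint _ h0.1 h1.1)
        ((Submodule.disjoint_def).1 (isCompl_part' A (0 + 1)).disjoint _ h0.2 h1.2)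
    · rw [codisjoint_iff, eq_top_iff]
      intro w _
      have : w = mk (proj 0 (coeffD w)) (proj 1 (coeffξ w)) +
          mk (proj 1 (coeffD w)) (proj 0 (coeffξ w)) :=
        ext (proj_add_proj _).symm (by rw [map_add]; exact ((add_comm _ _).trans (proj_add_proj _)).symm)
      rw [this]
      exact Submodule.add_mem_sup ⟨proj_mem 0 (coeffD w), proj_mem 1 (coeffξ w)⟩
        ⟨proj_mem 1 (coeffD w), proj_mem 0 (coeffξ w)⟩

theorem mem_part {p : ZMod 2} {w : Witt} : w ∈ (part p : Submodule ℂ Witt) ↔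
    coeffD w ∈ (part p : Submodule ℂ A) ∧ coeffξ w ∈ (part (p + 1) : Submodule ℂ A) := Iff.rfl

/-- The action of `𝒲` on `𝒜` by superderivations. -/
def act : Witt →ₗ[ℂ] A →ₗ[ℂ] A :=
  (LinearMap.mul ℂ A).compl₂ A.D ∘ₗ coeffD + (LinearMap.mul ℂ A).compl₂ A.dξ ∘ₗ coeffξ

theorem act_apply (w : Witt) (a : A) : act w a = coeffD w * A.D a + coeffξ w * A.dξ a := rfl

theorem act_mem {p q : ZMod 2} {w : Witt} {a : A} (hw : w ∈ (part p : Submodule ℂ Witt))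
    (ha : a ∈ (part q : Submodule ℂ A)) : act w a ∈ (part (p + q) : Submodule ℂ A) := by
  obtain ⟨h1, h2⟩ := mem_part.1 hw
  rw [act_apply]
  rcases parity_cases p with rfl | rfl <;> rcases parity_cases q with rfl | rfl <;>
    simp [A.mem_part_zero, A.mem_part_one, one_add_one] at * <;> simp [*]

theorem act_mul {p q : ZMod 2} {w : Witt} {a : A} (hw : w ∈ (part p : Submodule ℂ Witt))
    (ha : a ∈ (part q : Submodule ℂ A)) (b : A) :
    act w (a * b) = act w a * b + sgn (p * q) • (a * act w b) := by
  obtain ⟨h1, h2⟩ := mem_part.1 hw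
  simp only [act_apply]
  rcases parity_cases p with rfl | rfl <;> rcases parity_cases q with rfl | rfl <;>
    simp [A.mem_part_zero, A.mem_part_one, one_add_one] at h1 h2 ha <;>
    refine TrivSqZeroExt.ext ?_ ?_ <;> simp [h1, h2, ha, sgn, A.euler_mul] <;> try ring

/-- `𝒲` acting on the coefficients of elements of `𝒲`. -/
def actW : Witt →ₗ[ℂ] Witt →ₗ[ℂ] Witt :=
  LinearMap.mk₂ ℂ (fun w w' => mk (act w (coeffD w')) (act w (coeffξ w')))
    (fun w₁ w₂ w' => ext (by simp) (by simp)) (fun c w w' => ext (by simp) (by simp))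
    (fun w w₁ w₂ => ext (by simp) (by simp)) (fun c w w' => ext (by simp) (by simp))

@[simp] theorem coeffD_actW (w w' : Witt) : coeffD (actW w w') = act w (coeffD w') := rfl
@[simp] theorem coeffξ_actW (w w' : Witt) : coeffξ (actW w w') = act w (coeffξ w') := rfl

theorem actW_mem {p q : ZMod 2} {w w' : Witt} (hw : w ∈ (part p : Submodule ℂ Witt))
    (hw' : w' ∈ (part q : Submodule ℂ Witt)) :
    actW w w' ∈ (part (p + q) : Submodule ℂ Witt) :=
  ⟨act_mem hw hw'.1, by rw [add_assoc]; exact act_mem hw hw'.2⟩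

theorem act_symm {p q : ZMod 2} {w w' : Witt} (hw : w ∈ (part p : Submodule ℂ Witt))
    (hw' : w' ∈ (part q : Submodule ℂ Witt)) (a : A) :
    act (actW w w') a - sgn (p * q) • act (actW w' w) a =
      act w (act w' a) - sgn (p * q) • act w' (act w a) := by
  obtain ⟨h1, h2⟩ := mem_part.1 hw
  obtain ⟨h3, h4⟩ := mem_part.1 hw'
  simp only [act_apply, coeffD_actW, coeffξ_actW]
  rcases parity_cases p with rfl | rfl <;> rcases parity_cases q with rfl | rfl <;>
    simp [A.mem_part_zero, A.mem_part_one, one_add_one] at h1 h2 h3 h4 <;>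
    refine TrivSqZeroExt.ext ?_ ?_ <;> simp [h1, h2, h3, h4, sgn, A.euler_mul] <;> try ring

end Witt

section current
variable {g : Type*} [AddCommGroup g] [Module ℂ g] [SuperSpace g]

/-- The action of `𝒲` on `g ⊗ 𝒜`: `w (x ⊗ a) = (-1) ^ (|w| |x|) x ⊗ w a`. -/
def actCur : Witt →ₗ[ℂ] g ⊗[ℂ] A →ₗ[ℂ] g ⊗[ℂ] A :=
  ∑ p : ZMod 2, ∑ q : ZMod 2, sgn (p * q) •
    (TensorProduct.mapBilinear (.id ℂ) g A g A (proj q)) ∘ₗ Witt.act ∘ₗ proj p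

theorem actCur_tmul {p q : ZMod 2} {w : Witt} {x : g} (hw : w ∈ (part p : Submodule ℂ Witt))
    (hx : x ∈ (part q : Submodule ℂ g)) (a : A) :
    actCur w (x ⊗ₜ[ℂ] a) = sgn (p * q) • x ⊗ₜ[ℂ] Witt.act w a := by
  rcases parity_cases p with rfl | rfl <;> rcases parity_cases q with rfl | rfl <;>
    simp [actCur, sum_parity, proj_of_mem hx, proj_of_mem hw]

theorem actCur_mem {p q : ZMod 2} {w : Witt} {u : g ⊗[ℂ] A}
    (hw : w ∈ (part p : Submodule ℂ Witt)) (hu : u ∈ (part q : Submodule ℂ (g ⊗[ℂ] A))) :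
    actCur w u ∈ (part (p + q) : Submodule ℂ (g ⊗[ℂ] A)) := by
  refine map_mem_of_part_tensor (actCur w) (fun i j hij x hx a ha => ?_) hu
  subst hij
  rw [actCur_tmul hw hx]
  have := tmul_mem hx (Witt.act_mem hw ha)
  rw [show i + (p + j) = p + (i + j) by ring] at this
  exact Submodule.smul_mem _ _ this

theorem actCur_symm {p q r : ZMod 2} {w w' : Witt} {u : g ⊗[ℂ] A}
    (hw : w ∈ (part p : Submodule ℂ Witt)) (hw' : w' ∈ (part q : Submodule ℂ Witt))
    (hu : u ∈ (part r : Submodule ℂ (g ⊗[ℂ] A))) :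
    actCur (Witt.actW w w') u - sgn (p * q) • actCur (Witt.actW w' w) u =
      actCur w (actCur w' u) - sgn (p * q) • actCur w' (actCur w u) := by
  refine eq_on_part_tensor
    (f := actCur (Witt.actW w w') - sgn (p * q) • actCur (Witt.actW w' w))
    (g := actCur w ∘ₗ actCur w' - sgn (p * q) • actCur w' ∘ₗ actCur w)
    (fun i j hij x hx a ha => ?_) hu
  have e := congrArg (fun z => sgn ((p + q) * i) • x ⊗ₜ[ℂ] z) (Witt.act_symm hw hw' a)
  simp only [LinearMap.sub_apply, LinearMap.smul_apply, LinearMap.comp_apply,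
    actCur_tmul (Witt.actW_mem hw hw') hx, actCur_tmul (Witt.actW_mem hw' hw) hx,
    actCur_tmul hw hx, actCur_tmul hw' hx, map_smul, TensorProduct.tmul_sub,
    TensorProduct.tmul_smul, add_mul, sgn_add] at e ⊢
  linear_combination (norm := module) e

variable [LieSuperalgebra g]

/-- The bracket of `g ⊗ 𝒜`: `[x ⊗ a, y ⊗ b] = (-1) ^ (|a| |y|) [x, y] ⊗ a b`. -/
def brCur : g ⊗[ℂ] A →ₗ[ℂ] g ⊗[ℂ] A →ₗ[ℂ] g ⊗[ℂ] A :=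
  ∑ p : ZMod 2, ∑ q : ZMod 2, sgn (p * q) •
    TensorProduct.map₂ ((br (L := g)).compl₂ (proj q)) (LinearMap.mul ℂ A ∘ₗ proj p)

theorem brCur_tmul {p q : ZMod 2} (x : g) {y : g} {a : A} (ha : a ∈ (part p : Submodule ℂ A))
    (hy : y ∈ (part q : Submodule ℂ g)) (b : A) :
    brCur (x ⊗ₜ[ℂ] a) (y ⊗ₜ[ℂ] b) = sgn (p * q) • br x y ⊗ₜ[ℂ] (a * b) := by
  rcases parity_cases p with rfl | rfl <;> rcases parity_cases q with rfl | rfl <;>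
    simp [brCur, sum_parity, proj_of_mem ha, proj_of_mem hy]

theorem brCur_mem {p q : ZMod 2} {u v : g ⊗[ℂ] A}
    (hu : u ∈ (part p : Submodule ℂ (g ⊗[ℂ] A))) (hv : v ∈ (part q : Submodule ℂ (g ⊗[ℂ] A))) :
    brCur u v ∈ (part (p + q) : Submodule ℂ (g ⊗[ℂ] A)) := by
  rw [← LinearMap.flip_apply]
  refine map_mem_of_part_tensor (brCur.flip v) (fun i j hij x hx a ha => ?_) hu
  rw [LinearMap.flip_apply]
  refine map_mem_of_part_tensor (brCur (x ⊗ₜ a)) (fun k l hkl y hy b hb => ?_) hv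
  subst hij hkl
  rw [brCur_tmul x ha hy]
  have := tmul_mem (LieSuperalgebra.br_mem hx hy) (A.mul_mem ha hb)
  rw [show i + k + (j + l) = i + j + (k + l) by ring] at this
  exact Submodule.smul_mem _ _ this

theorem brCur_skew {p q : ZMod 2} {u v : g ⊗[ℂ] A}
    (hu : u ∈ (part p : Submodule ℂ (g ⊗[ℂ] A))) (hv : v ∈ (part q : Submodule ℂ (g ⊗[ℂ] A))) :
    brCur u v = -(sgn (p * q) • brCur v u) := by
  rw [← LinearMap.flip_apply (f := brCur), ← LinearMap.smul_apply, ← LinearMap.neg_apply]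
  refine eq_on_part_tensor (f := brCur.flip v) (g := -(sgn (p * q) • brCur v))
    (fun i j hij x hx a ha => ?_) hu
  simp only [LinearMap.flip_apply, LinearMap.smul_apply, LinearMap.neg_apply]
  have key := eq_on_part_tensor (f := brCur (x ⊗ₜ[ℂ] a))
    (g := -(sgn (p * q) • brCur.flip (x ⊗ₜ[ℂ] a))) (fun k l hkl y hy b hb => ?_) hv
  · simpa only [LinearMap.flip_apply, LinearMap.smul_apply, LinearMap.neg_apply] using key
  subst hij hkl
  simp only [LinearMap.neg_apply, LinearMap.smul_apply, LinearMap.flip_apply, brCur_tmul x ha hy,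
    brCur_tmul y hb hx, LieSuperalgebra.br_skew hx hy, A.mul_comm_super ha hb,
    TensorProduct.neg_tmul, ← TensorProduct.smul_tmul', TensorProduct.tmul_smul, mul_add, add_mul,
    sgn_add]
  rw [mul_comm l i]
  have h1 := sgn_mul_self (i * k)
  have h2 := sgn_mul_self (j * k)
  have h3 := sgn_mul_self (i * l)
  match_scalars
  grind

theorem actCur_brCur {p q r : ZMod 2} {w : Witt} {u v : g ⊗[ℂ] A}
    (hw : w ∈ (part p : Submodule ℂ Witt)) (hu : u ∈ (part q : Submodule ℂ (g ⊗[ℂ] A)))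
    (hv : v ∈ (part r : Submodule ℂ (g ⊗[ℂ] A))) :
    actCur w (brCur u v) = brCur (actCur w u) v + sgn (p * q) • brCur u (actCur w v) := by
  have key := eq_on_part_tensor (f := (actCur w) ∘ₗ brCur.flip v)
    (g := brCur.flip v ∘ₗ actCur w + sgn (p * q) • brCur.flip (actCur w v))
    (fun i j hij x hx a ha => ?_) hu
  · simpa only [LinearMap.flip_apply, LinearMap.smul_apply, LinearMap.add_apply,
      LinearMap.comp_apply] using key
  simp only [LinearMap.flip_apply, LinearMap.smul_apply, LinearMap.add_apply, LinearMap.comp_apply]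
  have key := eq_on_part_tensor (f := (actCur w) ∘ₗ brCur (x ⊗ₜ[ℂ] a))
    (g := brCur (actCur w (x ⊗ₜ[ℂ] a)) + sgn (p * q) • brCur (x ⊗ₜ[ℂ] a) ∘ₗ actCur w)
    (fun k l hkl y hy b hb => ?_) hv
  · simpa only [LinearMap.flip_apply, LinearMap.smul_apply, LinearMap.add_apply,
      LinearMap.comp_apply] using key
  subst hij hkl
  simp only [LinearMap.smul_apply, LinearMap.add_apply, LinearMap.comp_apply, brCur_tmul x ha hy,
    map_smul, actCur_tmul hw (LieSuperalgebra.br_mem hx hy), actCur_tmul hw hx, actCur_tmul hw hy,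
    brCur_tmul x (Witt.act_mem hw ha) hy, Witt.act_mul hw ha, TensorProduct.tmul_add,
    TensorProduct.tmul_smul, mul_add, add_mul, sgn_add]
  have h1 := sgn_mul_self (p * k)
  match_scalars <;> grind

theorem brCur_jacobi {p q r : ZMod 2} {u v w : g ⊗[ℂ] A}
    (hu : u ∈ (part p : Submodule ℂ (g ⊗[ℂ] A))) (hv : v ∈ (part q : Submodule ℂ (g ⊗[ℂ] A)))
    (hw : w ∈ (part r : Submodule ℂ (g ⊗[ℂ] A))) :
    brCur u (brCur v w) = brCur (brCur u v) w + sgn (p * q) • brCur v (brCur u w) := by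
  have key := eq_on_part_tensor (f := brCur.flip (brCur v w))
    (g := brCur.flip w ∘ₗ brCur.flip v + sgn (p * q) • brCur v ∘ₗ brCur.flip w)
    (fun i j hij x hx a ha => ?_) hu
  · simpa only [LinearMap.flip_apply, LinearMap.smul_apply, LinearMap.add_apply,
      LinearMap.comp_apply] using key
  simp only [LinearMap.flip_apply, LinearMap.smul_apply, LinearMap.add_apply, LinearMap.comp_apply]
  have key := eq_on_part_tensor (f := brCur (x ⊗ₜ[ℂ] a) ∘ₗ brCur.flip w)
    (g := brCur.flip w ∘ₗ brCur (x ⊗ₜ[ℂ] a) + sgn (p * q) • brCur.flip (brCur (x ⊗ₜ[ℂ] a) w))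
    (fun k l hkl y hy b hb => ?_) hv
  · simpa only [LinearMap.flip_apply, LinearMap.smul_apply, LinearMap.add_apply,
      LinearMap.comp_apply] using key
  simp only [LinearMap.flip_apply, LinearMap.smul_apply, LinearMap.add_apply, LinearMap.comp_apply]
  have key := eq_on_part_tensor (f := brCur (x ⊗ₜ[ℂ] a) ∘ₗ brCur (y ⊗ₜ[ℂ] b))
    (g := brCur (brCur (x ⊗ₜ[ℂ] a) (y ⊗ₜ[ℂ] b)) +
      sgn (p * q) • brCur (y ⊗ₜ[ℂ] b) ∘ₗ brCur (x ⊗ₜ[ℂ] a))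
    (fun m n hmn z hz c hc => ?_) hw
  · simpa only [LinearMap.flip_apply, LinearMap.smul_apply, LinearMap.add_apply,
      LinearMap.comp_apply] using key
  subst hij hkl
  have e : b * (a * c) = sgn (j * l) • (a * (b * c)) := by
    rw [← mul_assoc, A.mul_comm_super hb ha, mul_comm l j, smul_mul_assoc, mul_assoc]
  simp only [LinearMap.smul_apply, LinearMap.add_apply, LinearMap.comp_apply, brCur_tmul x ha hy,
    brCur_tmul y hb hz, brCur_tmul x ha hz, map_smul,
    brCur_tmul x ha (LieSuperalgebra.br_mem hy hz), brCur_tmul y hb (LieSuperalgebra.br_mem hx hz),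
    brCur_tmul (br x y) (A.mul_mem ha hb) hz, e, LieSuperalgebra.br_jacobi hx hy z, mul_assoc a b c,
    TensorProduct.add_tmul, ← TensorProduct.smul_tmul', TensorProduct.tmul_smul, mul_add, add_mul,
    sgn_add]
  rw [mul_comm l i]
  have h1 := sgn_mul_self (i * l)
  have h2 := sgn_mul_self (j * l)
  have h3 := sgn_mul_self (j * k)
  match_scalars <;> grind

end current

/-- The Lie superalgebra `𝒲 ⋉ ((g ⊗ 𝒜) ⊕ 𝒜)`. Its subalgebra of elements with zero
last component is `ℒ = 𝒲 ⋉ (g ⊗ 𝒜)`. -/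
abbrev LTilde (g : Type*) [AddCommGroup g] [Module ℂ g] : Type _ := Witt × (g ⊗[ℂ] A) × A

namespace LTilde
variable (g : Type*) [AddCommGroup g] [Module ℂ g] [SuperSpace g]

/-- `𝒲` acting on `𝒲 = 𝒜 Δ` (through the coefficients), on `g ⊗ 𝒜` and on `𝒜`. -/
def left : LTilde g →ₗ[ℂ] LTilde g →ₗ[ℂ] LTilde g :=
  LinearMap.mk₂ ℂ (fun X Y => (Witt.actW X.1 Y.1, actCur X.1 Y.2.1, Witt.act X.1 Y.2.2))
    (by intros; simp) (by intros; simp) (by intros; simp) (by intros; simp)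

variable {g} in
theorem left_apply (X Y : LTilde g) :
    left g X Y = (Witt.actW X.1 Y.1, actCur X.1 Y.2.1, Witt.act X.1 Y.2.2) := rfl

variable [LieSuperalgebra g]

/-- The bracket of the current components. -/
def cur : LTilde g →ₗ[ℂ] LTilde g →ₗ[ℂ] LTilde g :=
  LinearMap.mk₂ ℂ (fun X Y => (0, brCur X.2.1 Y.2.1, 0))
    (by intros; simp) (by intros; simp) (by intros; simp) (by intros; simp)

variable {g} in
theorem cur_apply (X Y : LTilde g) : cur g X Y = (0, brCur X.2.1 Y.2.1, 0) := rfl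

/-- For homogeneous `X = w + u + f` and `Y = w' + u' + f'` the bracket is
`[X, Y] = (w(Y) - (-1) ^ (|X| |Y|) w'(X)) + [u, u']`, where `w` acts on `𝒲` through
the coefficients, which gives
`[f ∂, f' ∂'] = f ∂(f') ∂' - (-1) ^ (|f ∂| |f' ∂'|) f' ∂'(f) ∂` on `𝒲`. -/
instance : LieSuperalgebra (LTilde g) :=
  lieOfLeftSymm (left g) (cur g)
    (fun hx hy => ⟨Witt.actW_mem hx.1 hy.1, actCur_mem hx.1 hy.2.1, Witt.act_mem hx.1 hy.2.2⟩)
    (fun hx hy => ⟨Submodule.zero_mem _, brCur_mem hx.2.1 hy.2.1, Submodule.zero_mem _⟩)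
    (fun hx hy => by simp [cur_apply, ← brCur_skew hx.2.1 hy.2.1])
    (fun hx hy hz => by simp [cur_apply, brCur_jacobi hx.2.1 hy.2.1 hz.2.1])
    (fun x y z => by simp [cur_apply, left_apply])
    (fun hx hy hz => by simp [cur_apply, left_apply, actCur_brCur hx.1 hy.2.1 hz.2.1])
    (fun {p q r x y z} hx hy hz => by
      refine Prod.ext (Witt.ext ?_ ?_) (Prod.ext ?_ ?_)
      · simpa using! Witt.act_symm hx.1 hy.1 (Witt.coeffD z.1)
      · simpa using! Witt.act_symm hx.1 hy.1 (Witt.coeffξ z.1)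
      · exact actCur_symm hx.1 hy.1 hz.2.1
      · exact Witt.act_symm hx.1 hy.1 z.2.2)

theorem br_def (X Y : LTilde g) : br X Y = superComm (left g) X Y + cur g X Y := rfl

end LTilde

section elements
variable {g : Type*} [AddCommGroup g] [Module ℂ g]

/-- `d_i = t ^ (i + 1) ∂/∂t`. -/
def d (i : ℤ) : LTilde g := (Witt.mk (A.t i) 0, 0, 0)

/-- `h_i = t ^ i ξ ∂/∂ξ`. -/
def h (i : ℤ) : LTilde g := (Witt.mk 0 (A.tξ i), 0, 0)

/-- `Q_i = t ^ i ∂/∂ξ`. -/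
def Q (i : ℤ) : LTilde g := (Witt.mk 0 (A.t i), 0, 0)

/-- `G_i = t ^ (i + 1) ξ ∂/∂t`. -/
def G (i : ℤ) : LTilde g := (Witt.mk (A.tξ i) 0, 0, 0)

/-- The element `x ⊗ a`. -/
def curr (x : g) (a : A) : LTilde g := (0, x ⊗ₜ[ℂ] a, 0)

/-- The element `a` of the abelian summand `𝒜`. -/
def fn (a : A) : LTilde g := (0, 0, a)

end elements

/-- The maximal ideal of `𝒜` generated by `t - 1` and `ξ`. -/
def 𝔪 : Ideal A := Ideal.span {A.t 1 - 1, A.tξ 0}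

theorem proj_one_mem_𝔪 (a : A) : proj 1 a ∈ 𝔪 := by
  have h1 : (proj 1 a).fst = 0 := A.mem_part_one.1 (proj_mem 1 a)
  have : proj 1 a = TrivSqZeroExt.inl (proj 1 a).snd * A.tξ 0 :=
    TrivSqZeroExt.ext (by simp [A.tξ, h1]) (by simp [A.tξ])
  rw [this]
  exact Ideal.mul_mem_left _ _ (Ideal.subset_span (by simp))

theorem proj_mem_𝔪 {a : A} (ha : a ∈ 𝔪) (p : ZMod 2) : proj p a ∈ 𝔪 := by
  rcases parity_cases p with rfl | rfl
  · rw [eq_sub_of_add_eq (proj_add_proj a)]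
    exact sub_mem ha (proj_one_mem_𝔪 a)
  · exact proj_one_mem_𝔪 a

theorem tξ_mem_𝔪 (i : ℤ) : A.tξ i ∈ 𝔪 := by
  have : A.tξ i = A.t i * A.tξ 0 := TrivSqZeroExt.ext (by simp [A.t, A.tξ]) (by simp [A.t, A.tξ])
  rw [this]
  exact Ideal.mul_mem_left _ _ (Ideal.subset_span (by simp))

theorem t_sub_mem_𝔪 (i : ℤ) : A.t i - A.t 0 ∈ 𝔪 := by
  have h1 : A.t 1 - 1 ∈ 𝔪 := Ideal.subset_span (by simp)
  have t0 : A.t 0 = 1 := by simp [A.t]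
  have hadd : ∀ i j, A.t (i + j) = A.t i * A.t j := fun i j => by
    rw [A.t, LaurentPolynomial.T_add, TrivSqZeroExt.inl_mul]; rfl
  induction i using Int.induction_on with
  | zero => simp
  | succ i ih =>
    have : A.t (i + 1) - A.t 0 = A.t i * (A.t 1 - 1) + (A.t i - A.t 0) := by rw [hadd]; ring
    rw [this]
    exact add_mem (Ideal.mul_mem_left _ _ h1) ih
  | pred i ih =>
    have e : A.t (-i) = A.t (-i - 1) * A.t 1 := by rw [← hadd]; ring_nf
    have : A.t (-i - 1) - A.t 0 = A.t (-i) - A.t 0 - A.t (-i - 1) * (A.t 1 - 1) := by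
      rw [e]; ring
    rw [this]
    exact sub_mem ih (Ideal.mul_mem_left _ _ h1)

section a0
variable (g : Type*) [AddCommGroup g] [Module ℂ g]

/-- `𝔞₀ = 𝔪 Δ ⋉ (g ⊗ 𝒜)`. -/
def a0 : Submodule ℂ (LTilde g) where
  carrier := {X | Witt.coeffD X.1 ∈ 𝔪 ∧ Witt.coeffξ X.1 ∈ 𝔪 ∧ X.2.2 = 0}
  zero_mem' := by simp
  add_mem' := by
    rintro X Y ⟨h1, h2, h3⟩ ⟨h4, h5, h6⟩
    refine ⟨?_, ?_, ?_⟩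
    · simpa using add_mem h1 h4
    · simpa using add_mem h2 h5
    · simp [h3, h6]
  smul_mem' := by
    rintro c X ⟨h1, h2, h3⟩
    refine ⟨?_, ?_, ?_⟩
    · simpa using Submodule.smul_of_tower_mem 𝔪 c h1
    · simpa using Submodule.smul_of_tower_mem 𝔪 c h2
    · simp [h3]

variable {g}

theorem mem_a0 {X : LTilde g} :
    X ∈ a0 g ↔ Witt.coeffD X.1 ∈ 𝔪 ∧ Witt.coeffξ X.1 ∈ 𝔪 ∧ X.2.2 = 0 := Iff.rfl

namespace a0

/-- `d_i - d_0`. -/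
def dd (i : ℤ) : a0 g := ⟨d i - d 0, by simpa [mem_a0, d] using t_sub_mem_𝔪 i⟩

/-- `Q_i - Q_0`. -/
def QQ (i : ℤ) : a0 g := ⟨Q i - Q 0, by simpa [mem_a0, Q] using t_sub_mem_𝔪 i⟩

/-- `h_i`. -/
def hh (i : ℤ) : a0 g := ⟨h i, by simpa [mem_a0, h] using tξ_mem_𝔪 i⟩

/-- `G_i`. -/
def GG (i : ℤ) : a0 g := ⟨G i, by simpa [mem_a0, G] using tξ_mem_𝔪 i⟩

/-- `x ⊗ a`. -/
def cc (x : g) (a : A) : a0 g := ⟨curr x a, by simp [mem_a0, curr]⟩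

theorem cc_add (x y : g) (a : A) : cc (x + y) a = cc x a + cc y a :=
  Subtype.ext (by simp [cc, curr, TensorProduct.add_tmul])

theorem cc_smul (c : ℂ) (x : g) (a : A) : cc (c • x) a = c • cc x a :=
  Subtype.ext (by simp [cc, curr, TensorProduct.smul_tmul'])

variable [SuperSpace g]

theorem exists_parts {X : LTilde g} (hX : X ∈ a0 g) : ∃ X₀ ∈ a0 g, ∃ X₁ ∈ a0 g,
    X₀ ∈ (part 0 : Submodule ℂ (LTilde g)) ∧ X₁ ∈ (part 1 : Submodule ℂ (LTilde g)) ∧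
      X₀ + X₁ = X := by
  obtain ⟨w, u, f⟩ := X
  obtain ⟨h1, h2, h3⟩ := hX
  refine ⟨(Witt.mk (proj 0 (Witt.coeffD w)) (proj 1 (Witt.coeffξ w)), proj 0 u, 0),
    ⟨proj_mem_𝔪 h1 0, proj_mem_𝔪 h2 1, rfl⟩,
    (Witt.mk (proj 1 (Witt.coeffD w)) (proj 0 (Witt.coeffξ w)), proj 1 u, 0),
    ⟨proj_mem_𝔪 h1 1, proj_mem_𝔪 h2 0, rfl⟩,
    ⟨⟨proj_mem 0 (Witt.coeffD w), proj_mem 1 (Witt.coeffξ w)⟩, proj_mem 0 u,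
      Submodule.zero_mem _⟩,
    ⟨⟨proj_mem 1 (Witt.coeffD w), proj_mem 0 (Witt.coeffξ w)⟩, proj_mem 1 u,
      Submodule.zero_mem _⟩, ?_⟩
  refine Prod.ext (Witt.ext ?_ ?_) (Prod.ext ?_ ?_)
  · simp [proj_add_proj]
  · simp [add_comm (proj 1 (Witt.coeffξ w)), proj_add_proj]
  · simp [proj_add_proj]
  · simpa using h3.symm

theorem proj_mem_a0 {X : LTilde g} (hX : X ∈ a0 g) (p : ZMod 2) : proj p X ∈ a0 g := by
  obtain ⟨X₀, m₀, X₁, m₁, h₀, h₁, rfl⟩ := exists_parts hX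
  rw [map_add, proj_of_mem h₀, proj_of_mem h₁]
  split_ifs <;> simp [*]

instance : SuperSpace (a0 g) where
  part p := (part p).comap (a0 g).subtype
  isCompl_part := by
    constructor
    · refine (Submodule.disjoint_def).2 fun X h0 h1 => Subtype.ext ?_
      exact (Submodule.disjoint_def).1 (SuperSpace.isCompl_part (V := LTilde g)).disjoint _ h0 h1
    · rw [codisjoint_iff, eq_top_iff]
      rintro ⟨X, hX⟩ _
      obtain ⟨X₀, m₀, X₁, m₁, h₀, h₁, rfl⟩ := exists_parts hX
      exact Submodule.add_mem_sup (s := (⟨X₀, m₀⟩ : a0 g)) (t := (⟨X₁, m₁⟩ : a0 g)) h₀ h₁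

variable [LieSuperalgebra g]

theorem br_mem_a0 {X Y : LTilde g} (hX : X ∈ a0 g) (hY : Y ∈ a0 g) : br X Y ∈ a0 g := by
  have key : ∀ {X Y : LTilde g}, X ∈ a0 g → Y ∈ a0 g → LTilde.left g X Y ∈ a0 g := by
    intro X Y hX hY
    refine ⟨?_, ?_, ?_⟩
    · exact add_mem (Ideal.mul_mem_right _ _ hX.1) (Ideal.mul_mem_right _ _ hX.2.1)
    · exact add_mem (Ideal.mul_mem_right _ _ hX.1) (Ideal.mul_mem_right _ _ hX.2.1)
    · simp [LTilde.left_apply, hY.2.2]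
  rw [LTilde.br_def]
  refine add_mem ?_ (by simp [mem_a0, LTilde.cur_apply])
  have := fun p q => key (proj_mem_a0 hX p) (proj_mem_a0 hY q)
  have := fun p q => key (proj_mem_a0 hY p) (proj_mem_a0 hX q)
  simp only [superComm, sum_parity, LinearMap.add_apply, LinearMap.sub_apply,
    LinearMap.smul_apply, LinearMap.flip_apply, LinearMap.compl₁₂_apply]
  refine add_mem (add_mem ?_ ?_) (add_mem ?_ ?_) <;>
    exact sub_mem (by simp [*]) (Submodule.smul_mem _ _ (by simp [*]))

/-- `𝔞₀` is a Lie superalgebra, with the bracket restricted from `𝒲 ⋉ ((g ⊗ 𝒜) ⊕ 𝒜)`. -/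
instance : LieSuperalgebra (a0 g) where
  br := LinearMap.mk₂ ℂ (fun X Y => ⟨br (X : LTilde g) (Y : LTilde g), br_mem_a0 X.2 Y.2⟩)
    (by intros; ext1; simp) (by intros; ext1; simp) (by intros; ext1; simp)
    (by intros; ext1; simp)
  br_mem hx hy := LieSuperalgebra.br_mem (L := LTilde g) hx hy
  br_skew hx hy := Subtype.ext (LieSuperalgebra.br_skew (L := LTilde g) hx hy)
  br_jacobi hx hy z := Subtype.ext (LieSuperalgebra.br_jacobi (L := LTilde g) hx hy (z : LTilde g))

end a0
end a0

/-- A Lie superalgebra is perfect if it is spanned by brackets. -/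
def IsPerfect (L : Type*) [AddCommGroup L] [Module ℂ L] [SuperSpace L] [LieSuperalgebra L] :
    Prop :=
  Submodule.span ℂ {z : L | ∃ x y : L, z = br x y} = ⊤

section modules
variable {L V V' : Type*} [AddCommGroup L] [Module ℂ L] [SuperSpace L] [LieSuperalgebra L]
  [AddCommGroup V] [Module ℂ V] [SuperSpace V] [AddCommGroup V'] [Module ℂ V'] [SuperSpace V']

/-- The linear map `ρ` makes the super vector space `V` a module over the Lie superalgebra `L`. -/
structure IsRep (ρ : L →ₗ[ℂ] Module.End ℂ V) : Prop where
  map_part : ∀ {p q : ZMod 2} {x : L} {v : V}, x ∈ (part p : Submodule ℂ L) →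
    v ∈ (part q : Submodule ℂ V) → ρ x v ∈ (part (p + q) : Submodule ℂ V)
  map_br : ∀ {p q : ZMod 2} {x y : L}, x ∈ (part p : Submodule ℂ L) →
    y ∈ (part q : Submodule ℂ L) → ∀ v : V,
      ρ (br x y) v = ρ x (ρ y v) - sgn (p * q) • ρ y (ρ x v)

/-- A module is simple if it is nonzero and has no nonzero proper graded submodule. -/
def IsSimpleRep (ρ : L →ₗ[ℂ] Module.End ℂ V) : Prop :=
  Nontrivial V ∧ ∀ N : Submodule ℂ V, (∀ p, ∀ v ∈ N, proj p v ∈ N) →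
    (∀ x, ∀ v ∈ N, ρ x v ∈ N) → N = ⊥ ∨ N = ⊤

/-- Isomorphism of modules: a linear bijection that preserves parity and commutes with the
actions. -/
def IsoRep (ρ : L →ₗ[ℂ] Module.End ℂ V) (ρ' : L →ₗ[ℂ] Module.End ℂ V') : Prop :=
  ∃ e : V ≃ₗ[ℂ] V',
    (∀ p, ∀ v ∈ (part p : Submodule ℂ V), e v ∈ (part p : Submodule ℂ V')) ∧
    ∀ x v, e (ρ x v) = ρ' x (e v)

end modules

section ALmodules
variable {g : Type*} [AddCommGroup g] [Module ℂ g] [SuperSpace g] [LieSuperalgebra g]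
  {M : Type*} [AddCommGroup M] [Module ℂ M]

/-- `𝒜ℒ`-modules: modules over `𝒲 ⋉ ((g ⊗ 𝒜) ⊕ 𝒜)` on which `𝒜` acts associatively. -/
structure IsALModule [SuperSpace M] (σ : LTilde g →ₗ[ℂ] Module.End ℂ M) : Prop extends
    IsRep σ where
  one_act : ∀ v, σ (fn 1) v = v
  mul_act : ∀ (a b : A) (v : M), σ (fn (a * b)) v = σ (fn a) (σ (fn b) v)

/-- A weight module: `d_0` acts diagonalizably. (Eigenspaces are always independent, so it is
enough that they span.) -/
def IsWeight (σ : LTilde g →ₗ[ℂ] Module.End ℂ M) : Prop :=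
  ⨆ μ : ℂ, Module.End.eigenspace (σ (d 0)) μ = ⊤

/-- The support of a module: the set of its weights. -/
def supp (σ : LTilde g →ₗ[ℂ] Module.End ℂ M) : Set ℂ :=
  {μ | Module.End.eigenspace (σ (d 0)) μ ≠ ⊥}

end ALmodules

section gamma
variable {g : Type*} [AddCommGroup g] [Module ℂ g]
  {V : Type*} [AddCommGroup V] [Module ℂ V]

/-- For an operator `β` of parity `p` on `V`: the operator
`a ⊗ v ↦ (-1) ^ (p |a|) c a ⊗ β v` on `𝒜 ⊗ V`. -/
def tw (p : ZMod 2) (c : A) (β : Module.End ℂ V) : Module.End ℂ (A ⊗[ℂ] V) :=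
  TensorProduct.map (LinearMap.mulLeft ℂ c ∘ₗ (proj 0 + sgn p • proj 1)) β

theorem tw_add (p : ZMod 2) (c : A) (β β' : Module.End ℂ V) :
    tw p c (β + β') = tw p c β + tw p c β' := TensorProduct.map_add_right _ _ _

theorem tw_smul (p : ZMod 2) (c : A) (r : ℂ) (β : Module.End ℂ V) :
    tw p c (r • β) = r • tw p c β := TensorProduct.map_smul_right _ _ _

/-- The operator `a ⊗ v ↦ α a ⊗ v` on `𝒜 ⊗ V`. -/
def onA (α : Module.End ℂ A) : Module.End ℂ (A ⊗[ℂ] V) := TensorProduct.map α LinearMap.id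

namespace Gamma
variable (lam : ℂ) (ρ : a0 g →ₗ[ℂ] Module.End ℂ V)

/-- The action of `d_i`:
`a ⊗ v ↦ t ^ i a ⊗ (d_i - d_0) v + t ^ i (λ a + d_0 a) ⊗ v`. -/
def opd (i : ℤ) : Module.End ℂ (A ⊗[ℂ] V) :=
  tw 0 (A.t i) (ρ (a0.dd i)) +
    onA (LinearMap.mulLeft ℂ (A.t i) ∘ₗ (lam • LinearMap.id + A.D))

/-- The action of `Q_i`:
`a ⊗ v ↦ (-1) ^ |a| t ^ i a ⊗ (Q_i - Q_0) v + t ^ i Q_0(a) ⊗ v`. -/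
def opQ (i : ℤ) : Module.End ℂ (A ⊗[ℂ] V) :=
  tw 1 (A.t i) (ρ (a0.QQ i)) + onA (LinearMap.mulLeft ℂ (A.t i) ∘ₗ A.dξ)

/-- The action of `h_i`:
`a ⊗ v ↦ t ^ i a ⊗ h_i v + (-1) ^ |a| t ^ i ξ a ⊗ (Q_i - Q_0) v + t ^ i ξ Q_0(a) ⊗ v`. -/
def oph (i : ℤ) : Module.End ℂ (A ⊗[ℂ] V) :=
  tw 0 (A.t i) (ρ (a0.hh i)) + tw 1 (A.tξ i) (ρ (a0.QQ i)) +
    onA (LinearMap.mulLeft ℂ (A.tξ i) ∘ₗ A.dξ)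

/-- The action of `G_i`:
`a ⊗ v ↦ (-1) ^ |a| t ^ i a ⊗ G_i v + t ^ i ξ a ⊗ (d_i - d_0) v + t ^ i ξ (λ a + d_0 a) ⊗ v`. -/
def opG (i : ℤ) : Module.End ℂ (A ⊗[ℂ] V) :=
  tw 1 (A.t i) (ρ (a0.GG i)) + tw 0 (A.tξ i) (ρ (a0.dd i)) +
    onA (LinearMap.mulLeft ℂ (A.tξ i) ∘ₗ (lam • LinearMap.id + A.D))

/-- The action of `x ⊗ t ^ i` for `x` of parity `p`:
`a ⊗ v ↦ (-1) ^ (|a| p) t ^ i a ⊗ (x ⊗ t ^ i) v`. -/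
def opx (p : ZMod 2) (x : g) (i : ℤ) : Module.End ℂ (A ⊗[ℂ] V) :=
  tw p (A.t i) (ρ (a0.cc x (A.t i)))

/-- The action of `x ⊗ t ^ i ξ` for `x` of parity `p`:
`a ⊗ v ↦ (-1) ^ ((|a| + 1) p) t ^ i ξ a ⊗ (x ⊗ t ^ i) v
  + (-1) ^ (|a| (p + 1)) t ^ i a ⊗ (x ⊗ t ^ i ξ) v`. -/
def opxξ (p : ZMod 2) (x : g) (i : ℤ) : Module.End ℂ (A ⊗[ℂ] V) :=
  sgn p • tw p (A.tξ i) (ρ (a0.cc x (A.t i))) + tw (p + 1) (A.t i) (ρ (a0.cc x (A.tξ i)))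

/-- The action of the elements `x ⊗ a` with `x` of parity `p`, as a bilinear map of `x` and `a`. -/
def opcur (p : ZMod 2) : g →ₗ[ℂ] A →ₗ[ℂ] Module.End ℂ (A ⊗[ℂ] V) where
  toFun x := A.lift (opx ρ p x) (opxξ ρ p x)
  map_add' x y := by
    refine A.hom_ext (E := Module.End ℂ (A ⊗[ℂ] V)) (fun i => ?_) (fun i => ?_)
    · simp only [LinearMap.add_apply, A.lift_t, opx, a0.cc_add, map_add, tw_add]
    · simp only [LinearMap.add_apply, A.lift_tξ, opxξ, a0.cc_add, map_add, tw_add, smul_add]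
      abel
  map_smul' c x := by
    refine A.hom_ext (E := Module.End ℂ (A ⊗[ℂ] V)) (fun i => ?_) (fun i => ?_)
    · simp only [LinearMap.smul_apply, A.lift_t, opx, a0.cc_smul, map_smul, tw_smul,
        RingHom.id_apply]
    · simp only [LinearMap.smul_apply, A.lift_tξ, opxξ, a0.cc_smul, map_smul, tw_smul, smul_add,
        smul_comm c (sgn p), RingHom.id_apply]

end Gamma

variable [SuperSpace g]

/-- The `𝒜ℒ`-module `Γ(λ, V) = 𝒜 ⊗ V` of an `𝔞₀`-module `V`. It is the module `𝒜(λ) ⊗ V` over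
`𝒦 ⊗ U(𝔞₀)` (`𝒦` the super Weyl algebra, acting on `𝒜` with `d_0` acting as `λ + t ∂/∂t`)
regarded as an `𝒜ℒ`-module: `𝒜`, `d_0`, `Q_0` act on `𝒜(λ)`, and the elements
`t ^ (-i) d_i - d_0`, `t ^ (-i) Q_i - Q_0`, `t ^ (-i) h_i - t ^ (-i) ξ Q_i`,
`t ^ (-i) G_i - t ^ (-i) ξ d_i`, `t ^ (-i) (x ⊗ t ^ i)` and
`t ^ (-i) (x ⊗ t ^ i ξ) - (-1) ^ |x| t ^ (-i) ξ (x ⊗ t ^ i)` act on `V` as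
`d_i - d_0`, `Q_i - Q_0`, `h_i`, `G_i`, `x ⊗ t ^ i` and `x ⊗ t ^ i ξ`. -/
def Gamma (lam : ℂ) (ρ : a0 g →ₗ[ℂ] Module.End ℂ V) :
    LTilde g →ₗ[ℂ] Module.End ℂ (A ⊗[ℂ] V) :=
  (A.lift (Gamma.opd lam ρ) (Gamma.opG lam ρ) ∘ₗ Witt.coeffD +
      A.lift (Gamma.opQ ρ) (Gamma.oph ρ) ∘ₗ Witt.coeffξ) ∘ₗ
      LinearMap.fst ℂ Witt ((g ⊗[ℂ] A) × A) +
    (∑ p : ZMod 2, TensorProduct.lift (Gamma.opcur ρ p ∘ₗ proj p)) ∘ₗ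
      LinearMap.fst ℂ (g ⊗[ℂ] A) A ∘ₗ LinearMap.snd ℂ Witt ((g ⊗[ℂ] A) × A) +
    (TensorProduct.mapBilinear (.id ℂ) A V A V).flip LinearMap.id ∘ₗ LinearMap.mul ℂ A ∘ₗ
      LinearMap.snd ℂ (g ⊗[ℂ] A) A ∘ₗ LinearMap.snd ℂ Witt ((g ⊗[ℂ] A) × A)

end gamma

end

end SuperAffine

open SuperAffine

set_option autoImplicit false

/-! In an `𝒜ℒ`-module the operators of `𝒜`, `d_0` and `Q_0` form a super Weyl algebra, `d_0` and
`Q_0` acting as `t ∂/∂t` and `∂/∂ξ`. The point of the proof is that what remains of the action is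
exactly a commuting action of `𝔞₀`.

Let `δ = a t ∂/∂t + b ∂/∂ξ + x` be a constant vector and `∂` its derivation part. The operators `t ^
(-i) (t ^ i δ) - ∂` and `t ^ (-i) (t ^ i ξ δ) - t ^ (-i) ξ (t ^ i δ)` supercommute with the Weyl
algebra, and they satisfy the relations of `t ^ i δ - ∂` and `t ^ i ξ δ` in `𝔞₀`. Conversely, an
action of the Weyl algebra and a supercommuting action `T` of `𝔞₀` determine an `𝒜ℒ`-module by
solving for `t ^ i δ` and `t ^ i ξ δ`. The structure `IsTwist` records this dictionary. That
brackets are respected on one side exactly when they are on the other follows from identities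
expressing the failure for `σ` triangularly through the failure for `T` (`defect_even_even`,
`defect_even_odd`, `defect_odd_odd`), since `t ^ i` is invertible.

`Γ(λ, V)` is the case where the Weyl algebra acts on the factor `𝒜`, with `d_0` shifted by `λ`, and
`𝔞₀` acts on `V` (`Gamma.isTwist`). The weight spaces of `𝒜` are spanned by `t ^ k` and `t ^ k ξ`,
so a nonzero subspace stable under the Weyl algebra contains a weight vector, which `∂/∂ξ` and `t ^
(-k)` turn into some `1 ⊗ v ≠ 0`. Hence the submodules of `Γ(λ, V)` are controlled by those of `V`,
and simplicity passes in both directions.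

For a simple weight module `M`, let `N` be the space of vectors of a weight `λ` killed by `Q_0`. It
is nonzero since `Q_0 ^ 2 = 0`, and it is stable under `𝔞₀`. The map `𝒜 ⊗ N → M`, `a ⊗ v ↦ a v`, is
injective by the same weight argument and surjective by simplicity, so `M ≅ Γ(λ, N)`. -/

namespace SuperAffine
noncomputable section
open SuperAffine.SuperSpace (part)
open SuperAffine.LieSuperalgebra (br)

/-! ### Monomials of `𝒜`, their products and derivatives, and evaluation at `t = 1`, `ξ = 0`. -/

namespace A

theorem t_zero : t 0 = 1 := by simp [t]

theorem t_mul (i j : ℤ) : t i * t j = t (i + j) := by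
  rw [t, t, ← TrivSqZeroExt.inl_mul, ← LaurentPolynomial.T_add]; rfl

theorem t_mul_tξ (i j : ℤ) : t i * tξ j = tξ (i + j) := by
  rw [t, tξ, TrivSqZeroExt.inl_mul_inr, smul_eq_mul, ← LaurentPolynomial.T_add]; rfl

theorem tξ_mul_t (i j : ℤ) : tξ i * t j = tξ (i + j) := by
  rw [mul_comm, t_mul_tξ, add_comm]

theorem tξ_mul_tξ (i j : ℤ) : tξ i * tξ j = 0 := by
  simp [tξ]

theorem D_t (i : ℤ) : D (t i) = (i : ℂ) • t i := by
  refine TrivSqZeroExt.ext ?_ ?_ <;> simp [t, euler_T]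

theorem D_tξ (i : ℤ) : D (tξ i) = (i : ℂ) • tξ i := by
  refine TrivSqZeroExt.ext ?_ ?_ <;> simp [tξ, euler_T]

theorem dξ_t (i : ℤ) : dξ (t i) = 0 := by
  refine TrivSqZeroExt.ext ?_ ?_ <;> simp [t]

theorem dξ_tξ (i : ℤ) : dξ (tξ i) = t i := by
  refine TrivSqZeroExt.ext ?_ ?_ <;> simp [t, tξ]

theorem t_mem (i : ℤ) : t i ∈ (part 0 : Submodule ℂ A) := by simp [mem_part_zero, t]

theorem tξ_mem (i : ℤ) : tξ i ∈ (part 1 : Submodule ℂ A) := by simp [mem_part_one, tξ]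

/-- A subspace that contains all `t ^ i` and all `t ^ i ξ` is everything. -/
theorem mem_of_forall {N : Submodule ℂ A} (h : ∀ i, t i ∈ N) (h' : ∀ i, tξ i ∈ N) (a : A) :
    a ∈ N := by
  have : N.mkQ = 0 := hom_ext (fun i => by simpa using h i) (fun i => by simpa using h' i)
  simpa using DFunLike.congr_fun this a

/-- Evaluation at `t = 1`, `ξ = 0`. -/
def counit : A →ₗ[ℂ] ℂ := lift (fun _ => 1) (fun _ => 0)

/-- Evaluation kills every monomial multiple of `t - 1` and of `ξ`, hence the ideal they generate.
Consequently the correction used in `a0.mem_of_gen` is trivial on `𝔞₀`. -/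
theorem counit_eq_zero {a : A} (ha : a ∈ 𝔪) : counit a = 0 := by
  have h1 : counit ∘ₗ LinearMap.mulRight ℂ (t 1 - 1) = 0 := by
    rw [← t_zero]
    refine hom_ext (fun i => ?_) (fun i => ?_) <;>
      simp [mul_sub, t_mul, tξ_mul_t, counit, lift_t, lift_tξ]
  have h2 : counit ∘ₗ LinearMap.mulRight ℂ (tξ 0) = 0 :=
    hom_ext (fun i => by simp [t_mul_tξ, counit, lift_tξ]) (fun i => by simp [tξ_mul_tξ])
  obtain ⟨x, y, rfl⟩ := Ideal.mem_span_pair.1 ha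
  have e1 := DFunLike.congr_fun h1 x
  have e2 := DFunLike.congr_fun h2 y
  simp only [LinearMap.comp_apply, LinearMap.mulRight_apply, LinearMap.zero_apply] at e1 e2
  rw [map_add, e1, e2, add_zero]

end A

/-! ### Homogeneous spanning sets. -/

section spanning
variable {V : Type*} [AddCommGroup V] [Module ℂ V] [SuperSpace V]

/-- If a super vector space is spanned by a set of homogeneous elements, so is each component. -/
theorem part_le_span {s : ZMod 2 → Set V} (hs : ∀ p, ∀ v ∈ s p, v ∈ (part p : Submodule ℂ V))
    (h : ∀ v, v ∈ Submodule.span ℂ (⋃ p, s p)) (p : ZMod 2) :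
    (part p : Submodule ℂ V) ≤ Submodule.span ℂ (s p) := by
  -- The projection to parity `p` fixes the spanning vectors of parity `p` and kills the others.
  have key : ∀ v, proj p v ∈ Submodule.span ℂ (s p) := by
    intro v
    induction h v using Submodule.span_induction with
    | zero => simp
    | add x y _ _ hx hy => rw [map_add]; exact add_mem hx hy
    | smul c x _ hx => rw [map_smul]; exact Submodule.smul_mem _ _ hx
    | mem x hx =>
      obtain ⟨q, hq⟩ := Set.mem_iUnion.1 hx
      rw [proj_of_mem (hs q x hq)]
      split_ifs with hpq
      · subst hpq; exact Submodule.subset_span hq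
      · exact zero_mem _
  intro v hv
  simpa [proj_of_mem hv] using key v

end spanning

@[simp] theorem Witt.mk_zero : Witt.mk 0 0 = 0 := rfl

/-! ### The generators `t ^ i δ` and `t ^ i ξ δ` of the Lie superalgebras. -/

section generators
variable {g : Type*} [AddCommGroup g] [Module ℂ g]

/-- The element `t ^ i δ` for the constant vector `δ = a t ∂/∂t + b ∂/∂ξ + x`. -/
def evenGen (i : ℤ) (δ : ℂ × ℂ × g) : LTilde g :=
  (Witt.mk (δ.1 • A.t i) (δ.2.1 • A.t i), δ.2.2 ⊗ₜ A.t i, 0)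

/-- The element `t ^ i ξ δ` for a constant vector `δ` of parity `p`. -/
def oddGen (p : ZMod 2) (i : ℤ) (δ : ℂ × ℂ × g) : LTilde g :=
  (Witt.mk (δ.1 • A.tξ i) (δ.2.1 • A.tξ i), (sgn p • δ.2.2) ⊗ₜ A.tξ i, 0)

theorem evenGen_mem_a0 (i : ℤ) (δ : ℂ × ℂ × g) :
    evenGen i δ - evenGen 0 (δ.1, δ.2.1, 0) ∈ a0 g := by
  refine ⟨?_, ?_, ?_⟩
  · simpa [evenGen, ← smul_sub] using Submodule.smul_of_tower_mem 𝔪 δ.1 (t_sub_mem_𝔪 i)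
  · simpa [evenGen, ← smul_sub] using Submodule.smul_of_tower_mem 𝔪 δ.2.1 (t_sub_mem_𝔪 i)
  · simp [evenGen]

theorem oddGen_mem_a0 (p : ZMod 2) (i : ℤ) (δ : ℂ × ℂ × g) : oddGen p i δ ∈ a0 g := by
  refine ⟨?_, ?_, ?_⟩
  · simpa [oddGen] using Submodule.smul_of_tower_mem 𝔪 δ.1 (tξ_mem_𝔪 i)
  · simpa [oddGen] using Submodule.smul_of_tower_mem 𝔪 δ.2.1 (tξ_mem_𝔪 i)
  · simp [oddGen]

theorem d_eq (i : ℤ) : (d i : LTilde g) = evenGen i (1, 0, 0) := by simp [d, evenGen]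
theorem Q_eq (i : ℤ) : (Q i : LTilde g) = evenGen i (0, 1, 0) := by simp [Q, evenGen]
theorem G_eq (i : ℤ) : (G i : LTilde g) = oddGen 0 i (1, 0, 0) := by simp [G, oddGen]
theorem h_eq (i : ℤ) : (h i : LTilde g) = oddGen 1 i (0, 1, 0) := by simp [h, oddGen]
theorem curr_t_eq (x : g) (i : ℤ) : curr x (A.t i) = evenGen i (0, 0, x) := by
  simp [curr, evenGen]
theorem curr_tξ_eq (p : ZMod 2) (x : g) (i : ℤ) :
    curr x (A.tξ i) = sgn p • oddGen p i (0, 0, x) := by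
  simp [curr, oddGen, ← TensorProduct.smul_tmul', smul_smul, sgn_mul_self]

namespace a0

/-- The element `(t ^ i - 1) (a t ∂/∂t + b ∂/∂ξ) + t ^ i x` of `𝔞₀`. -/
def evenGen (i : ℤ) (δ : ℂ × ℂ × g) : a0 g :=
  ⟨SuperAffine.evenGen i δ - SuperAffine.evenGen 0 (δ.1, δ.2.1, 0), evenGen_mem_a0 i δ⟩

/-- The element `t ^ i ξ δ` of `𝔞₀` for a constant vector `δ` of parity `p`. -/
def oddGen (p : ZMod 2) (i : ℤ) (δ : ℂ × ℂ × g) : a0 g :=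
  ⟨SuperAffine.oddGen p i δ, oddGen_mem_a0 p i δ⟩

end a0

variable [SuperSpace g]

/-- The constant vector `a t ∂/∂t + b ∂/∂ξ + x` has parity `p`. -/
structure IsHom (p : ZMod 2) (δ : ℂ × ℂ × g) : Prop where
  fst : p = 1 → δ.1 = 0
  snd : p = 0 → δ.2.1 = 0
  mem : δ.2.2 ∈ (part p : Submodule ℂ g)

theorem IsHom.deriv {p : ZMod 2} {δ : ℂ × ℂ × g} (hδ : IsHom p δ) :
    IsHom p ((δ.1, δ.2.1, 0) : ℂ × ℂ × g) := ⟨hδ.fst, hδ.snd, zero_mem _⟩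

/-- The coefficient of `t ∂/∂t` can be nonzero only in an even vector, that of `∂/∂ξ` only in an odd
one. This and the next few identities encode that, so that later coefficient comparisons need no
case split on parities. -/
theorem IsHom.sgn_mul {p : ZMod 2} {δ : ℂ × ℂ × g} (hδ : IsHom p δ) : sgn p * δ.1 = δ.1 := by
  rcases parity_cases p with rfl | rfl
  · simp [sgn]
  · simp [hδ.fst rfl]

theorem IsHom.sgn_mul_mul {p : ZMod 2} {δ : ℂ × ℂ × g} (hδ : IsHom p δ) (q : ZMod 2) :
    sgn (p * q) * δ.1 = δ.1 := by
  rcases parity_cases p with rfl | rfl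
  · simp [sgn]
  · simp [hδ.fst rfl]

theorem IsHom.sgn_mul_mul' {p : ZMod 2} {δ : ℂ × ℂ × g} (hδ : IsHom p δ) (q : ZMod 2) :
    sgn (q * p) * δ.1 = δ.1 := by rw [mul_comm q, hδ.sgn_mul_mul]

theorem IsHom.sgn_mul_snd {p : ZMod 2} {δ : ℂ × ℂ × g} (hδ : IsHom p δ) :
    sgn p * δ.2.1 = -δ.2.1 := by
  rcases parity_cases p with rfl | rfl
  · simp [hδ.snd rfl]
  · simp [sgn]

theorem IsHom.sgn_mul_mul_snd {p : ZMod 2} {δ : ℂ × ℂ × g} (hδ : IsHom p δ) (q : ZMod 2) :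
    sgn (p * q) * δ.2.1 = sgn q * δ.2.1 := by
  rcases parity_cases p with rfl | rfl
  · simp [hδ.snd rfl]
  · simp

theorem IsHom.sgn_mul_mul_snd' {p : ZMod 2} {δ : ℂ × ℂ × g} (hδ : IsHom p δ) (q : ZMod 2) :
    sgn (q * p) * δ.2.1 = sgn q * δ.2.1 := by rw [mul_comm q, hδ.sgn_mul_mul_snd]

theorem Witt.mk_mem {p : ZMod 2} {f f' : A} (h : f ∈ (part p : Submodule ℂ A))
    (h' : f' ∈ (part (p + 1) : Submodule ℂ A)) :
    Witt.mk f f' ∈ (part p : Submodule ℂ Witt) := Witt.mem_part.2 ⟨h, h'⟩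

theorem IsHom.fst_smul_mem {p q : ZMod 2} {δ : ℂ × ℂ × g} (hδ : IsHom p δ) {a : A}
    (ha : a ∈ (part q : Submodule ℂ A)) : δ.1 • a ∈ (part (p + q) : Submodule ℂ A) := by
  rcases parity_cases p with rfl | rfl
  · rw [zero_add]; exact Submodule.smul_mem _ _ ha
  · rw [hδ.fst rfl, zero_smul]; exact zero_mem _

theorem IsHom.snd_smul_mem {p q : ZMod 2} {δ : ℂ × ℂ × g} (hδ : IsHom p δ) {a : A}
    (ha : a ∈ (part q : Submodule ℂ A)) : δ.2.1 • a ∈ (part (p + q + 1) : Submodule ℂ A) := by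
  rcases parity_cases p with rfl | rfl
  · rw [hδ.snd rfl, zero_smul]; exact zero_mem _
  · rw [add_right_comm, one_add_one, zero_add]; exact Submodule.smul_mem _ _ ha

theorem Witt.mk_smul_mem {p q : ZMod 2} {δ : ℂ × ℂ × g} (hδ : IsHom p δ) {a : A}
    (ha : a ∈ (part q : Submodule ℂ A)) :
    Witt.mk (δ.1 • a) (δ.2.1 • a) ∈ (part (p + q) : Submodule ℂ Witt) :=
  Witt.mk_mem (hδ.fst_smul_mem ha) (hδ.snd_smul_mem ha)

theorem mem_part_LTilde {p : ZMod 2} {w : Witt} {u : g ⊗[ℂ] A} {f : A}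
    (h1 : w ∈ (part p : Submodule ℂ Witt)) (h2 : u ∈ (part p : Submodule ℂ (g ⊗[ℂ] A)))
    (h3 : f ∈ (part p : Submodule ℂ A)) :
    ((w, u, f) : LTilde g) ∈ (part p : Submodule ℂ (LTilde g)) := ⟨h1, h2, h3⟩

theorem evenGen_mem {p : ZMod 2} {δ : ℂ × ℂ × g} (hδ : IsHom p δ) (i : ℤ) :
    evenGen i δ ∈ (part p : Submodule ℂ (LTilde g)) := by
  have h1 := Witt.mk_smul_mem hδ (A.t_mem i)
  have h2 := tmul_mem hδ.mem (A.t_mem i)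
  rw [add_zero] at h1 h2
  exact mem_part_LTilde h1 h2 (zero_mem _)

theorem oddGen_mem {p : ZMod 2} {δ : ℂ × ℂ × g} (hδ : IsHom p δ) (i : ℤ) :
    oddGen p i δ ∈ (part (p + 1) : Submodule ℂ (LTilde g)) :=
  mem_part_LTilde (Witt.mk_smul_mem hδ (A.tξ_mem i))
    (tmul_mem (Submodule.smul_mem _ _ hδ.mem) (A.tξ_mem i)) (zero_mem _)

theorem fn_mem {p : ZMod 2} {a : A} (ha : a ∈ (part p : Submodule ℂ A)) :
    fn a ∈ (part p : Submodule ℂ (LTilde g)) :=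
  mem_part_LTilde (zero_mem _) (zero_mem _) ha

theorem a0.mem_part {p : ZMod 2} {X : a0 g} : X ∈ (part p : Submodule ℂ (a0 g)) ↔
    (X : LTilde g) ∈ (part p : Submodule ℂ (LTilde g)) := Iff.rfl

theorem a0.evenGen_mem {p : ZMod 2} {δ : ℂ × ℂ × g} (hδ : IsHom p δ) (i : ℤ) :
    a0.evenGen i δ ∈ (part p : Submodule ℂ (a0 g)) := by
  rw [a0.mem_part, a0.evenGen]
  exact sub_mem (SuperAffine.evenGen_mem hδ i) (SuperAffine.evenGen_mem hδ.deriv 0)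

theorem a0.oddGen_mem {p : ZMod 2} {δ : ℂ × ℂ × g} (hδ : IsHom p δ) (i : ℤ) :
    a0.oddGen p i δ ∈ (part (p + 1) : Submodule ℂ (a0 g)) :=
  a0.mem_part.2 (SuperAffine.oddGen_mem hδ i)

/-- The generators `t ^ i δ`, `t ^ i ξ δ` of parity `p` of `ℒ`. -/
def genL (g : Type*) [AddCommGroup g] [Module ℂ g] [SuperSpace g] (p : ZMod 2) :
    Set (LTilde g) :=
  {X | ∃ i δ, IsHom p δ ∧ X = evenGen i δ} ∪
    {X | ∃ i q δ, q + 1 = p ∧ IsHom q δ ∧ X = oddGen q i δ}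

/-- Homogeneous elements of `𝒜` in the extension of `ℒ`. -/
def genFn (g : Type*) [AddCommGroup g] [Module ℂ g] [SuperSpace g] (p : ZMod 2) :
    Set (LTilde g) := {X | ∃ a ∈ (part p : Submodule ℂ A), X = fn a}

/-- The generators of parity `p` of `𝔞₀`. -/
def genA0 (g : Type*) [AddCommGroup g] [Module ℂ g] [SuperSpace g] (p : ZMod 2) :
    Set (a0 g) :=
  {X | ∃ i δ, IsHom p δ ∧ X = a0.evenGen i δ} ∪
    {X | ∃ i q δ, q + 1 = p ∧ IsHom q δ ∧ X = a0.oddGen q i δ}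

theorem isHom_D : IsHom 0 ((1, 0, 0) : ℂ × ℂ × g) := ⟨by simp, by simp, zero_mem _⟩
theorem isHom_dξ : IsHom 1 ((0, 1, 0) : ℂ × ℂ × g) := ⟨by simp, by simp, zero_mem _⟩
theorem isHom_cur {p : ZMod 2} {x : g} (hx : x ∈ (part p : Submodule ℂ g)) :
    IsHom p ((0, 0, x) : ℂ × ℂ × g) := ⟨by simp, by simp, hx⟩

/-- A subspace of `𝒲 ⋉ ((g ⊗ 𝒜) ⊕ 𝒜)` that contains all generators is everything. -/
theorem mem_of_gen {N : Submodule ℂ (LTilde g)} (hN : ∀ p, genL g p ⊆ N)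
    (hF : ∀ p, genFn g p ⊆ N) (X : LTilde g) : X ∈ N := by
  have hE : ∀ {p δ}, IsHom p δ → ∀ i, evenGen i δ ∈ N := fun {p δ} h i =>
    hN p (Or.inl ⟨i, δ, h, rfl⟩)
  have hO : ∀ {p δ}, IsHom p δ → ∀ i, oddGen p i δ ∈ N := fun {p δ} h i =>
    hN (p + 1) (Or.inr ⟨i, p, δ, rfl, h, rfl⟩)
  -- The inclusions of the two coefficient copies of `𝒜` and of each `x ⊗ 𝒜` reduce membership to
  -- monomials, where `A.mem_of_forall` applies.
  let i1 : A →ₗ[ℂ] LTilde g :=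
    { toFun := fun a => (Witt.mk a 0, 0, 0)
      map_add' := fun a b => Prod.ext (Witt.ext (by simp) (by simp)) (by simp)
      map_smul' := fun a b => Prod.ext (Witt.ext (by simp) (by simp)) (by simp) }
  let i2 : A →ₗ[ℂ] LTilde g :=
    { toFun := fun a => (Witt.mk 0 a, 0, 0)
      map_add' := fun a b => Prod.ext (Witt.ext (by simp) (by simp)) (by simp)
      map_smul' := fun a b => Prod.ext (Witt.ext (by simp) (by simp)) (by simp) }
  let i3 : g → A →ₗ[ℂ] LTilde g := fun x =>
    { toFun := fun a => curr x a
      map_add' := fun a b => by simp [curr, TensorProduct.tmul_add]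
      map_smul' := fun a b => by simp [curr] }
  have h1 : ∀ a, i1 a ∈ N := fun a => A.mem_of_forall (N := N.comap i1)
    (fun i => by
      have := hE isHom_D i
      rwa [← d_eq] at this) (fun i => by
      have := hO isHom_D i
      rwa [← G_eq] at this) a
  have h2 : ∀ a, i2 a ∈ N := fun a => A.mem_of_forall (N := N.comap i2)
    (fun i => by
      have := hE isHom_dξ i
      rwa [← Q_eq] at this) (fun i => by
      have := hO isHom_dξ i
      rwa [← h_eq] at this) a
  have h3 : ∀ p, ∀ x ∈ (part p : Submodule ℂ g), ∀ a, curr x a ∈ N := fun p x hx a =>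
    A.mem_of_forall (N := N.comap (i3 x))
    (fun i => by
      have := hE (isHom_cur hx) i
      rwa [← curr_t_eq] at this) (fun i => by
      have := N.smul_mem (sgn p) (hO (isHom_cur hx) i)
      rwa [← curr_tξ_eq] at this) a
  have h4 : ∀ u : g ⊗[ℂ] A, ((0, u, 0) : LTilde g) ∈ N := by
    intro u
    induction u using TensorProduct.induction_on with
    | zero => exact zero_mem _
    | add x y hx hy => simpa using add_mem hx hy
    | tmul x a =>
      have := add_mem (h3 0 _ (proj_mem 0 x) a) (h3 1 _ (proj_mem 1 x) a)
      simp only [curr, Prod.mk_add_mk, ← TensorProduct.add_tmul, proj_add_proj, add_zero] at this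
      exact this
  obtain ⟨w, u, f⟩ := X
  have e : ((w, u, f) : LTilde g) = i1 (Witt.coeffD w) + i2 (Witt.coeffξ w) + (0, u, 0) +
      (fn (proj 0 f) + fn (proj 1 f)) := by
    refine Prod.ext (Witt.ext ?_ ?_) (Prod.ext ?_ ?_) <;> simp [i1, i2, fn, proj_add_proj]
  rw [e]
  exact add_mem (add_mem (add_mem (h1 _) (h2 _)) (h4 _)) (add_mem
    (hF 0 ⟨_, proj_mem 0 f, rfl⟩) (hF 1 ⟨_, proj_mem 1 f, rfl⟩))

theorem part_LTilde_le (p : ZMod 2) :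
    (part p : Submodule ℂ (LTilde g)) ≤ Submodule.span ℂ (genL g p ∪ genFn g p) := by
  refine part_le_span (s := fun p => genL g p ∪ genFn g p) ?_ ?_ p
  · rintro p X ((⟨i, δ, hδ, rfl⟩ | ⟨i, q, δ, rfl, hδ, rfl⟩) | ⟨a, ha, rfl⟩)
    · exact evenGen_mem hδ i
    · exact oddGen_mem hδ i
    · exact fn_mem ha
  · refine mem_of_gen (fun p => ?_) (fun p => ?_) <;> intro X hX <;>
      refine Submodule.subset_span (Set.mem_iUnion.2 ⟨p, ?_⟩)
    · exact Or.inl hX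
    · exact Or.inr hX

/-- A subspace of `𝔞₀` that contains all generators is everything. -/
theorem a0.mem_of_gen {N : Submodule ℂ (a0 g)} (hN : ∀ p, genA0 g p ⊆ N) (X : a0 g) : X ∈ N := by
  -- A projection of the whole algebra onto `𝔞₀`: subtract the values of the coefficients at `t =
  -- 1`, `ξ = 0` times `t ∂/∂t` and `∂/∂ξ`, and drop the abelian summand. It maps generators to
  -- generators of `𝔞₀` or to zero and fixes `𝔞₀`, so the spanning statement descends.
  let corr : LTilde g →ₗ[ℂ] LTilde g :=
    { toFun := fun X => X - (SuperAffine.evenGen 0 (A.counit (Witt.coeffD X.1), A.counit (Witt.coeffξ X.1), 0)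
        + fn X.2.2)
      map_add' := fun X Y => by
        refine Prod.ext (Witt.ext ?_ ?_) (Prod.ext ?_ ?_) <;> simp [SuperAffine.evenGen, fn] <;> module
      map_smul' := fun c X => by
        refine Prod.ext (Witt.ext ?_ ?_) (Prod.ext ?_ ?_) <;> simp [SuperAffine.evenGen, fn] <;> module }
  have key : ∀ Y : LTilde g, Y ∈ (N.map (a0 g).subtype).comap corr := by
    refine SuperAffine.mem_of_gen (fun p => ?_) (fun p => ?_)
    · rintro Y (⟨i, δ, hδ, rfl⟩ | ⟨i, q, δ, rfl, hδ, rfl⟩)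
      · refine ⟨_, hN p (Or.inl ⟨i, δ, hδ, rfl⟩), ?_⟩
        simp [corr, a0.evenGen, SuperAffine.evenGen, fn, A.counit, A.lift_t]
      · refine ⟨_, hN _ (Or.inr ⟨i, q, δ, rfl, hδ, rfl⟩), ?_⟩
        simp [corr, a0.oddGen, SuperAffine.oddGen, SuperAffine.evenGen, fn, A.counit, A.lift_tξ]
    · rintro Y ⟨a, ha, rfl⟩
      refine ⟨0, zero_mem _, ?_⟩
      refine Prod.ext (Witt.ext ?_ ?_) (Prod.ext ?_ ?_) <;> simp [corr, fn, SuperAffine.evenGen]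
  obtain ⟨Z, hZ, e⟩ := key X
  obtain ⟨⟨w, u, f⟩, h1, h2, h3⟩ := X
  have : Z = ⟨(w, u, f), h1, h2, h3⟩ := by
    refine Subtype.ext (e.trans ?_)
    simp only at h1 h2 h3
    refine Prod.ext (Witt.ext ?_ ?_) (Prod.ext ?_ ?_) <;>
      simp [corr, SuperAffine.evenGen, fn, A.counit_eq_zero h1, A.counit_eq_zero h2, h3]
  exact this ▸ hZ

theorem part_a0_le (p : ZMod 2) :
    (part p : Submodule ℂ (a0 g)) ≤ Submodule.span ℂ (genA0 g p) := by
  refine part_le_span ?_ ?_ p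
  · rintro p X (⟨i, δ, hδ, rfl⟩ | ⟨i, q, δ, rfl, hδ, rfl⟩)
    · exact a0.evenGen_mem hδ i
    · exact a0.oddGen_mem hδ i
  · exact a0.mem_of_gen fun p X hX => Submodule.subset_span (Set.mem_iUnion.2 ⟨p, hX⟩)

end generators

/-! ### Brackets of the generators. -/

section brackets
variable {g : Type*} [AddCommGroup g] [Module ℂ g] [SuperSpace g] [LieSuperalgebra g]

theorem br_fn {p q : ZMod 2} {X : LTilde g} {a : A} (hX : X ∈ (part p : Submodule ℂ (LTilde g)))
    (ha : a ∈ (part q : Submodule ℂ A)) : br X (fn a) = fn (Witt.act X.1 a) := by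
  rw [LTilde.br_def, superComm_apply _ hX (fn_mem ha), LTilde.left_apply, LTilde.left_apply,
    LTilde.cur_apply]
  refine Prod.ext (Witt.ext ?_ ?_) (Prod.ext ?_ ?_) <;> simp [fn]

/-- A constant vector differentiates `t ^ j` only through `t ∂/∂t`, because `∂/∂ξ` kills it. The
sign of the exchanged term disappears: its coefficient is nonzero only if `δ'` is even. -/
theorem br_evenGen_evenGen {p q : ZMod 2} {δ δ' : ℂ × ℂ × g} (hδ : IsHom p δ) (hδ' : IsHom q δ')
    (i j : ℤ) : br (evenGen i δ) (evenGen j δ') =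
      (j * δ.1 : ℂ) • evenGen (i + j) δ' - (i * δ'.1 : ℂ) • evenGen (i + j) δ +
        evenGen (i + j) (0, 0, br δ.2.2 δ'.2.2) := by
  have e1 := actCur_tmul (by simpa using Witt.mk_smul_mem hδ (A.t_mem i)) hδ'.mem (A.t j)
  have e2 := actCur_tmul (by simpa using Witt.mk_smul_mem hδ' (A.t_mem j)) hδ.mem (A.t i)
  have e3 := brCur_tmul δ.2.2 (A.t_mem i) hδ'.mem (A.t j)
  rw [LTilde.br_def, superComm_apply _ (evenGen_mem hδ i) (evenGen_mem hδ' j), LTilde.left_apply,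
    LTilde.left_apply, LTilde.cur_apply]
  simp only [evenGen, e1, e2, e3]
  clear e1 e2 e3
  have s1 := hδ.sgn_mul_mul q
  have s2 := hδ'.sgn_mul_mul' p
  have s3 := sgn_mul_self (p * q)
  rw [mul_comm q p]
  refine Prod.ext (Witt.ext ?_ ?_) (Prod.ext ?_ ?_)
  · simp [Witt.act_apply, A.D_t, A.dξ_t, A.t_mul, smul_smul, add_comm j i]
    match_scalars
    grind
  · simp [Witt.act_apply, A.D_t, A.dξ_t, A.t_mul, smul_smul, add_comm j i]
    match_scalars
    grind
  · simp [Witt.act_apply, A.D_t, A.dξ_t, A.t_mul, smul_smul, add_comm j i]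
    simp only [show sgn 0 = 1 from by simp [sgn]]
    match_scalars <;> grind
  · simp

/-- The new term comes from `∂/∂ξ` removing the `ξ` of the second argument. The factors `sgn p` come
from moving `δ` past `ξ`. -/
theorem br_evenGen_oddGen {p q : ZMod 2} {δ δ' : ℂ × ℂ × g} (hδ : IsHom p δ) (hδ' : IsHom q δ')
    (i j : ℤ) : br (evenGen i δ) (oddGen q j δ') =
      (j * δ.1 : ℂ) • oddGen q (i + j) δ' + δ.2.1 • evenGen (i + j) δ' -
        (sgn p * (i * δ'.1) : ℂ) • oddGen p (i + j) δ +
        sgn p • oddGen (p + q) (i + j) (0, 0, br δ.2.2 δ'.2.2) := by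
  have e1 := actCur_tmul (by simpa using Witt.mk_smul_mem hδ (A.t_mem i))
    (Submodule.smul_mem _ (sgn q) hδ'.mem) (A.tξ j)
  have e2 := actCur_tmul (Witt.mk_smul_mem hδ' (A.tξ_mem j)) hδ.mem (A.t i)
  have e3 := brCur_tmul δ.2.2 (A.t_mem i) (Submodule.smul_mem _ (sgn q) hδ'.mem) (A.tξ j)
  rw [LTilde.br_def, superComm_apply _ (evenGen_mem hδ i) (oddGen_mem hδ' j), LTilde.left_apply,
    LTilde.left_apply, LTilde.cur_apply]
  simp only [evenGen, oddGen, e1, e2, e3]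
  clear e1 e2 e3
  have s1 := hδ.sgn_mul_mul q
  have s2 := hδ'.sgn_mul_mul' p
  have s4 := hδ.sgn_mul_mul_snd q
  have s5 := hδ'.sgn_mul_mul_snd' p
  have s3 := sgn_mul_self (p * q)
  have s6 := sgn_mul_self p
  have s7 := sgn_mul_self q
  refine Prod.ext (Witt.ext ?_ ?_) (Prod.ext ?_ ?_)
  · simp [Witt.act_apply, A.D_t, A.dξ_t, A.D_tξ, A.dξ_tξ, A.t_mul, A.tξ_mul_t, A.t_mul_tξ,
      smul_smul, add_comm j i, mul_add, sgn_add]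
    match_scalars <;> grind
  · simp [Witt.act_apply, A.D_t, A.dξ_t, A.D_tξ, A.dξ_tξ, A.t_mul, A.tξ_mul_t, A.t_mul_tξ,
      smul_smul, add_comm j i, mul_add, sgn_add]
    match_scalars <;> grind
  · simp [Witt.act_apply, A.D_t, A.dξ_t, A.D_tξ, A.dξ_tξ, A.t_mul, A.tξ_mul_t, A.t_mul_tξ,
      smul_smul, add_comm j i, mul_add, add_mul, sgn_add, ← TensorProduct.smul_tmul',
      TensorProduct.tmul_add, mul_comm q p]
    simp only [show sgn 0 = 1 from by simp [sgn]]
    match_scalars <;> grind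
  · simp

/-- Since `ξ ^ 2 = 0`, only the terms in which `∂/∂ξ` removes one of the two factors `ξ` survive. -/
theorem br_oddGen_oddGen {p q : ZMod 2} {δ δ' : ℂ × ℂ × g} (hδ : IsHom p δ) (hδ' : IsHom q δ')
    (i j : ℤ) : br (oddGen p i δ) (oddGen q j δ') =
      δ.2.1 • oddGen q (i + j) δ' - δ'.2.1 • oddGen p (i + j) δ := by
  have e1 := actCur_tmul (Witt.mk_smul_mem hδ (A.tξ_mem i))
    (Submodule.smul_mem _ (sgn q) hδ'.mem) (A.tξ j)
  have e2 := actCur_tmul (Witt.mk_smul_mem hδ' (A.tξ_mem j))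
    (Submodule.smul_mem _ (sgn p) hδ.mem) (A.tξ i)
  have e3 := brCur_tmul (sgn p • δ.2.2) (A.tξ_mem i)
    (Submodule.smul_mem _ (sgn q) hδ'.mem) (A.tξ j)
  rw [LTilde.br_def, superComm_apply _ (oddGen_mem hδ i) (oddGen_mem hδ' j), LTilde.left_apply,
    LTilde.left_apply, LTilde.cur_apply]
  simp only [oddGen, e1, e2, e3]
  clear e1 e2 e3
  have s4 := hδ.sgn_mul_mul_snd q
  have s5 := hδ'.sgn_mul_mul_snd' p
  have s8 := hδ.sgn_mul_snd
  have s9 := hδ'.sgn_mul_snd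
  have s3 := sgn_mul_self (p * q)
  have s6 := sgn_mul_self p
  have s7 := sgn_mul_self q
  have s10 : sgn 1 = -1 := by simp [sgn]
  refine Prod.ext (Witt.ext ?_ ?_) (Prod.ext ?_ ?_)
  · simp [Witt.act_apply, A.D_tξ, A.dξ_tξ, A.tξ_mul_t, A.tξ_mul_tξ,
      smul_smul, add_comm j i, mul_add, add_mul, sgn_add]
    match_scalars
    grind
  · simp [Witt.act_apply, A.D_tξ, A.dξ_tξ, A.tξ_mul_t, A.tξ_mul_tξ,
      smul_smul, add_comm j i, mul_add, add_mul, sgn_add]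
    match_scalars
    grind
  · simp [Witt.act_apply, A.D_tξ, A.dξ_tξ, A.tξ_mul_t, A.tξ_mul_tξ,
      smul_smul, add_comm j i, mul_add, add_mul, sgn_add, ← TensorProduct.smul_tmul',
      mul_comm q p]
    match_scalars <;> grind
  · simp

/-- Bilinear expansion of `[t ^ i δ - ∂, t ^ j δ' - ∂']` for the derivation parts `∂`, `∂'`. The
constant corrections are what produces the subtracted generators of index `j` and `i`. -/
theorem a0.br_evenGen_evenGen {p q : ZMod 2} {δ δ' : ℂ × ℂ × g} (hδ : IsHom p δ)
    (hδ' : IsHom q δ') (i j : ℤ) : br (a0.evenGen i δ) (a0.evenGen j δ') =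
      (j * δ.1 : ℂ) • (a0.evenGen (i + j) δ' - a0.evenGen j δ') -
        (i * δ'.1 : ℂ) • (a0.evenGen (i + j) δ - a0.evenGen i δ) +
        a0.evenGen (i + j) (0, 0, br δ.2.2 δ'.2.2) := by
  refine Subtype.ext ?_
  change br (a0.evenGen i δ : LTilde g) (a0.evenGen j δ' : LTilde g) = _
  simp only [a0.evenGen, map_sub, LinearMap.sub_apply, SuperAffine.br_evenGen_evenGen hδ hδ',
    SuperAffine.br_evenGen_evenGen hδ.deriv hδ', SuperAffine.br_evenGen_evenGen hδ hδ'.deriv,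
    SuperAffine.br_evenGen_evenGen hδ.deriv hδ'.deriv, map_zero, LinearMap.zero_apply,
    Submodule.coe_add, Submodule.coe_sub, Submodule.coe_smul, zero_add, add_zero]
  have e : ∀ i, SuperAffine.evenGen i ((0, 0, 0) : ℂ × ℂ × g) = 0 := fun i => by
    simp [SuperAffine.evenGen]
  simp only [e]
  push_cast
  module

theorem a0.br_evenGen_oddGen {p q : ZMod 2} {δ δ' : ℂ × ℂ × g} (hδ : IsHom p δ)
    (hδ' : IsHom q δ') (i j : ℤ) : br (a0.evenGen i δ) (a0.oddGen q j δ') =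
      (j * δ.1 : ℂ) • (a0.oddGen q (i + j) δ' - a0.oddGen q j δ') +
        δ.2.1 • (a0.evenGen (i + j) δ' - a0.evenGen j δ') -
        (sgn p * (i * δ'.1) : ℂ) • a0.oddGen p (i + j) δ +
        sgn p • a0.oddGen (p + q) (i + j) (0, 0, br δ.2.2 δ'.2.2) := by
  refine Subtype.ext ?_
  change br (a0.evenGen i δ : LTilde g) (a0.oddGen q j δ' : LTilde g) = _
  simp only [a0.evenGen, a0.oddGen, map_sub, LinearMap.sub_apply,
    SuperAffine.br_evenGen_oddGen hδ hδ',
    SuperAffine.br_evenGen_oddGen hδ.deriv hδ', map_zero, LinearMap.zero_apply,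
    Submodule.coe_add, Submodule.coe_sub, Submodule.coe_smul, zero_add]
  have e : ∀ r i, SuperAffine.oddGen r i ((0, 0, 0) : ℂ × ℂ × g) = 0 := fun r i => by
    simp [SuperAffine.oddGen]
  simp only [e]
  push_cast
  module

theorem a0.br_oddGen_oddGen {p q : ZMod 2} {δ δ' : ℂ × ℂ × g} (hδ : IsHom p δ)
    (hδ' : IsHom q δ') (i j : ℤ) : br (a0.oddGen p i δ) (a0.oddGen q j δ') =
      δ.2.1 • a0.oddGen q (i + j) δ' - δ'.2.1 • a0.oddGen p (i + j) δ :=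
  Subtype.ext (SuperAffine.br_oddGen_oddGen hδ hδ' i j)

end brackets

/-! ### Measuring how far a linear map is from being a representation. -/

section rep
variable {L V : Type*} [AddCommGroup L] [Module ℂ L] [SuperSpace L] [LieSuperalgebra L]
  [AddCommGroup V] [Module ℂ V]

/-- The failure of `ρ` to respect the bracket of `x` and `y`, of parities `p` and `q`. -/
def defect (ρ : L →ₗ[ℂ] Module.End ℂ V) (p q : ZMod 2) (x y : L) (v : V) : V :=
  ρ x (ρ y v) - sgn (p * q) • ρ y (ρ x v) - ρ (br x y) v

theorem defect_eq_zero_iff {ρ : L →ₗ[ℂ] Module.End ℂ V} {p q : ZMod 2} {x y : L} {v : V} :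
    defect ρ p q x y v = 0 ↔ ρ (br x y) v = ρ x (ρ y v) - sgn (p * q) • ρ y (ρ x v) := by
  rw [defect, sub_eq_zero, eq_comm]

theorem IsRep.defect_eq_zero [SuperSpace V] {ρ : L →ₗ[ℂ] Module.End ℂ V} (hρ : IsRep ρ)
    {p q : ZMod 2} {x y : L} (hx : x ∈ (part p : Submodule ℂ L)) (hy : y ∈ (part q : Submodule ℂ L)) (v : V) :
    defect ρ p q x y v = 0 := defect_eq_zero_iff.2 (hρ.map_br hx hy v)

/-- Supercommutators of operators and the bracket of `L` have the same antisymmetry. Hence each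
mixed pair of generators needs checking in one order only. -/
theorem defect_swap (ρ : L →ₗ[ℂ] Module.End ℂ V) {p q : ZMod 2} {x y : L}
    (hx : x ∈ (part p : Submodule ℂ L)) (hy : y ∈ (part q : Submodule ℂ L)) (v : V) :
    defect ρ q p y x v = -(sgn (p * q) • defect ρ p q x y v) := by
  have h := sgn_mul_self (p * q)
  simp only [defect, LieSuperalgebra.br_skew hy hx, map_neg, map_smul, LinearMap.neg_apply,
    LinearMap.smul_apply, mul_comm q p]
  match_scalars <;> grind

/-- It is enough to check on homogeneous generators that a linear map is a representation. -/
theorem isRep_of_gen [SuperSpace V] {ρ : L →ₗ[ℂ] Module.End ℂ V} {s : ZMod 2 → Set L}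
    (hs : ∀ p, (part p : Submodule ℂ L) ≤ Submodule.span ℂ (s p))
    (h1 : ∀ {p q : ZMod 2} {x : L} {v : V}, x ∈ s p → v ∈ (part q : Submodule ℂ V) →
      ρ x v ∈ (part (p + q) : Submodule ℂ V))
    (h2 : ∀ {p q : ZMod 2} {x y : L}, x ∈ s p → y ∈ s q → ∀ v, defect ρ p q x y v = 0) :
    IsRep ρ where
  map_part {p q x v} hx hv := by
    have : Submodule.span ℂ (s p) ≤ (part (p + q) : Submodule ℂ V).comap (ρ.flip v) :=
      Submodule.span_le.2 fun x hx => h1 hx hv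
    exact this (hs p hx)
  map_br {p q x y} hx hy v := by
    -- With the parities fixed, the defect is bilinear in `x` and `y`, so its vanishing spreads from
    -- generators to their spans, one argument at a time.
    let f : L →ₗ[ℂ] L →ₗ[ℂ] Module.End ℂ V :=
      (LinearMap.mul ℂ (Module.End ℂ V)).compl₁₂ ρ ρ -
        sgn (p * q) • ((LinearMap.mul ℂ (Module.End ℂ V)).compl₁₂ ρ ρ).flip - (br (L := L)).compr₂ ρ
    have hf : ∀ x y v, f x y v = defect ρ p q x y v := fun x y v => rfl
    have e1 : ∀ x ∈ s p, Submodule.span ℂ (s q) ≤ LinearMap.ker (f x) := fun x hx =>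
      Submodule.span_le.2 fun y hy => LinearMap.ext fun v => (hf x y v).trans (h2 hx hy v)
    have e2 : Submodule.span ℂ (s p) ≤ LinearMap.ker (f.flip y) :=
      Submodule.span_le.2 fun x hx => LinearMap.mem_ker.1 (e1 x hx (hs q hy))
    have e3 : f x y = 0 := e2 (hs p hx)
    rw [← defect_eq_zero_iff, ← hf, e3, LinearMap.zero_apply]

end rep

/-! ### The dictionary between `𝒜ℒ`-actions and supercommuting actions of the super Weyl algebra and
`𝔞₀`. -/

section twist
variable {g : Type*} [AddCommGroup g] [Module ℂ g] [SuperSpace g]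
  {M : Type*} [AddCommGroup M] [Module ℂ M]

/-- An action `σ` of `𝒲 ⋉ ((g ⊗ 𝒜) ⊕ 𝒜)` written in terms of an action of `𝒜`, operators `D₀`
and `q` that act as the superderivations `t ∂/∂t` and `∂/∂ξ`, and operators `T X` for `X ∈ 𝔞₀`
that supercommute with these. -/
structure IsTwist (la : A →ₗ[ℂ] Module.End ℂ M) (D₀ q : Module.End ℂ M)
    (T : a0 g →ₗ[ℂ] Module.End ℂ M) (σ : LTilde g →ₗ[ℂ] Module.End ℂ M) : Prop where
  la_one : ∀ m, la 1 m = m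
  la_mul : ∀ a b m, la (a * b) m = la a (la b m)
  D_la : ∀ a m, D₀ (la a m) = la a (D₀ m) + la (A.D a) m
  q_la : ∀ {p : ZMod 2} {a : A}, a ∈ (part p : Submodule ℂ A) → ∀ m,
    q (la a m) = sgn p • la a (q m) + la (A.dξ a) m
  q_D : ∀ m, q (D₀ m) = D₀ (q m)
  q_q : ∀ m, q (q m) = 0
  T_la : ∀ {p r : ZMod 2} {X : a0 g} {a : A}, X ∈ (part p : Submodule ℂ (a0 g)) →
    a ∈ (part r : Submodule ℂ A) → ∀ m, T X (la a m) = sgn (p * r) • la a (T X m)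
  D_T : ∀ X m, D₀ (T X m) = T X (D₀ m)
  q_T : ∀ {p : ZMod 2} {X : a0 g}, X ∈ (part p : Submodule ℂ (a0 g)) → ∀ m,
    q (T X m) = sgn p • T X (q m)
  even : ∀ {p : ZMod 2} {δ : ℂ × ℂ × g}, IsHom p δ → ∀ i m, σ (evenGen i δ) m =
    la (A.t i) (T (a0.evenGen i δ) m + (δ.1 • D₀ m + δ.2.1 • q m))
  odd : ∀ {p : ZMod 2} {δ : ℂ × ℂ × g}, IsHom p δ → ∀ i m, σ (oddGen p i δ) m =
    la (A.t i) (T (a0.oddGen p i δ) m) +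
      la (A.tξ i) (T (a0.evenGen i δ) m + (δ.1 • D₀ m + δ.2.1 • q m))
  fn : ∀ a m, σ (fn a) m = la a m

namespace IsTwist
variable {la : A →ₗ[ℂ] Module.End ℂ M} {D₀ q : Module.End ℂ M}
  {T : a0 g →ₗ[ℂ] Module.End ℂ M} {σ : LTilde g →ₗ[ℂ] Module.End ℂ M}
  (h : IsTwist la D₀ q T σ)
include h

/-- Multiplication by `t ^ (-i)` is an inverse. This is what allows the factor `t ^ (i + j)` in the
defect identities to be cancelled. -/
theorem la_t_injective (i : ℤ) : Function.Injective (la (A.t i)) :=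
  Function.LeftInverse.injective (g := la (A.t (-i))) fun m => by
    rw [← h.la_mul, A.t_mul, neg_add_cancel, A.t_zero, h.la_one]

theorem la_t_t (i j : ℤ) (m : M) : la (A.t i) (la (A.t j) m) = la (A.t (i + j)) m := by
  rw [← h.la_mul, A.t_mul]
theorem la_t_tξ (i j : ℤ) (m : M) : la (A.t i) (la (A.tξ j) m) = la (A.tξ (i + j)) m := by
  rw [← h.la_mul, A.t_mul_tξ]
theorem la_tξ_t (i j : ℤ) (m : M) : la (A.tξ i) (la (A.t j) m) = la (A.tξ (i + j)) m := by
  rw [← h.la_mul, A.tξ_mul_t]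
theorem la_tξ_tξ (i j : ℤ) (m : M) : la (A.tξ i) (la (A.tξ j) m) = 0 := by
  rw [← h.la_mul, A.tξ_mul_tξ, map_zero, LinearMap.zero_apply]
theorem D_la_t (i : ℤ) (m : M) : D₀ (la (A.t i) m) = la (A.t i) (D₀ m) + (i : ℂ) • la (A.t i) m := by
  rw [h.D_la, A.D_t, map_smul, LinearMap.smul_apply]
theorem D_la_tξ (i : ℤ) (m : M) :
    D₀ (la (A.tξ i) m) = la (A.tξ i) (D₀ m) + (i : ℂ) • la (A.tξ i) m := by
  rw [h.D_la, A.D_tξ, map_smul, LinearMap.smul_apply]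
theorem q_la_t (i : ℤ) (m : M) : q (la (A.t i) m) = la (A.t i) (q m) := by
  simp [h.q_la (A.t_mem i), A.dξ_t, sgn]
theorem q_la_tξ (i : ℤ) (m : M) : q (la (A.tξ i) m) = -la (A.tξ i) (q m) + la (A.t i) m := by
  simp [h.q_la (A.tξ_mem i), A.dξ_tξ, sgn]
theorem T_la_t {p : ZMod 2} {X : a0 g} (hX : X ∈ (part p : Submodule ℂ (a0 g))) (i : ℤ) (m : M) :
    T X (la (A.t i) m) = la (A.t i) (T X m) := by
  simp [h.T_la hX (A.t_mem i), sgn]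
theorem T_la_tξ {p : ZMod 2} {X : a0 g} (hX : X ∈ (part p : Submodule ℂ (a0 g))) (i : ℤ) (m : M) :
    T X (la (A.tξ i) m) = sgn p • la (A.tξ i) (T X m) := by
  simp [h.T_la hX (A.tξ_mem i)]

variable [LieSuperalgebra g]

/-- Here `σ (t ^ i δ) = t ^ i (T + P)` with `P = δ.1 D₀ + δ.2.1 q`. The operators `P` supercommute
with `T` and with each other, and they differentiate only the powers of `t`. These derivatives
account exactly for the difference between the bracket formulas of `ℒ` and of `𝔞₀`. -/
theorem defect_even_even {p r : ZMod 2} {δ δ' : ℂ × ℂ × g} (hδ : IsHom p δ) (hδ' : IsHom r δ')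
    (i j : ℤ) (m : M) : defect σ p r (evenGen i δ) (evenGen j δ') m =
      la (A.t (i + j)) (defect T p r (a0.evenGen i δ) (a0.evenGen j δ') m) := by
  have hE := a0.evenGen_mem hδ i
  have hE' := a0.evenGen_mem hδ' j
  have hbr : IsHom (p + r) ((0, 0, br δ.2.2 δ'.2.2) : ℂ × ℂ × g) :=
    isHom_cur (LieSuperalgebra.br_mem hδ.mem hδ'.mem)
  simp only [defect, br_evenGen_evenGen hδ hδ', a0.br_evenGen_evenGen hδ hδ', map_add, map_sub,
    map_smul, LinearMap.add_apply, LinearMap.sub_apply, LinearMap.smul_apply, h.even hδ,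
    h.even hδ', h.even hbr, h.T_la_t hE, h.T_la_t hE', h.D_la_t, h.q_la_t, h.la_t_t, h.q_T hE,
    h.q_T hE', h.D_T, h.q_q, h.q_D, add_comm j i, zero_smul, smul_zero, map_zero, add_zero]
  have s1 := hδ.sgn_mul_mul r
  have s2 := hδ'.sgn_mul_mul' p
  have s4 := hδ.sgn_mul_mul_snd r
  have s5 := hδ'.sgn_mul_mul_snd' p
  have s3 := sgn_mul_self (p * r)
  have s6 := sgn_mul_self p
  have s7 := sgn_mul_self r
  match_scalars <;> grind

/-- The action of `t ^ j ξ δ'` has a summand without `ξ` and one with `ξ`. They contribute the two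
terms, and `sgn p` is the cost of moving an operator of parity `p` past `ξ`. -/
theorem defect_even_odd {p r : ZMod 2} {δ δ' : ℂ × ℂ × g} (hδ : IsHom p δ) (hδ' : IsHom r δ')
    (i j : ℤ) (m : M) : defect σ p (r + 1) (evenGen i δ) (oddGen r j δ') m =
      la (A.t (i + j)) (defect T p (r + 1) (a0.evenGen i δ) (a0.oddGen r j δ') m) +
      sgn p • la (A.tξ (i + j)) (defect T p r (a0.evenGen i δ) (a0.evenGen j δ') m) := by
  have hE := a0.evenGen_mem hδ i
  have hE' := a0.evenGen_mem hδ' j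
  have hO' := a0.oddGen_mem hδ' j
  have hbr : IsHom (p + r) ((0, 0, br δ.2.2 δ'.2.2) : ℂ × ℂ × g) :=
    isHom_cur (LieSuperalgebra.br_mem hδ.mem hδ'.mem)
  simp only [defect, br_evenGen_oddGen hδ hδ', a0.br_evenGen_evenGen hδ hδ',
    a0.br_evenGen_oddGen hδ hδ', map_add, map_sub,
    map_smul, LinearMap.add_apply, LinearMap.sub_apply, LinearMap.smul_apply, h.even hδ,
    h.even hδ', h.odd hδ, h.odd hδ', h.odd hbr, h.T_la_t hE, h.T_la_t hE', h.T_la_t hO',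
    h.T_la_tξ hE, h.D_la_t, h.D_la_tξ, h.q_la_t, h.q_la_tξ, h.la_t_t, h.la_tξ_t, h.la_t_tξ,
    h.q_T hE, h.q_T hE', h.q_T hO', h.D_T, h.q_q, h.q_D, add_comm j i, zero_smul, smul_zero,
    map_zero, add_zero, map_neg]
  have s0 := hδ.sgn_mul
  have s8 := hδ.sgn_mul_snd
  have s9 := hδ'.sgn_mul
  have s1 := hδ.sgn_mul_mul r
  have s2 := hδ'.sgn_mul_mul' p
  have s4 := hδ.sgn_mul_mul_snd r
  have s5 := hδ'.sgn_mul_mul_snd' p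
  have s3 := sgn_mul_self (p * r)
  have s6 := sgn_mul_self p
  have s7 := sgn_mul_self r
  have s10 : sgn 1 = -1 := by simp [sgn]
  simp only [mul_add, sgn_add, mul_one]
  match_scalars <;> grind

/-- The product of the two summands containing `ξ` contributes no defect of its own since `ξ ^ 2 =
0`. In the last term, moving the operator of `t ^ i ξ δ` past `ξ` gives `-sgn p`, and exchanging the
arguments as in `defect_swap` gives `-sgn ((p + 1) * r)`; their product is the stated coefficient.
-/
theorem defect_odd_odd {p r : ZMod 2} {δ δ' : ℂ × ℂ × g} (hδ : IsHom p δ) (hδ' : IsHom r δ')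
    (i j : ℤ) (m : M) : defect σ (p + 1) (r + 1) (oddGen p i δ) (oddGen r j δ') m =
      la (A.t (i + j)) (defect T (p + 1) (r + 1) (a0.oddGen p i δ) (a0.oddGen r j δ') m) +
      la (A.tξ (i + j)) (defect T p (r + 1) (a0.evenGen i δ) (a0.oddGen r j δ') m) +
      (sgn p * sgn r * sgn (p * r)) •
        la (A.tξ (i + j)) (defect T r (p + 1) (a0.evenGen j δ') (a0.oddGen p i δ) m) := by
  have hE := a0.evenGen_mem hδ i
  have hE' := a0.evenGen_mem hδ' j
  have hO := a0.oddGen_mem hδ i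
  have hO' := a0.oddGen_mem hδ' j
  -- The two mixed defects involve `[x, x']` and `[x', x]`; both are expressed through the former so
  -- that the terms can be compared.
  have hsk : ((0, 0, br δ'.2.2 δ.2.2) : ℂ × ℂ × g) = (-sgn (p * r)) • (0, 0, br δ.2.2 δ'.2.2) := by
    simp [LieSuperalgebra.br_skew hδ'.mem hδ.mem, mul_comm r p]
  have hsmul : ∀ k (c : ℂ) (δ : ℂ × ℂ × g), a0.oddGen (p + r) k (c • δ) =
      c • a0.oddGen (p + r) k δ := fun k c δ => Subtype.ext (by
    refine Prod.ext (Witt.ext ?_ ?_) (Prod.ext ?_ ?_) <;>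
      simp [a0.oddGen, oddGen, mul_smul, TensorProduct.smul_tmul', smul_comm c])
  simp only [defect, br_oddGen_oddGen hδ hδ', a0.br_oddGen_oddGen hδ hδ',
    a0.br_evenGen_oddGen hδ hδ', a0.br_evenGen_oddGen hδ' hδ, hsk, add_comm r p, hsmul,
    map_add, map_sub,
    map_smul, LinearMap.add_apply, LinearMap.sub_apply, LinearMap.smul_apply, h.odd hδ,
    h.odd hδ', h.T_la_t hE, h.T_la_t hE', h.T_la_t hO',
    h.T_la_t hO, h.T_la_tξ hO, h.T_la_tξ hO', h.T_la_tξ hE', h.la_tξ_tξ,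
    h.T_la_tξ hE, h.D_la_t, h.D_la_tξ, h.q_la_t, h.q_la_tξ, h.la_t_t, h.la_tξ_t, h.la_t_tξ,
    h.q_T hE, h.q_T hE', h.q_T hO', h.q_T hO, h.D_T, h.q_q, h.q_D, add_comm j i,
    smul_zero, map_zero, add_zero, map_neg]
  have s0 := hδ.sgn_mul
  have s8 := hδ.sgn_mul_snd
  have s9 := hδ'.sgn_mul
  have s11 := hδ'.sgn_mul_snd
  have s1 := hδ.sgn_mul_mul r
  have s2 := hδ'.sgn_mul_mul' p
  have s4 := hδ.sgn_mul_mul_snd r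
  have s5 := hδ'.sgn_mul_mul_snd' p
  have s3 := sgn_mul_self (p * r)
  have s6 := sgn_mul_self p
  have s7 := sgn_mul_self r
  have s10 : sgn 1 = -1 := by simp [sgn]
  simp only [mul_add, add_mul, sgn_add, mul_one, one_mul, mul_comm r p]
  match_scalars <;> grind

end IsTwist
end twist

/-! ### Transfer of stability, intertwining and the representation property between `σ` and `T`. -/

namespace IsTwist
variable {g : Type*} [AddCommGroup g] [Module ℂ g] [SuperSpace g]
  {M : Type*} [AddCommGroup M] [Module ℂ M]
  {la : A →ₗ[ℂ] Module.End ℂ M} {D₀ q : Module.End ℂ M}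
  {T : a0 g →ₗ[ℂ] Module.End ℂ M} {σ : LTilde g →ₗ[ℂ] Module.End ℂ M}
  (h : IsTwist la D₀ q T σ)
include h

/-- The element of `𝔞₀` attached to `d_0` is `d_0 - d_0 = 0`, so only `D₀` remains. -/
theorem act_d_zero (m : M) : σ (d 0) m = D₀ m := by
  have : a0.evenGen 0 ((1, 0, 0) : ℂ × ℂ × g) = 0 := Subtype.ext (by simp [a0.evenGen])
  rw [d_eq, h.even isHom_D, this, A.t_zero, h.la_one]
  simp

theorem act_Q_zero (m : M) : σ (Q 0) m = q m := by
  have : a0.evenGen 0 ((0, 1, 0) : ℂ × ℂ × g) = 0 := Subtype.ext (by simp [a0.evenGen])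
  rw [Q_eq, h.even isHom_dξ, this, A.t_zero, h.la_one]
  simp

/-- Inverting `t ^ i` solves the defining relation for `T`. Together with `T_odd` this shows that
`σ` determines `T`. -/
theorem T_even {p : ZMod 2} {δ : ℂ × ℂ × g} (hδ : IsHom p δ) (i : ℤ) (m : M) :
    T (a0.evenGen i δ) m =
      la (A.t (-i)) (σ (evenGen i δ) m) - (δ.1 • D₀ m + δ.2.1 • q m) := by
  rw [h.even hδ, h.la_t_t, neg_add_cancel, A.t_zero, h.la_one, add_sub_cancel_right]

theorem T_odd {p : ZMod 2} {δ : ℂ × ℂ × g} (hδ : IsHom p δ) (i : ℤ) (m : M) :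
    T (a0.oddGen p i δ) m = la (A.t (-i)) (σ (oddGen p i δ) m) -
      la (A.tξ 0) (T (a0.evenGen i δ) m + (δ.1 • D₀ m + δ.2.1 • q m)) := by
  rw [h.odd hδ, map_add, h.la_t_t, h.la_t_tξ, neg_add_cancel, A.t_zero, h.la_one,
    add_sub_cancel_right]

/-- A subspace stable under `𝒜`, `D₀`, `q` and the `T X` is stable under `σ`. -/
theorem stable {N : Submodule ℂ M} (hla : ∀ a, ∀ m ∈ N, la a m ∈ N) (hD : ∀ m ∈ N, D₀ m ∈ N)
    (hq : ∀ m ∈ N, q m ∈ N) (hT : ∀ X, ∀ m ∈ N, T X m ∈ N) (X : LTilde g) :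
    ∀ m ∈ N, σ X m ∈ N := by
  intro m hm
  refine mem_of_gen (N := N.comap (σ.flip m)) (fun p => ?_) (fun p => ?_) X
  · have key : ∀ i (δ : ℂ × ℂ × g), T (a0.evenGen i δ) m + (δ.1 • D₀ m + δ.2.1 • q m) ∈ N :=
      fun i δ => add_mem (hT _ _ hm) (add_mem (N.smul_mem _ (hD _ hm)) (N.smul_mem _ (hq _ hm)))
    rintro Y (⟨i, δ, hδ, rfl⟩ | ⟨i, r, δ, rfl, hδ, rfl⟩) <;>
      rw [SetLike.mem_coe, Submodule.mem_comap, LinearMap.flip_apply]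
    · rw [h.even hδ]
      exact hla _ _ (key i δ)
    · rw [h.odd hδ]
      exact add_mem (hla _ _ (hT _ _ hm)) (hla _ _ (key i δ))
  · rintro Y ⟨a, ha, rfl⟩
    rw [SetLike.mem_coe, Submodule.mem_comap, LinearMap.flip_apply, h.fn]
    exact hla _ _ hm

/-- A subspace stable under `σ` is stable under the `T X`. -/
theorem T_stable {N : Submodule ℂ M} (hN : ∀ X, ∀ m ∈ N, σ X m ∈ N) (X : a0 g) :
    ∀ m ∈ N, T X m ∈ N := by
  intro m hm
  have hla : ∀ a, ∀ m ∈ N, la a m ∈ N := fun a m hm => h.fn a m ▸ hN (SuperAffine.fn a) m hm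
  have hP : ∀ (δ : ℂ × ℂ × g), δ.1 • D₀ m + δ.2.1 • q m ∈ N := fun δ =>
    add_mem (N.smul_mem _ (h.act_d_zero m ▸ hN _ _ hm))
      (N.smul_mem _ (h.act_Q_zero m ▸ hN _ _ hm))
  have hE : ∀ {p : ZMod 2} {δ : ℂ × ℂ × g}, IsHom p δ → ∀ i, T (a0.evenGen i δ) m ∈ N :=
    fun hδ i => by
      rw [h.T_even hδ]
      exact sub_mem (hla _ _ (hN _ _ hm)) (hP _)
  refine a0.mem_of_gen (N := N.comap (T.flip m)) (fun p => ?_) X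
  rintro Y (⟨i, δ, hδ, rfl⟩ | ⟨i, r, δ, rfl, hδ, rfl⟩) <;>
    rw [SetLike.mem_coe, Submodule.mem_comap, LinearMap.flip_apply]
  · exact hE hδ i
  · rw [h.T_odd hδ]
    exact sub_mem (hla _ _ (hN _ _ hm)) (hla _ _ (add_mem (hE hδ i) (hP _)))

/-- A linear map that commutes with `𝒜`, `D₀`, `q` and the `T X` commutes with `σ`. -/
theorem intertwine {M' : Type*} [AddCommGroup M'] [Module ℂ M']
    {la' : A →ₗ[ℂ] Module.End ℂ M'} {D₀' q' : Module.End ℂ M'}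
    {T' : a0 g →ₗ[ℂ] Module.End ℂ M'} {σ' : LTilde g →ₗ[ℂ] Module.End ℂ M'}
    (h' : IsTwist la' D₀' q' T' σ') {e : M →ₗ[ℂ] M'} (hla : ∀ a m, e (la a m) = la' a (e m))
    (hD : ∀ m, e (D₀ m) = D₀' (e m)) (hq : ∀ m, e (q m) = q' (e m))
    (hT : ∀ X m, e (T X m) = T' X (e m)) (X : LTilde g) (m : M) : e (σ X m) = σ' X (e m) := by
  suffices hX : X ∈ LinearMap.ker (e ∘ₗ σ.flip m - σ'.flip (e m)) by
    simpa [sub_eq_zero] using hX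
  refine mem_of_gen (fun p => ?_) (fun p => ?_) X
  · rintro Y (⟨i, δ, hδ, rfl⟩ | ⟨i, r, δ, rfl, hδ, rfl⟩) <;>
      simp only [SetLike.mem_coe, LinearMap.mem_ker, LinearMap.sub_apply, LinearMap.comp_apply,
        LinearMap.flip_apply, sub_eq_zero, h.even hδ, h'.even hδ, h.odd hδ, h'.odd hδ, map_add,
        map_smul, hla, hD, hq, hT]
  · rintro Y ⟨a, ha, rfl⟩
    simp only [SetLike.mem_coe, LinearMap.mem_ker, LinearMap.sub_apply, LinearMap.comp_apply,
      LinearMap.flip_apply, sub_eq_zero, h.fn, h'.fn, hla]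

variable [LieSuperalgebra g]

/-- No property of `T` as a representation enters: `T` supercommutes with `𝒜`, and the remaining
part acts by the Leibniz rule, which reproduces `t ^ i δ(a)`. -/
theorem defect_even_fn {p r : ZMod 2} {δ : ℂ × ℂ × g} {a : A} (hδ : IsHom p δ)
    (ha : a ∈ (part r : Submodule ℂ A)) (i : ℤ) (m : M) :
    defect σ p r (evenGen i δ) (SuperAffine.fn a) m = 0 := by
  have c1 : ∀ m, la a (la (A.t i) m) = la (A.t i) (la a m) := fun m => by
    rw [← h.la_mul, mul_comm, h.la_mul]
  have e : Witt.act (evenGen i δ).1 a = δ.1 • (A.t i * A.D a) + δ.2.1 • (A.t i * A.dξ a) := by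
    simp [evenGen, Witt.act_apply]
  simp only [defect, br_fn (evenGen_mem hδ i) ha, h.fn, h.even hδ, e,
    h.T_la (a0.evenGen_mem hδ i) ha, h.D_la, h.q_la ha, map_add, map_smul, LinearMap.add_apply,
    LinearMap.smul_apply, h.la_mul, c1]
  have s1 := hδ.sgn_mul_mul r
  have s4 := hδ.sgn_mul_mul_snd r
  match_scalars <;> grind

theorem defect_odd_fn {p r : ZMod 2} {δ : ℂ × ℂ × g} {a : A} (hδ : IsHom p δ)
    (ha : a ∈ (part r : Submodule ℂ A)) (i : ℤ) (m : M) :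
    defect σ (p + 1) r (oddGen p i δ) (SuperAffine.fn a) m = 0 := by
  have c1 : ∀ m, la a (la (A.t i) m) = la (A.t i) (la a m) := fun m => by
    rw [← h.la_mul, mul_comm, h.la_mul]
  have c2 : ∀ m, la a (la (A.tξ i) m) = sgn r • la (A.tξ i) (la a m) := fun m => by
    rw [← h.la_mul, A.mul_comm_super ha (A.tξ_mem i), map_smul, LinearMap.smul_apply, mul_one,
      h.la_mul]
  have e : Witt.act (oddGen p i δ).1 a = δ.1 • (A.tξ i * A.D a) + δ.2.1 • (A.tξ i * A.dξ a) := by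
    simp [oddGen, Witt.act_apply]
  simp only [defect, br_fn (oddGen_mem hδ i) ha, h.fn, h.odd hδ, e,
    h.T_la (a0.evenGen_mem hδ i) ha, h.T_la (a0.oddGen_mem hδ i) ha, h.D_la, h.q_la ha, map_add,
    map_smul, LinearMap.add_apply, LinearMap.smul_apply, h.la_mul, c1, c2, add_mul, sgn_add,
    one_mul]
  have s1 := hδ.sgn_mul_mul r
  have s4 := hδ.sgn_mul_mul_snd r
  have s7 := sgn_mul_self r
  match_scalars <;> grind

theorem defect_fn_fn {p r : ZMod 2} {a b : A} (ha : a ∈ (part p : Submodule ℂ A))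
    (hb : b ∈ (part r : Submodule ℂ A)) (m : M) :
    defect σ p r (SuperAffine.fn a) (SuperAffine.fn b) m = 0 := by
  have e : br (SuperAffine.fn a : LTilde g) (SuperAffine.fn b) = 0 := by
    rw [br_fn (fn_mem ha) hb]
    simp [SuperAffine.fn]
  simp only [defect, e, h.fn, map_zero, LinearMap.zero_apply, sub_zero, ← h.la_mul]
  rw [A.mul_comm_super ha hb, map_smul, LinearMap.smul_apply, sub_self]

variable [SuperSpace M]

/-- If `T` is a representation of `𝔞₀` then `σ` is an `𝒜ℒ`-module. -/
theorem isALModule (hT : IsRep T)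
    (hla : ∀ {p r : ZMod 2} {a : A} {m : M}, a ∈ (part p : Submodule ℂ A) →
      m ∈ (part r : Submodule ℂ M) → la a m ∈ (part (p + r) : Submodule ℂ M))
    (hD : ∀ {p : ZMod 2} {m : M}, m ∈ (part p : Submodule ℂ M) →
      D₀ m ∈ (part p : Submodule ℂ M))
    (hq : ∀ {p : ZMod 2} {m : M}, m ∈ (part p : Submodule ℂ M) →
      q m ∈ (part (1 + p) : Submodule ℂ M)) : IsALModule σ where
  toIsRep := by
    refine isRep_of_gen part_LTilde_le (fun {p r x m} hx hm => ?_) (fun {p r x y} hx hy m => ?_)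
    -- The even operator `D₀` occurs only for even `δ` and the odd operator `q` only for odd `δ`, so
    -- the combination has the parity of `δ`.
    · have hP : ∀ {p : ZMod 2} {δ : ℂ × ℂ × g}, IsHom p δ →
          δ.1 • D₀ m + δ.2.1 • q m ∈ (part (p + r) : Submodule ℂ M) := fun {p δ} hδ => by
        rcases parity_cases p with rfl | rfl
        · simpa [hδ.snd rfl] using Submodule.smul_mem _ _ (hD hm)
        · simpa [hδ.fst rfl] using Submodule.smul_mem _ _ (hq hm)
      rcases hx with (⟨i, δ, hδ, rfl⟩ | ⟨i, s, δ, rfl, hδ, rfl⟩) | ⟨a, ha, rfl⟩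
      · rw [h.even hδ]
        have := hla (A.t_mem i) (add_mem (hT.map_part (a0.evenGen_mem hδ i) hm) (hP hδ))
        rwa [zero_add] at this
      · rw [h.odd hδ]
        have e1 := hla (A.t_mem i) (hT.map_part (a0.oddGen_mem hδ i) hm)
        have e2 := hla (A.tξ_mem i) (add_mem (hT.map_part (a0.evenGen_mem hδ i) hm) (hP hδ))
        rw [zero_add] at e1
        rw [← add_assoc, add_comm 1 s] at e2
        exact add_mem e1 e2
      · rw [h.fn]
        exact hla ha hm
    · have swap : ∀ {p r : ZMod 2} {x y : LTilde g}, x ∈ (part p : Submodule ℂ (LTilde g)) →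
          y ∈ (part r : Submodule ℂ (LTilde g)) → defect σ p r x y m = 0 →
          defect σ r p y x m = 0 := fun hx hy e => by
        rw [defect_swap σ hx hy, e, smul_zero, neg_zero]
      have dT : ∀ {p r : ZMod 2} {X Y : a0 g}, X ∈ (part p : Submodule ℂ (a0 g)) →
          Y ∈ (part r : Submodule ℂ (a0 g)) → defect T p r X Y m = 0 := fun hX hY =>
        hT.defect_eq_zero hX hY m
      rcases hx with (⟨i, δ, hδ, rfl⟩ | ⟨i, s, δ, rfl, hδ, rfl⟩) | ⟨a, ha, rfl⟩ <;>
        rcases hy with (⟨j, δ', hδ', rfl⟩ | ⟨j, s', δ', rfl, hδ', rfl⟩) | ⟨b, hb, rfl⟩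
      · rw [h.defect_even_even hδ hδ', dT (a0.evenGen_mem hδ i) (a0.evenGen_mem hδ' j), map_zero]
      · rw [h.defect_even_odd hδ hδ', dT (a0.evenGen_mem hδ i) (a0.evenGen_mem hδ' j),
          dT (a0.evenGen_mem hδ i) (a0.oddGen_mem hδ' j)]
        simp
      · exact h.defect_even_fn hδ hb i m
      · refine swap (evenGen_mem hδ' j) (oddGen_mem hδ i) ?_
        rw [h.defect_even_odd hδ' hδ, dT (a0.evenGen_mem hδ' j) (a0.evenGen_mem hδ i),
          dT (a0.evenGen_mem hδ' j) (a0.oddGen_mem hδ i)]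
        simp
      · rw [h.defect_odd_odd hδ hδ', dT (a0.oddGen_mem hδ i) (a0.oddGen_mem hδ' j),
          dT (a0.evenGen_mem hδ i) (a0.oddGen_mem hδ' j),
          dT (a0.evenGen_mem hδ' j) (a0.oddGen_mem hδ i)]
        simp
      · exact h.defect_odd_fn hδ hb i m
      · exact swap (evenGen_mem hδ' j) (fn_mem ha) (h.defect_even_fn hδ' ha j m)
      · exact swap (oddGen_mem hδ' j) (fn_mem ha) (h.defect_odd_fn hδ' ha j m)
      · exact h.defect_fn_fn ha hb m
  one_act m := by rw [h.fn, h.la_one]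
  mul_act a b m := by rw [h.fn, h.fn, h.fn, h.la_mul]

/-- If `σ` is a representation then `T` is a representation of `𝔞₀`. -/
theorem isRep_T (hσ : IsRep σ) : IsRep T := by
  have hla : ∀ {p r : ZMod 2} {a : A} {m : M}, a ∈ (part p : Submodule ℂ A) →
      m ∈ (part r : Submodule ℂ M) → la a m ∈ (part (p + r) : Submodule ℂ M) :=
    fun {p r a m} ha hm => h.fn a m ▸ hσ.map_part (fn_mem ha) hm
  refine isRep_of_gen part_a0_le (fun {p r x m} hx hm => ?_) (fun {p r x y} hx hy m => ?_)
  · have hP : ∀ {p : ZMod 2} {δ : ℂ × ℂ × g}, IsHom p δ →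
        δ.1 • D₀ m + δ.2.1 • q m ∈ (part (p + r) : Submodule ℂ M) := fun {p δ} hδ => by
      rcases parity_cases p with rfl | rfl
      · have := hσ.map_part (d_eq (g := g) 0 ▸ evenGen_mem isHom_D 0) hm
        simpa [hδ.snd rfl, h.act_d_zero] using Submodule.smul_mem _ δ.1 this
      · have := hσ.map_part (Q_eq (g := g) 0 ▸ evenGen_mem isHom_dξ 0) hm
        simpa [hδ.fst rfl, h.act_Q_zero] using Submodule.smul_mem _ δ.2.1 this
    have hE : ∀ {p : ZMod 2} {δ : ℂ × ℂ × g}, IsHom p δ → ∀ i,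
        T (a0.evenGen i δ) m ∈ (part (p + r) : Submodule ℂ M) := fun {p δ} hδ i => by
      rw [h.T_even hδ]
      have := hla (A.t_mem (-i)) (hσ.map_part (evenGen_mem hδ i) hm)
      rw [zero_add] at this
      exact sub_mem this (hP hδ)
    rcases hx with ⟨i, δ, hδ, rfl⟩ | ⟨i, s, δ, rfl, hδ, rfl⟩
    · exact hE hδ i
    · rw [h.T_odd hδ]
      have e1 := hla (A.t_mem (-i)) (hσ.map_part (oddGen_mem hδ i) hm)
      have e2 := hla (A.tξ_mem 0) (add_mem (hE hδ i) (hP hδ))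
      rw [zero_add] at e1
      rw [← add_assoc, add_comm 1 s] at e2
      exact sub_mem e1 e2
  -- The defect identities are solved in triangular order: the even-even case has no other term, the
  -- even-odd case uses it, and the odd-odd case uses the even-odd one. Each time `t ^ (i + j)` is
  -- cancelled.
  · have dE : ∀ {p r : ZMod 2} {δ δ' : ℂ × ℂ × g}, IsHom p δ → IsHom r δ' → ∀ i j,
        defect T p r (a0.evenGen i δ) (a0.evenGen j δ') m = 0 := fun hδ hδ' i j => by
      refine h.la_t_injective (i + j) ?_
      rw [← h.defect_even_even hδ hδ', map_zero,
        hσ.defect_eq_zero (evenGen_mem hδ i) (evenGen_mem hδ' j)]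
    have dO : ∀ {p r : ZMod 2} {δ δ' : ℂ × ℂ × g}, IsHom p δ → IsHom r δ' → ∀ i j,
        defect T p (r + 1) (a0.evenGen i δ) (a0.oddGen r j δ') m = 0 := fun hδ hδ' i j => by
      refine h.la_t_injective (i + j) ?_
      have := h.defect_even_odd hδ hδ' i j m
      rw [dE hδ hδ', hσ.defect_eq_zero (evenGen_mem hδ i) (oddGen_mem hδ' j), map_zero, smul_zero,
        add_zero] at this
      rw [← this, map_zero]
    rcases hx with ⟨i, δ, hδ, rfl⟩ | ⟨i, s, δ, rfl, hδ, rfl⟩ <;>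
      rcases hy with ⟨j, δ', hδ', rfl⟩ | ⟨j, s', δ', rfl, hδ', rfl⟩
    · exact dE hδ hδ' i j
    · exact dO hδ hδ' i j
    · rw [defect_swap T (a0.evenGen_mem hδ' j) (a0.oddGen_mem hδ i), dO hδ' hδ, smul_zero, neg_zero]
    · refine h.la_t_injective (i + j) ?_
      have := h.defect_odd_odd hδ hδ' i j m
      rw [dO hδ hδ', dO hδ' hδ, hσ.defect_eq_zero (oddGen_mem hδ i) (oddGen_mem hδ' j), map_zero,
        smul_zero, add_zero, add_zero] at this
      rw [← this, map_zero]

end IsTwist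

/-! ### Operators on `𝒜 ⊗ V`, and `Γ(λ, V)` as an instance of the dictionary. -/

section tensor
variable {V Z : Type*} [AddCommGroup V] [Module ℂ V] [AddCommGroup Z] [Module ℂ Z]

theorem tensor_hom_ext {f f' : A ⊗[ℂ] V →ₗ[ℂ] Z}
    (h : ∀ r, ∀ a ∈ (part r : Submodule ℂ A), ∀ v, f (a ⊗ₜ v) = f' (a ⊗ₜ v)) : f = f' := by
  refine TensorProduct.ext' fun a v => ?_
  rw [← proj_add_proj a, TensorProduct.add_tmul, map_add, map_add, h 0 _ (proj_mem _ _),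
    h 1 _ (proj_mem _ _)]

theorem tw_tmul {p r : ZMod 2} (c : A) (β : Module.End ℂ V) {a : A}
    (ha : a ∈ (part r : Submodule ℂ A)) (v : V) :
    tw p c β (a ⊗ₜ v) = sgn (p * r) • (c * a) ⊗ₜ β v := by
  rw [tw, TensorProduct.map_tmul, LinearMap.comp_apply, LinearMap.add_apply, LinearMap.smul_apply,
    proj_of_mem ha, proj_of_mem ha, TensorProduct.smul_tmul']
  rcases parity_cases r with rfl | rfl <;> simp [sgn]

@[simp] theorem onA_tmul (α : Module.End ℂ A) (a : A) (v : V) :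
    onA α (a ⊗ₜ[ℂ] v) = α a ⊗ₜ v := TensorProduct.map_tmul _ _ _ _

end tensor

namespace Gamma
variable {g : Type*} [AddCommGroup g] [Module ℂ g]
  {V : Type*} [AddCommGroup V] [Module ℂ V]

theorem evenGen_eq (i : ℤ) (δ : ℂ × ℂ × g) : a0.evenGen i δ =
    δ.1 • a0.dd i + δ.2.1 • a0.QQ i + a0.cc δ.2.2 (A.t i) := by
  refine Subtype.ext (Prod.ext (Witt.ext ?_ ?_) (Prod.ext ?_ ?_)) <;>
    simp [a0.evenGen, evenGen, a0.dd, a0.QQ, a0.cc, d, Q, curr, smul_sub]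

theorem oddGen_eq (p : ZMod 2) (i : ℤ) (δ : ℂ × ℂ × g) : a0.oddGen p i δ =
    δ.1 • a0.GG i + δ.2.1 • a0.hh i + sgn p • a0.cc δ.2.2 (A.tξ i) := by
  refine Subtype.ext (Prod.ext (Witt.ext ?_ ?_) (Prod.ext ?_ ?_)) <;>
    simp [a0.oddGen, oddGen, a0.GG, a0.hh, a0.cc, G, h, curr, TensorProduct.smul_tmul']

variable [SuperSpace g]

/-- The operators `a ⊗ v ↦ (-1) ^ (|X| |a|) a ⊗ X v` on `𝒜 ⊗ V`. -/
def opT (ρ : a0 g →ₗ[ℂ] Module.End ℂ V) : a0 g →ₗ[ℂ] Module.End ℂ (A ⊗[ℂ] V) :=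
  ∑ p : ZMod 2, (TensorProduct.mapBilinear (.id ℂ) A V A V (proj 0 + sgn p • proj 1)) ∘ₗ ρ ∘ₗ proj p

/-- Multiplication by elements of `𝒜` on `𝒜 ⊗ V`. -/
def opla (V : Type*) [AddCommGroup V] [Module ℂ V] : A →ₗ[ℂ] Module.End ℂ (A ⊗[ℂ] V) :=
  (TensorProduct.mapBilinear (.id ℂ) A V A V).flip LinearMap.id ∘ₗ LinearMap.mul ℂ A

@[simp] theorem opla_tmul (a b : A) (v : V) : opla V a (b ⊗ₜ v) = (a * b) ⊗ₜ v := rfl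

theorem opT_tmul (ρ : a0 g →ₗ[ℂ] Module.End ℂ V) {p r : ZMod 2} {X : a0 g} {a : A}
    (hX : X ∈ (part p : Submodule ℂ (a0 g))) (ha : a ∈ (part r : Submodule ℂ A)) (v : V) :
    opT ρ X (a ⊗ₜ v) = sgn (p * r) • a ⊗ₜ ρ X v := by
  have e1 : (proj 0 + sgn p • proj 1 : Module.End ℂ A) a = sgn (p * r) • a := by
    rw [LinearMap.add_apply, LinearMap.smul_apply, proj_of_mem ha, proj_of_mem ha]
    rcases parity_cases r with rfl | rfl <;> simp [sgn]
  have e2 : opT ρ X = TensorProduct.map (proj 0 + sgn p • proj 1) (ρ X) := by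
    rcases parity_cases p with rfl | rfl <;>
      simp [opT, sum_parity, proj_of_mem hX, TensorProduct.map_add_left,
        TensorProduct.map_smul_left]
  rw [e2, TensorProduct.map_tmul, e1, TensorProduct.smul_tmul']

theorem apply_mk (lam : ℂ) (ρ : a0 g →ₗ[ℂ] Module.End ℂ V) {p : ZMod 2} {x : g}
    (hx : x ∈ (part p : Submodule ℂ g)) (f f' b b' : A) :
    Gamma lam ρ (Witt.mk f f', x ⊗ₜ b, b') =
      A.lift (opd lam ρ) (opG lam ρ) f + A.lift (opQ ρ) (oph ρ) f' + opcur ρ p x b + opla V b' := by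
  have e : (∑ p : ZMod 2, TensorProduct.lift (opcur ρ p ∘ₗ proj p)) (x ⊗ₜ b) = opcur ρ p x b := by
    rcases parity_cases p with rfl | rfl <;> simp [sum_parity, proj_of_mem hx]
  rw [← e]
  rfl

/-- The three formulas for `d_i`, `Q_i` and `x ⊗ t ^ i` become one: in each, the sign is `(-1) ^
(|δ| |a|)`, which is the sign built into `opT`. -/
theorem apply_evenGen (lam : ℂ) (ρ : a0 g →ₗ[ℂ] Module.End ℂ V) {p : ZMod 2} {δ : ℂ × ℂ × g}
    (hδ : IsHom p δ) (i : ℤ) : Gamma lam ρ (evenGen i δ) = opla V (A.t i) ∘ₗ (opT ρ (a0.evenGen i δ) +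
        (δ.1 • onA (lam • LinearMap.id + A.D) + δ.2.1 • onA A.dξ)) := by
  refine tensor_hom_ext fun r b hb v => ?_
  have eT := opT_tmul ρ (a0.evenGen_mem hδ i) hb v
  -- Only the generator inside `ρ` is expanded; the one inside `opT` must keep the form it has in
  -- the goal.
  nth_rewrite 2 [evenGen_eq] at eT
  rw [evenGen, apply_mk lam ρ hδ.mem]
  simp only [map_smul, A.lift_t, opcur, LinearMap.coe_mk, AddHom.coe_mk, opd, opQ, opx,
    LinearMap.add_apply, LinearMap.smul_apply, LinearMap.comp_apply, tw_tmul _ _ hb, onA_tmul,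
    eT, map_add, opla_tmul, LinearMap.mulLeft_apply,
    TensorProduct.tmul_add, TensorProduct.tmul_smul, map_zero, LinearMap.zero_apply, smul_add,
    zero_mul, mul_add, mul_smul_comm]
  have s1 := hδ.sgn_mul_mul r
  have s4 := hδ.sgn_mul_mul_snd r
  simp only [show sgn 0 = 1 from by simp [sgn]]
  match_scalars <;> grind

set_option maxHeartbeats 1000000 in
theorem apply_oddGen (lam : ℂ) (ρ : a0 g →ₗ[ℂ] Module.End ℂ V) {p : ZMod 2} {δ : ℂ × ℂ × g}
    (hδ : IsHom p δ) (i : ℤ) : Gamma lam ρ (oddGen p i δ) = opla V (A.t i) ∘ₗ opT ρ (a0.oddGen p i δ) +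
        opla V (A.tξ i) ∘ₗ (opT ρ (a0.evenGen i δ) +
        (δ.1 • onA (lam • LinearMap.id + A.D) + δ.2.1 • onA A.dξ)) := by
  refine tensor_hom_ext fun r b hb v => ?_
  have eT := opT_tmul ρ (a0.evenGen_mem hδ i) hb v
  nth_rewrite 2 [evenGen_eq] at eT
  have eT' := opT_tmul ρ (a0.oddGen_mem hδ i) hb v
  nth_rewrite 2 [oddGen_eq] at eT'
  rw [oddGen, apply_mk lam ρ (Submodule.smul_mem _ _ hδ.mem)]
  simp only [map_smul, A.lift_tξ, opcur, LinearMap.coe_mk, AddHom.coe_mk, opG, oph, opxξ,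
    LinearMap.add_apply, LinearMap.smul_apply, LinearMap.comp_apply, tw_tmul _ _ hb, onA_tmul,
    eT, eT',
    map_add, opla_tmul, LinearMap.mulLeft_apply,
    TensorProduct.tmul_add, TensorProduct.tmul_smul, map_zero, LinearMap.zero_apply, smul_add,
    zero_mul, one_mul, add_mul, mul_add, mul_smul_comm, sgn_add]
  have s1 := hδ.sgn_mul_mul r
  have s4 := hδ.sgn_mul_mul_snd r
  have s6 := sgn_mul_self p
  have s7 := sgn_mul_self r
  simp only [show sgn 0 = 1 from by simp [sgn]]
  match_scalars <;> grind

/-- The Weyl algebra acts on the first tensor factor and `𝔞₀` on the second, and the sign in `opT`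
makes the two supercommute. Adding the scalar `λ` to `t ∂/∂t` affects none of the commutation
relations. Neither the bracket of `𝔞₀` nor a grading of `V` plays a role here. -/
theorem isTwist (lam : ℂ) (ρ : a0 g →ₗ[ℂ] Module.End ℂ V) :
    IsTwist (opla V) (onA (lam • LinearMap.id + A.D)) (onA A.dξ) (opT ρ) (Gamma lam ρ) where
  la_one m := by
    induction m using TensorProduct.induction_on <;> simp_all
  la_mul a b m := by
    induction m using TensorProduct.induction_on <;> simp_all [mul_assoc]
  D_la a m := by
    have hD : ∀ b, A.D (a * b) = a * A.D b + A.D a * b := fun b => by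
      refine TrivSqZeroExt.ext ?_ ?_ <;> simp [A.euler_mul] <;> ring
    induction m using TensorProduct.induction_on with
    | zero => simp
    | tmul b v =>
      simp [hD, TensorProduct.add_tmul, add_assoc]
    | add x y hx hy => rw [map_add, map_add, map_add, hx, hy, map_add, map_add]; abel
  q_la {p a} ha m := by
    have hD : ∀ b, A.dξ (a * b) = sgn p • (a * A.dξ b) + A.dξ a * b := fun b => by
      rcases parity_cases p with rfl | rfl <;>
        simp [A.mem_part_zero, A.mem_part_one] at ha <;>
        refine TrivSqZeroExt.ext ?_ ?_ <;> simp [ha, sgn, mul_comm]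
    induction m using TensorProduct.induction_on with
    | zero => simp
    | tmul b v => simp [hD, TensorProduct.add_tmul, TensorProduct.smul_tmul']
    | add x y hx hy => rw [map_add, map_add, map_add, hx, hy, map_add, map_add, smul_add]; abel
  q_D m := by
    have hD : ∀ a, A.dξ (A.D a) = A.D (A.dξ a) := fun a => by
      refine TrivSqZeroExt.ext ?_ ?_ <;> simp
    induction m using TensorProduct.induction_on <;> simp_all
  q_q m := by
    have hD : ∀ a, A.dξ (A.dξ a) = 0 := fun a => by
      refine TrivSqZeroExt.ext ?_ ?_ <;> simp
    induction m using TensorProduct.induction_on <;> simp_all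
  T_la {p r X a} hX ha m := by
    suffices e : opT ρ X ∘ₗ opla V a = sgn (p * r) • opla V a ∘ₗ opT ρ X from
      DFunLike.congr_fun e m
    refine tensor_hom_ext fun s b hb v => ?_
    simp [opT_tmul ρ hX hb, opT_tmul ρ hX (A.mul_mem ha hb), mul_add, sgn_add, smul_smul]
  D_T X m := by
    suffices e : ∀ p, ∀ X ∈ (part p : Submodule ℂ (a0 g)),
        (onA (lam • LinearMap.id + A.D)) ∘ₗ opT ρ X =
          opT ρ X ∘ₗ onA (lam • LinearMap.id + A.D) by
      have := DFunLike.congr_fun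
        (congrArg₂ (· + ·) (e 0 _ (proj_mem 0 X)) (e 1 _ (proj_mem 1 X))) m
      simp only [← LinearMap.comp_add, ← LinearMap.add_comp, ← map_add, proj_add_proj] at this
      exact this
    intro p X hX
    refine tensor_hom_ext fun s b hb v => ?_
    have hb' : (lam • LinearMap.id + A.D : Module.End ℂ A) b ∈ (part s : Submodule ℂ A) := by
      rcases parity_cases s with rfl | rfl <;>
        simp_all [A.mem_part_zero, A.mem_part_one]
    simp only [LinearMap.comp_apply, opT_tmul ρ hX hb, onA_tmul, map_smul, opT_tmul ρ hX hb']
  q_T {p X} hX m := by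
    suffices e : onA A.dξ ∘ₗ opT ρ X = sgn p • opT ρ X ∘ₗ onA A.dξ from
      DFunLike.congr_fun e m
    refine tensor_hom_ext fun s b hb v => ?_
    have hb' : A.dξ b ∈ (part (s + 1) : Submodule ℂ A) := by
      rcases parity_cases s with rfl | rfl <;>
        simp_all [A.mem_part_zero, A.mem_part_one, one_add_one]
    simp [opT_tmul ρ hX hb, opT_tmul ρ hX hb', mul_add, sgn_add, smul_smul,
      mul_left_comm (sgn p), sgn_mul_self]
  even hδ i m := DFunLike.congr_fun (apply_evenGen lam ρ hδ i) m
  odd hδ i m := DFunLike.congr_fun (apply_oddGen lam ρ hδ i) m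
  fn a m := by
    have := apply_mk lam ρ (zero_mem (part 0 : Submodule ℂ g)) 0 0 0 a
    rw [TensorProduct.zero_tmul, Witt.mk_zero] at this
    rw [fn, this]
    simp

variable [LieSuperalgebra g] [SuperSpace V]

/-- On a homogeneous `a` the sign `(-1) ^ (|X| |a|)` is multiplicative in `X`, hence it factors out
of both sides of the bracket relation. -/
theorem isRep_opT {ρ : a0 g →ₗ[ℂ] Module.End ℂ V} (hρ : IsRep ρ) : IsRep (opT ρ) where
  map_part {p r X m} hX hm := by
    refine map_mem_of_part_tensor (opT ρ X) (fun i j hij a ha v hv => ?_) hm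
    subst hij
    rw [opT_tmul ρ hX ha, ← add_assoc, add_comm p i, add_assoc]
    exact Submodule.smul_mem _ _ (tmul_mem ha (hρ.map_part hX hv))
  map_br {p r X Y} hX hY m := by
    suffices e : opT ρ (br X Y) = opT ρ X ∘ₗ opT ρ Y - sgn (p * r) • opT ρ Y ∘ₗ opT ρ X from
      DFunLike.congr_fun e m
    refine tensor_hom_ext fun s a ha v => ?_
    simp only [opT_tmul ρ (LieSuperalgebra.br_mem hX hY) ha, LinearMap.sub_apply,
      LinearMap.comp_apply, LinearMap.smul_apply, opT_tmul ρ hX ha, opT_tmul ρ hY ha, map_smul,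
      hρ.map_br hX hY, TensorProduct.tmul_sub, TensorProduct.tmul_smul, add_mul, sgn_add]
    module

theorem isALModule (lam : ℂ) {ρ : a0 g →ₗ[ℂ] Module.End ℂ V} (hρ : IsRep ρ) :
    IsALModule (Gamma lam ρ) := by
  refine (isTwist lam ρ).isALModule (isRep_opT hρ) (fun {p r a m} ha hm => ?_) (fun {p m} hm => ?_)
    (fun {p m} hm => ?_)
  · refine map_mem_of_part_tensor (opla V a) (fun i j hij b hb v hv => ?_) hm
    subst hij
    rw [opla_tmul, ← add_assoc]
    exact tmul_mem (A.mul_mem ha hb) hv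
  · refine map_mem_of_part_tensor (onA _) (fun i j hij b hb v hv => ?_) hm
    subst hij
    rw [onA_tmul]
    refine tmul_mem ?_ hv
    rcases parity_cases i with rfl | rfl <;> simp_all [A.mem_part_zero, A.mem_part_one]
  · refine map_mem_of_part_tensor (onA _) (fun i j hij b hb v hv => ?_) hm
    subst hij
    rw [onA_tmul, ← add_assoc]
    refine tmul_mem ?_ hv
    rcases parity_cases i with rfl | rfl <;> simp_all [A.mem_part_zero, A.mem_part_one, one_add_one]

end Gamma

/-! ### Stable subspaces of diagonalizable operators. -/

section eigen
variable {M : Type*} [AddCommGroup M] [Module ℂ M]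

/-- A subspace that is stable under a diagonalizable operator and contains no eigenvector is
zero. -/
theorem eq_bot_of_inf_eigenspace {f : Module.End ℂ M} (hf : ⨆ μ, f.eigenspace μ = ⊤)
    {N : Submodule ℂ M} (hN : ∀ m ∈ N, f m ∈ N) (h : ∀ μ : ℂ, ∀ m ∈ N, f m = μ • m → m = 0) :
    N = ⊥ := by
  have key : ∀ (s : Finset ℂ) (x : ℂ → M), (∀ μ, f (x μ) = μ • x μ) → ∑ μ ∈ s, x μ ∈ N →
      ∑ μ ∈ s, x μ = 0 := by
    intro s
    induction s using Finset.induction_on with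
    | empty => simp
    | insert ν s hν ih =>
      intro x hx hmem
      -- Applying `f - ν` removes the `ν`-component and stays in `N`, so the result vanishes by
      -- induction. The whole sum is then an eigenvector in `N`, hence zero.
      have e1 : f (∑ μ ∈ insert ν s, x μ) - ν • ∑ μ ∈ insert ν s, x μ =
          ∑ μ ∈ s, (μ - ν) • x μ := by
        simp only [map_sum, hx, Finset.smul_sum, ← Finset.sum_sub_distrib, ← sub_smul]
        rw [Finset.sum_insert hν, sub_self, zero_smul, zero_add]
      have e2 := ih (fun μ => (μ - ν) • x μ)
        (fun μ => by rw [map_smul, hx, smul_comm])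
        (e1 ▸ sub_mem (hN _ hmem) (N.smul_mem _ hmem))
      exact h ν _ hmem (sub_eq_zero.1 (e1.trans e2))
  refine (Submodule.eq_bot_iff _).2 fun m hm => ?_
  obtain ⟨x, hx, rfl⟩ := (Submodule.mem_iSup_iff_exists_finsupp _ _).1
    (hf ▸ Submodule.mem_top : m ∈ ⨆ μ, f.eigenspace μ)
  exact key x.support x (fun μ => Module.End.mem_eigenspace_iff.1 (hx μ)) hm

end eigen

/-! ### Weight vectors of `𝒜 ⊗ V`, and simplicity of `Γ(λ, V)` versus simplicity of `V`. -/

section simple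
variable {V : Type*} [AddCommGroup V] [Module ℂ V]

theorem A.one_mem : (1 : A) ∈ (part 0 : Submodule ℂ A) := t_zero ▸ t_mem 0

/-- The coefficients of `t ^ i` and of `t ^ i ξ` of an element of `𝒜 ⊗ V`. -/
def coeffs (V : Type*) [AddCommGroup V] [Module ℂ V] : A ⊗[ℂ] V →ₗ[ℂ] (ℤ →₀ V) × (ℤ →₀ V) :=
  TensorProduct.lift (A.lift (fun i => LinearMap.inl ℂ (ℤ →₀ V) (ℤ →₀ V) ∘ₗ Finsupp.lsingle i)
    (fun i => LinearMap.inr ℂ (ℤ →₀ V) (ℤ →₀ V) ∘ₗ Finsupp.lsingle i))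

/-- The element of `𝒜 ⊗ V` with given coefficients. -/
def ofCoeffs (V : Type*) [AddCommGroup V] [Module ℂ V] : (ℤ →₀ V) × (ℤ →₀ V) →ₗ[ℂ] A ⊗[ℂ] V :=
  (Finsupp.lsum ℂ fun i => TensorProduct.mk ℂ A V (A.t i)).coprod
    (Finsupp.lsum ℂ fun i => TensorProduct.mk ℂ A V (A.tξ i))

theorem tensor_hom_ext_basis {Z : Type*} [AddCommGroup Z] [Module ℂ Z] {f f' : A ⊗[ℂ] V →ₗ[ℂ] Z}
    (h : ∀ i v, f (A.t i ⊗ₜ v) = f' (A.t i ⊗ₜ v))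
    (h' : ∀ i v, f (A.tξ i ⊗ₜ v) = f' (A.tξ i ⊗ₜ v)) : f = f' := by
  refine TensorProduct.ext (A.hom_ext (fun i => ?_) (fun i => ?_)) <;> refine LinearMap.ext fun v => ?_
  · exact h i v
  · exact h' i v

theorem coeffs_t (i : ℤ) (v : V) : coeffs V (A.t i ⊗ₜ v) = (Finsupp.single i v, 0) := by
  simp [coeffs, A.lift_t]

theorem coeffs_tξ (i : ℤ) (v : V) : coeffs V (A.tξ i ⊗ₜ v) = (0, Finsupp.single i v) := by
  simp [coeffs, A.lift_tξ]

theorem ofCoeffs_coeffs (m : A ⊗[ℂ] V) : ofCoeffs V (coeffs V m) = m := by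
  refine DFunLike.congr_fun (f := ofCoeffs V ∘ₗ coeffs V) (g := LinearMap.id)
    (tensor_hom_ext_basis (fun i v => ?_) (fun i v => ?_)) m
  · simp [coeffs_t, ofCoeffs]
  · simp [coeffs_tξ, ofCoeffs]

theorem coeffs_D (lam : ℂ) (m : A ⊗[ℂ] V) (i : ℤ) :
    (coeffs V (onA (lam • LinearMap.id + A.D) m)).1 i = (lam + i) • (coeffs V m).1 i ∧
      (coeffs V (onA (lam • LinearMap.id + A.D) m)).2 i = (lam + i) • (coeffs V m).2 i := by
  have e1 : Finsupp.lapply i ∘ₗ LinearMap.fst ℂ _ _ ∘ₗ coeffs V ∘ₗ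
      onA (lam • LinearMap.id + A.D) =
      (lam + i) • (Finsupp.lapply i ∘ₗ LinearMap.fst ℂ _ _ ∘ₗ coeffs V) := by
    refine tensor_hom_ext_basis (fun j v => ?_) (fun j v => ?_)
    · rcases eq_or_ne j i with rfl | hij
      · simp [A.D_t, ← add_smul, ← TensorProduct.smul_tmul', coeffs_t]
      · simp [A.D_t, ← add_smul, ← TensorProduct.smul_tmul', coeffs_t, hij]
    · simp [A.D_tξ, ← add_smul, ← TensorProduct.smul_tmul', coeffs_tξ]
  have e2 : Finsupp.lapply i ∘ₗ LinearMap.snd ℂ _ _ ∘ₗ coeffs V ∘ₗ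
      onA (lam • LinearMap.id + A.D) =
      (lam + i) • (Finsupp.lapply i ∘ₗ LinearMap.snd ℂ _ _ ∘ₗ coeffs V) := by
    refine tensor_hom_ext_basis (fun j v => ?_) (fun j v => ?_)
    · simp [A.D_t, ← add_smul, ← TensorProduct.smul_tmul', coeffs_t]
    · rcases eq_or_ne j i with rfl | hij
      · simp [A.D_tξ, ← add_smul, ← TensorProduct.smul_tmul', coeffs_tξ]
      · simp [A.D_tξ, ← add_smul, ← TensorProduct.smul_tmul', coeffs_tξ, hij]
  exact ⟨DFunLike.congr_fun e1 m, DFunLike.congr_fun e2 m⟩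

/-- The eigenvectors of `λ + t ∂/∂t` on `𝒜 ⊗ V`. -/
theorem exists_eq_of_eigenvector {lam μ : ℂ} {m : A ⊗[ℂ] V}
    (hm : onA (lam • LinearMap.id + A.D) m = μ • m) :
    ∃ (k : ℤ) (v w : V), m = A.t k ⊗ₜ v + A.tξ k ⊗ₜ w := by
  have e1 : ∀ i : ℤ, lam + i ≠ μ → (coeffs V m).1 i = 0 := fun i hi => by
    have := (coeffs_D lam m i).1
    rw [hm, map_smul, Prod.smul_fst, Finsupp.smul_apply, eq_comm, ← sub_eq_zero, ← sub_smul] at this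
    exact (smul_eq_zero.1 this).resolve_left (sub_ne_zero.2 hi)
  have e2 : ∀ i : ℤ, lam + i ≠ μ → (coeffs V m).2 i = 0 := fun i hi => by
    have := (coeffs_D lam m i).2
    rw [hm, map_smul, Prod.smul_snd, Finsupp.smul_apply, eq_comm, ← sub_eq_zero, ← sub_smul] at this
    exact (smul_eq_zero.1 this).resolve_left (sub_ne_zero.2 hi)
  have key : ∀ k : ℤ, (∀ i : ℤ, i ≠ k → lam + i ≠ μ) →
      ∃ (k : ℤ) (v w : V), m = A.t k ⊗ₜ v + A.tξ k ⊗ₜ w := fun k hk => by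
    refine ⟨k, (coeffs V m).1 k, (coeffs V m).2 k, ?_⟩
    have h1 : (coeffs V m).1 = Finsupp.single k ((coeffs V m).1 k) := Finsupp.ext fun i => by
      rcases eq_or_ne i k with rfl | hi
      · simp
      · rw [e1 i (hk i hi), Finsupp.single_eq_of_ne hi]
    have h2 : (coeffs V m).2 = Finsupp.single k ((coeffs V m).2 k) := Finsupp.ext fun i => by
      rcases eq_or_ne i k with rfl | hi
      · simp
      · rw [e2 i (hk i hi), Finsupp.single_eq_of_ne hi]
    conv_lhs => rw [← ofCoeffs_coeffs m, ← Prod.mk.eta (p := coeffs V m), h1, h2]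
    simp [ofCoeffs]
  -- At most one integer `k` has `λ + k = μ`. If there is none, all coefficients vanish and `k = 0`
  -- serves.
  by_cases hex : ∃ k : ℤ, lam + k = μ
  · obtain ⟨k, hk⟩ := hex
    refine key k fun i hi h => hi ?_
    rw [← hk] at h
    exact_mod_cast add_left_cancel h
  · exact key 0 fun i _ h => hex ⟨i, h⟩

theorem iSup_eigenspace (V : Type*) [AddCommGroup V] [Module ℂ V] (lam : ℂ) :
    ⨆ μ, Module.End.eigenspace (onA (V := V) (lam • LinearMap.id + A.D)) μ = ⊤ := by
  refine eq_top_iff.2 fun m _ => ?_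
  induction m using TensorProduct.induction_on with
  | zero => exact zero_mem _
  | add x y hx hy => exact add_mem (hx trivial) (hy trivial)
  | tmul a v =>
    refine A.mem_of_forall (N := (⨆ μ, Module.End.eigenspace
      (onA (V := V) (lam • LinearMap.id + A.D)) μ).comap ((TensorProduct.mk ℂ A V).flip v))
      (fun i => ?_) (fun i => ?_) a <;>
      refine Submodule.mem_iSup_of_mem (lam + i) (Module.End.mem_eigenspace_iff.2 ?_) <;>
      simp [A.D_t, A.D_tξ, ← add_smul, TensorProduct.smul_tmul']

/-- A subspace of `𝒜 ⊗ V` stable under the super Weyl algebra that meets `1 ⊗ V` in zero is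
zero. -/
theorem eq_bot_of_forall_one_tmul {lam : ℂ} {N : Submodule ℂ (A ⊗[ℂ] V)}
    (hla : ∀ a, ∀ m ∈ N, Gamma.opla V a m ∈ N)
    (hD : ∀ m ∈ N, onA (lam • LinearMap.id + A.D) m ∈ N) (hq : ∀ m ∈ N, onA A.dξ m ∈ N)
    (h : ∀ v, 1 ⊗ₜ v ∈ N → v = 0) : N = ⊥ := by
  refine eq_bot_of_inf_eigenspace (iSup_eigenspace V lam) hD fun μ m hm e => ?_
  obtain ⟨k, v, w, rfl⟩ := exists_eq_of_eigenvector e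
  -- Applying `∂/∂ξ` to `t ^ k ⊗ v + t ^ k ξ ⊗ w` leaves `t ^ k ⊗ w`, and `t ^ (-k)` turns it into
  -- `1 ⊗ w`. Once `w = 0`, the vector `v` is reached by `t ^ (-k)` alone.
  have hw : w = 0 := h w (by
    have := hla (A.t (-k)) _ (hq _ hm)
    simpa [A.dξ_t, A.dξ_tξ, A.t_mul, A.t_zero] using this)
  have hv : v = 0 := h v (by
    have := hla (A.t (-k)) _ hm
    simpa [hw, A.t_mul, A.t_zero] using this)
  simp [hv, hw]

/-- Evaluation `𝒜 ⊗ V → V` at `t = 1`, `ξ = 0`. -/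
def evalOne (V : Type*) [AddCommGroup V] [Module ℂ V] : A ⊗[ℂ] V →ₗ[ℂ] V :=
  TensorProduct.lift (LinearMap.lsmul ℂ V ∘ₗ A.counit)

theorem evalOne_tmul (a : A) (v : V) : evalOne V (a ⊗ₜ v) = A.counit a • v := rfl

theorem evalOne_one_tmul (v : V) : evalOne V (1 ⊗ₜ v) = v := by
  rw [evalOne_tmul, ← A.t_zero, A.counit, A.lift_t, one_smul]

namespace Gamma
variable {g : Type*} [AddCommGroup g] [Module ℂ g] [SuperSpace g] {lam : ℂ}
  {ρ : a0 g →ₗ[ℂ] Module.End ℂ V}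

theorem isWeight : IsWeight (Gamma lam ρ) := by
  have : Gamma lam ρ (d 0) = onA (lam • LinearMap.id + A.D) :=
    LinearMap.ext fun m => (isTwist lam ρ).act_d_zero m
  rw [IsWeight, this, iSup_eigenspace]

theorem opT_one_tmul (X : a0 g) (v : V) : opT ρ X (1 ⊗ₜ v) = 1 ⊗ₜ ρ X v := by
  rw [← proj_add_proj X, map_add, LinearMap.add_apply, opT_tmul ρ (proj_mem 0 X) A.one_mem,
    opT_tmul ρ (proj_mem 1 X) A.one_mem]
  simp [sgn, TensorProduct.tmul_add]

variable [SuperSpace V]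

theorem proj_one_tmul (p : ZMod 2) (v : V) : proj p ((1 : A) ⊗ₜ[ℂ] v) = 1 ⊗ₜ proj p v := by
  have e : ∀ r, proj p ((1 : A) ⊗ₜ[ℂ] proj r v) = 1 ⊗ₜ proj p (proj r v) := fun r => by
    have := tmul_mem A.one_mem (proj_mem r v)
    rw [zero_add] at this
    rw [proj_of_mem this, proj_of_mem (proj_mem r v)]
    split_ifs <;> simp
  conv_lhs => rw [← proj_add_proj v, TensorProduct.tmul_add, map_add, e, e]
  rw [← TensorProduct.tmul_add, ← map_add, proj_add_proj]

/-- A graded submodule `N` of `Γ(λ, V)` cuts out the `𝔞₀`-submodule of those `v` with `1 ⊗ v ∈ N`.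
If this is zero, so is `N`, by the weight argument; if it is `V`, then `N` contains `𝒜 (1 ⊗ V)`,
which is everything. -/
theorem isSimpleRep (hρ : IsSimpleRep ρ) : IsSimpleRep (Gamma lam ρ) := by
  have ht := isTwist lam ρ
  obtain ⟨hV, hS⟩ := hρ
  obtain ⟨v₀, hv₀⟩ := exists_ne (0 : V)
  refine ⟨⟨1 ⊗ₜ v₀, 0, fun e => hv₀ ?_⟩, fun N hp hN => ?_⟩
  · rw [← evalOne_one_tmul v₀, e, map_zero]
  · have hla : ∀ a, ∀ m ∈ N, opla V a m ∈ N := fun a m hm => ht.fn a m ▸ hN _ m hm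
    rcases hS (N.comap (TensorProduct.mk ℂ A V 1))
      (fun p v hv => by
        have := hp p _ hv
        rwa [TensorProduct.mk_apply, proj_one_tmul] at this)
      (fun X v hv => by
        have := ht.T_stable hN X _ hv
        rwa [TensorProduct.mk_apply, opT_one_tmul] at this) with h | h
    · left
      refine eq_bot_of_forall_one_tmul (lam := lam) hla
        (fun m hm => ht.act_d_zero m ▸ hN _ m hm) (fun m hm => ht.act_Q_zero m ▸ hN _ m hm)
        (fun v hv => ?_)
      have : v ∈ N.comap (TensorProduct.mk ℂ A V 1) := hv
      rw [h] at this
      exact this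
    · right
      refine eq_top_iff.2 fun m _ => ?_
      induction m using TensorProduct.induction_on with
      | zero => exact zero_mem _
      | add x y hx hy => exact add_mem (hx trivial) (hy trivial)
      | tmul a v =>
        have hv : v ∈ N.comap (TensorProduct.mk ℂ A V 1) := h ▸ Submodule.mem_top
        have := hla a _ hv
        rwa [TensorProduct.mk_apply, opla_tmul, mul_one] at this

/-- For a submodule `W` of `V`, the span of all `a ⊗ w` is a submodule of `Γ(λ, V)`, and evaluation
at `t = 1`, `ξ = 0` recovers `W` from it. -/
theorem isSimpleRep_of_isSimpleRep (hΓ : IsSimpleRep (Gamma lam ρ)) : IsSimpleRep ρ := by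
  have ht := isTwist lam ρ
  obtain ⟨hM, hS⟩ := hΓ
  refine ⟨?_, fun W hp hW => ?_⟩
  · by_contra hV
    rw [not_nontrivial_iff_subsingleton] at hV
    exact not_subsingleton (A ⊗[ℂ] V) inferInstance
  · let N := Submodule.map₂ (TensorProduct.mk ℂ A V) ⊤ W
    have hmem : ∀ a, ∀ w ∈ W, a ⊗ₜ[ℂ] w ∈ N := fun a w hw =>
      Submodule.apply_mem_map₂ _ Submodule.mem_top hw
    have hend : ∀ f : Module.End ℂ (A ⊗[ℂ] V), (∀ a, ∀ w ∈ W, f (a ⊗ₜ w) ∈ N) → ∀ m ∈ N, f m ∈ N :=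
      fun f hf m hm => by
        have : N ≤ N.comap f := Submodule.map₂_le.2 fun a _ w hw => hf a w hw
        exact this hm
    have hT : ∀ (p r : ZMod 2) (X : a0 g), X ∈ (part p : Submodule ℂ (a0 g)) → ∀ a : A,
        a ∈ (part r : Submodule ℂ A) → ∀ w ∈ W, opT ρ X (a ⊗ₜ w) ∈ N := fun p r X hX a ha w hw => by
      rw [opT_tmul ρ hX ha]
      exact N.smul_mem _ (hmem _ _ (hW X w hw))
    rcases hS N
      (fun p => hend (proj p) fun a w hw => by
        have e : ∀ r s, proj p (proj r a ⊗ₜ[ℂ] proj s w) ∈ N := fun r s => by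
          rw [proj_of_mem (tmul_mem (proj_mem r a) (proj_mem s w))]
          split_ifs
          · exact hmem _ _ (hp s w hw)
          · exact zero_mem _
        rw [← proj_add_proj a, ← proj_add_proj w]
        simp only [TensorProduct.add_tmul, TensorProduct.tmul_add, map_add]
        exact add_mem (add_mem (e 0 0) (e 1 0)) (add_mem (e 0 1) (e 1 1)))
      (ht.stable (fun b => hend _ fun a w hw => hmem _ _ hw) (hend _ fun a w hw => hmem _ _ hw)
        (hend _ fun a w hw => hmem _ _ hw) (fun X => hend _ fun a w hw => by
          rw [← proj_add_proj a, ← proj_add_proj X]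
          simp only [TensorProduct.add_tmul, map_add, LinearMap.add_apply]
          exact add_mem (add_mem (hT 0 0 _ (proj_mem _ _) _ (proj_mem _ _) w hw)
            (hT 1 0 _ (proj_mem _ _) _ (proj_mem _ _) w hw))
            (add_mem (hT 0 1 _ (proj_mem _ _) _ (proj_mem _ _) w hw)
            (hT 1 1 _ (proj_mem _ _) _ (proj_mem _ _) w hw)))) with h | h
    · left
      refine (Submodule.eq_bot_iff _).2 fun w hw => ?_
      have : (1 : A) ⊗ₜ[ℂ] w ∈ N := hmem 1 w hw
      rw [h, Submodule.mem_bot] at this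
      rw [← evalOne_one_tmul w, this, map_zero]
    · right
      refine eq_top_iff.2 fun v _ => ?_
      have hle : N ≤ W.comap (evalOne V) := Submodule.map₂_le.2 fun a _ w hw =>
        W.smul_mem _ hw
      rw [← evalOne_one_tmul v]
      exact hle (h ▸ Submodule.mem_top)

end Gamma
end simple

/-! ### Extracting the action of `𝔞₀` from an arbitrary `𝒜ℒ`-module. -/

section untwist
variable {g : Type*} [AddCommGroup g] [Module ℂ g]
  {M : Type*} [AddCommGroup M] [Module ℂ M]

/-- The action of `𝒜` in an `𝒜ℒ`-module. -/
def actFn (σ : LTilde g →ₗ[ℂ] Module.End ℂ M) : A →ₗ[ℂ] Module.End ℂ M :=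
  σ ∘ₗ LinearMap.inr ℂ Witt ((g ⊗[ℂ] A) × A) ∘ₗ LinearMap.inr ℂ (g ⊗[ℂ] A) A

theorem actFn_apply (σ : LTilde g →ₗ[ℂ] Module.End ℂ M) (a : A) : actFn σ a = σ (fn a) := rfl

/-- The map `x ↦ x ⊗ a` into `𝒲 ⋉ ((g ⊗ 𝒜) ⊕ 𝒜)`. -/
def currHom (a : A) : g →ₗ[ℂ] LTilde g :=
  LinearMap.inr ℂ Witt ((g ⊗[ℂ] A) × A) ∘ₗ LinearMap.inl ℂ (g ⊗[ℂ] A) A ∘ₗ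
    (TensorProduct.mk ℂ g A).flip a

theorem currHom_apply (x : g) (a : A) : currHom a x = curr x a := rfl

variable [SuperSpace g]

/-- The linear map `t ^ i δ ↦ t ^ (-i) (t ^ i δ)`,
`t ^ i ξ δ ↦ t ^ (-i) (t ^ i ξ δ) - t ^ (-i) ξ (t ^ i δ)` for constant vectors `δ`. -/
def untwist (σ : LTilde g →ₗ[ℂ] Module.End ℂ M) : LTilde g →ₗ[ℂ] Module.End ℂ M :=
  A.lift (fun i => actFn σ (A.t (-i)) * σ (d i))
      (fun i => actFn σ (A.t (-i)) * σ (G i) - actFn σ (A.tξ (-i)) * σ (d i)) ∘ₗ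
      Witt.coeffD ∘ₗ LinearMap.fst ℂ Witt ((g ⊗[ℂ] A) × A) +
    A.lift (fun i => actFn σ (A.t (-i)) * σ (Q i))
      (fun i => actFn σ (A.t (-i)) * σ (h i) - actFn σ (A.tξ (-i)) * σ (Q i)) ∘ₗ
      Witt.coeffξ ∘ₗ LinearMap.fst ℂ Witt ((g ⊗[ℂ] A) × A) +
    TensorProduct.lift (A.lift (E := g →ₗ[ℂ] Module.End ℂ M)
      (fun i => LinearMap.mulLeft ℂ (actFn σ (A.t (-i))) ∘ₗ σ ∘ₗ currHom (A.t i))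
      (fun i => LinearMap.mulLeft ℂ (actFn σ (A.t (-i))) ∘ₗ σ ∘ₗ currHom (A.tξ i) -
        LinearMap.mulLeft ℂ (actFn σ (A.tξ (-i))) ∘ₗ σ ∘ₗ currHom (A.t i) ∘ₗ
          (proj 0 - proj 1))).flip ∘ₗ
      LinearMap.fst ℂ (g ⊗[ℂ] A) A ∘ₗ LinearMap.snd ℂ Witt ((g ⊗[ℂ] A) × A)

variable (σ : LTilde g →ₗ[ℂ] Module.End ℂ M)

theorem untwist_mk (f f' b : A) (x : g) : untwist σ (Witt.mk f f', x ⊗ₜ b, 0) =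
    A.lift (fun i => actFn σ (A.t (-i)) * σ (d i))
      (fun i => actFn σ (A.t (-i)) * σ (G i) - actFn σ (A.tξ (-i)) * σ (d i)) f +
    A.lift (fun i => actFn σ (A.t (-i)) * σ (Q i))
      (fun i => actFn σ (A.t (-i)) * σ (h i) - actFn σ (A.tξ (-i)) * σ (Q i)) f' +
    A.lift (E := g →ₗ[ℂ] Module.End ℂ M)
      (fun i => LinearMap.mulLeft ℂ (actFn σ (A.t (-i))) ∘ₗ σ ∘ₗ currHom (A.t i))
      (fun i => LinearMap.mulLeft ℂ (actFn σ (A.t (-i))) ∘ₗ σ ∘ₗ currHom (A.tξ i) -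
        LinearMap.mulLeft ℂ (actFn σ (A.tξ (-i))) ∘ₗ σ ∘ₗ currHom (A.t i) ∘ₗ
          (proj 0 - proj 1)) b x := rfl

omit [SuperSpace g] in
theorem evenGen_eq_sum (i : ℤ) (δ : ℂ × ℂ × g) :
    evenGen i δ = δ.1 • d i + δ.2.1 • Q i + curr δ.2.2 (A.t i) := by
  refine Prod.ext (Witt.ext ?_ ?_) (Prod.ext ?_ ?_) <;> simp [evenGen, d, Q, curr]

omit [SuperSpace g] in
theorem oddGen_eq_sum (p : ZMod 2) (i : ℤ) (δ : ℂ × ℂ × g) :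
    oddGen p i δ = δ.1 • G i + δ.2.1 • h i + sgn p • curr δ.2.2 (A.tξ i) := by
  refine Prod.ext (Witt.ext ?_ ?_) (Prod.ext ?_ ?_) <;>
    simp [oddGen, G, h, curr, TensorProduct.smul_tmul']

theorem untwist_evenGen (i : ℤ) (δ : ℂ × ℂ × g) :
    untwist σ (evenGen i δ) = actFn σ (A.t (-i)) * σ (evenGen i δ) := by
  have e := evenGen_eq_sum i δ
  conv_rhs => rw [e]
  rw [evenGen, untwist_mk]
  simp only [map_smul, A.lift_t, LinearMap.comp_apply, LinearMap.mulLeft_apply, currHom_apply,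
    map_add, mul_add, mul_smul_comm]

/-- Homogeneity enters through `proj 0 - proj 1` in the definition of `untwist`: it acts on the
current part as `sgn p` and cancels the sign carried by `oddGen`. -/
theorem untwist_oddGen {p : ZMod 2} {δ : ℂ × ℂ × g} (hδ : IsHom p δ) (i : ℤ) :
    untwist σ (oddGen p i δ) = actFn σ (A.t (-i)) * σ (oddGen p i δ) -
      actFn σ (A.tξ (-i)) * σ (evenGen i δ) := by
  have e := evenGen_eq_sum i δ
  have e' := oddGen_eq_sum p i δ
  have hx : (proj 0 - proj 1 : g →ₗ[ℂ] g) δ.2.2 = sgn p • δ.2.2 := by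
    rw [LinearMap.sub_apply, proj_of_mem hδ.mem, proj_of_mem hδ.mem]
    rcases parity_cases p with rfl | rfl <;> simp [sgn]
  conv_rhs => rw [e, e']
  rw [oddGen, untwist_mk]
  simp only [map_smul, A.lift_tξ, LinearMap.comp_apply, LinearMap.mulLeft_apply, currHom_apply,
    map_add, mul_add, mul_smul_comm, LinearMap.sub_apply, hx, smul_sub, smul_smul, sgn_mul_self,
    one_smul]
  abel

variable {σ}

/-- A linear map on a component of `𝔞₀` is determined by its values on the generators. -/
theorem a0.hom_ext_part {p : ZMod 2} {f f' : a0 g →ₗ[ℂ] M}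
    (h1 : ∀ {δ : ℂ × ℂ × g}, IsHom p δ → ∀ i, f (a0.evenGen i δ) = f' (a0.evenGen i δ))
    (h2 : ∀ {q : ZMod 2} {δ : ℂ × ℂ × g}, IsHom q δ → q + 1 = p → ∀ i,
      f (a0.oddGen q i δ) = f' (a0.oddGen q i δ)) :
    ∀ X ∈ (part p : Submodule ℂ (a0 g)), f X = f' X := by
  intro X hX
  have : Submodule.span ℂ (genA0 g p) ≤ LinearMap.ker (f - f') := by
    refine Submodule.span_le.2 ?_
    rintro X (⟨i, δ, hδ, rfl⟩ | ⟨i, q, δ, hq, hδ, rfl⟩) <;>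
      simp only [SetLike.mem_coe, LinearMap.mem_ker, LinearMap.sub_apply, sub_eq_zero]
    · exact h1 hδ i
    · exact h2 hδ hq i
  exact sub_eq_zero.1 (this (part_a0_le p hX))

variable [LieSuperalgebra g]

theorem br_d_evenGen {p : ZMod 2} {δ : ℂ × ℂ × g} (hδ : IsHom p δ) (i : ℤ) :
    br (d 0) (evenGen i δ) = (i : ℂ) • evenGen i δ := by
  rw [d_eq, br_evenGen_evenGen isHom_D hδ]
  simp [evenGen]

theorem br_d_oddGen {p : ZMod 2} {δ : ℂ × ℂ × g} (hδ : IsHom p δ) (i : ℤ) :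
    br (d 0) (oddGen p i δ) = (i : ℂ) • oddGen p i δ := by
  rw [d_eq, br_evenGen_oddGen isHom_D hδ]
  simp [evenGen, oddGen]

theorem br_Q_evenGen {p : ZMod 2} {δ : ℂ × ℂ × g} (hδ : IsHom p δ) (i : ℤ) :
    br (Q 0) (evenGen i δ) = 0 := by
  rw [Q_eq, br_evenGen_evenGen isHom_dξ hδ]
  simp [evenGen]

theorem br_Q_oddGen {p : ZMod 2} {δ : ℂ × ℂ × g} (hδ : IsHom p δ) (i : ℤ) :
    br (Q 0) (oddGen p i δ) = evenGen i δ := by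
  rw [Q_eq, br_evenGen_oddGen isHom_dξ hδ]
  simp [evenGen, oddGen]

variable [SuperSpace M]

omit [LieSuperalgebra g] in
theorem d_zero_mem : (d 0 : LTilde g) ∈ (part 0 : Submodule ℂ (LTilde g)) :=
  d_eq (g := g) 0 ▸ evenGen_mem isHom_D 0

omit [LieSuperalgebra g] in
theorem Q_zero_mem : (Q 0 : LTilde g) ∈ (part 1 : Submodule ℂ (LTilde g)) :=
  Q_eq (g := g) 0 ▸ evenGen_mem isHom_dξ 0

omit [SuperSpace g] [LieSuperalgebra g] in
theorem act_evenGen (i : ℤ) (δ : ℂ × ℂ × g) (a : A) :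
    Witt.act (evenGen i δ).1 a = A.t i * (δ.1 • A.D a + δ.2.1 • A.dξ a) := by
  simp [evenGen, Witt.act_apply, mul_add]

omit [SuperSpace g] [LieSuperalgebra g] in
theorem act_oddGen (p : ZMod 2) (i : ℤ) (δ : ℂ × ℂ × g) (a : A) :
    Witt.act (oddGen p i δ).1 a = A.tξ i * (δ.1 • A.D a + δ.2.1 • A.dξ a) := by
  simp [oddGen, Witt.act_apply, mul_add]

omit [SuperSpace g] [LieSuperalgebra g] in
theorem act_d_zero (a : A) : Witt.act (d 0 : LTilde g).1 a = A.D a := by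
  rw [d_eq, act_evenGen, A.t_zero]; simp

omit [SuperSpace g] [LieSuperalgebra g] in
theorem act_Q_zero (a : A) : Witt.act (Q 0 : LTilde g).1 a = A.dξ a := by
  rw [Q_eq, act_evenGen, A.t_zero]; simp

theorem sgn_zero : sgn 0 = 1 := by simp [sgn]
theorem sgn_one : sgn 1 = -1 := by simp [sgn]

namespace IsALModule
variable (hσ : IsALModule σ)
include hσ

theorem la_mul (a b : A) (m : M) : actFn σ (a * b) m = actFn σ a (actFn σ b m) := hσ.mul_act a b m

theorem la_comm (a : A) (i : ℤ) (m : M) :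
    actFn σ a (actFn σ (A.t i) m) = actFn σ (A.t i) (actFn σ a m) := by
  rw [← hσ.la_mul, mul_comm, hσ.la_mul]

theorem la_t_zero (m : M) : actFn σ (A.t 0) m = m := by
  rw [A.t_zero]; exact hσ.one_act m

theorem la_t_t (i j : ℤ) (m : M) :
    actFn σ (A.t i) (actFn σ (A.t j) m) = actFn σ (A.t (i + j)) m := by
  rw [← hσ.la_mul, A.t_mul]

theorem la_t_tξ (i j : ℤ) (m : M) :
    actFn σ (A.t i) (actFn σ (A.tξ j) m) = actFn σ (A.tξ (i + j)) m := by
  rw [← hσ.la_mul, A.t_mul_tξ]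

theorem la_tξ_t (i j : ℤ) (m : M) :
    actFn σ (A.tξ i) (actFn σ (A.t j) m) = actFn σ (A.tξ (i + j)) m := by
  rw [← hσ.la_mul, A.tξ_mul_t]

theorem act_la {p r : ZMod 2} {X : LTilde g} {a : A}
    (hX : X ∈ (part p : Submodule ℂ (LTilde g))) (ha : a ∈ (part r : Submodule ℂ A)) (m : M) :
    σ X (actFn σ a m) = sgn (p * r) • actFn σ a (σ X m) + actFn σ (Witt.act X.1 a) m := by
  have := hσ.map_br hX (fn_mem ha) m
  rw [br_fn hX ha] at this
  rw [actFn_apply, actFn_apply, this]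
  abel

theorem D_la (a : A) (m : M) :
    σ (d 0) (actFn σ a m) = actFn σ a (σ (d 0) m) + actFn σ (A.D a) m := by
  have e : ∀ r, σ (d 0) (actFn σ (proj r a) m) = actFn σ (proj r a) (σ (d 0) m) +
      actFn σ (A.D (proj r a)) m := fun r => by
    rw [hσ.act_la d_zero_mem (proj_mem r a), act_d_zero, zero_mul, sgn_zero, one_smul]
  have := congrArg₂ (· + ·) (e 0) (e 1)
  rw [← proj_add_proj a]
  simp only [map_add, LinearMap.add_apply] at this ⊢
  rw [this]
  abel

theorem Q_la {r : ZMod 2} {a : A} (ha : a ∈ (part r : Submodule ℂ A)) (m : M) :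
    σ (Q 0) (actFn σ a m) = sgn r • actFn σ a (σ (Q 0) m) + actFn σ (A.dξ a) m := by
  rw [hσ.act_la Q_zero_mem ha, act_Q_zero, one_mul]

theorem D_even {p : ZMod 2} {δ : ℂ × ℂ × g} (hδ : IsHom p δ) (i : ℤ) (m : M) :
    σ (d 0) (σ (evenGen i δ) m) = σ (evenGen i δ) (σ (d 0) m) + (i : ℂ) • σ (evenGen i δ) m := by
  have := hσ.map_br d_zero_mem (evenGen_mem hδ i) m
  rw [br_d_evenGen hδ, zero_mul, eq_sub_iff_add_eq] at this
  rw [← this]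
  simp [sgn_zero, add_comm]

theorem D_odd {p : ZMod 2} {δ : ℂ × ℂ × g} (hδ : IsHom p δ) (i : ℤ) (m : M) :
    σ (d 0) (σ (oddGen p i δ) m) =
      σ (oddGen p i δ) (σ (d 0) m) + (i : ℂ) • σ (oddGen p i δ) m := by
  have := hσ.map_br d_zero_mem (oddGen_mem hδ i) m
  rw [br_d_oddGen hδ, zero_mul, eq_sub_iff_add_eq] at this
  rw [← this]
  simp [sgn_zero, add_comm]

theorem Q_even {p : ZMod 2} {δ : ℂ × ℂ × g} (hδ : IsHom p δ) (i : ℤ) (m : M) :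
    σ (Q 0) (σ (evenGen i δ) m) = sgn p • σ (evenGen i δ) (σ (Q 0) m) := by
  have := hσ.map_br Q_zero_mem (evenGen_mem hδ i) m
  rwa [br_Q_evenGen hδ, one_mul, map_zero, LinearMap.zero_apply, eq_comm, sub_eq_zero] at this

theorem Q_odd {p : ZMod 2} {δ : ℂ × ℂ × g} (hδ : IsHom p δ) (i : ℤ) (m : M) :
    σ (Q 0) (σ (oddGen p i δ) m) =
      -(sgn p • σ (oddGen p i δ) (σ (Q 0) m)) + σ (evenGen i δ) m := by
  have := hσ.map_br Q_zero_mem (oddGen_mem hδ i) m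
  rw [br_Q_oddGen hδ, one_mul] at this
  rw [this, sgn_add, sgn_one]
  module

theorem Q_D (m : M) : σ (Q 0) (σ (d 0) m) = σ (d 0) (σ (Q 0) m) := by
  have := hσ.Q_even isHom_D 0 m
  rwa [← d_eq, sgn_zero, one_smul] at this

/-- For an odd element the relation `[Q_0, Q_0] = 0` says that twice the square of its operator
vanishes. -/
theorem Q_Q (m : M) : σ (Q 0) (σ (Q 0) m) = 0 := by
  have := hσ.Q_even isHom_dξ 0 m
  rw [← Q_eq, sgn_one, neg_one_smul, eq_neg_iff_add_eq_zero, ← two_smul ℂ, smul_eq_zero] at this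
  exact this.resolve_left two_ne_zero

theorem untwist_even (δ : ℂ × ℂ × g) (i : ℤ) (m : M) : untwist σ (a0.evenGen i δ : LTilde g) m =
    actFn σ (A.t (-i)) (σ (evenGen i δ) m) - (δ.1 • σ (d 0) m + δ.2.1 • σ (Q 0) m) := by
  have hP : σ (evenGen 0 (δ.1, δ.2.1, 0)) m = δ.1 • σ (d 0) m + δ.2.1 • σ (Q 0) m := by
    rw [evenGen_eq_sum, show curr (0 : g) (A.t 0) = 0 by simp [curr], add_zero, map_add, map_smul,
      map_smul]
    rfl
  rw [← hP, a0.evenGen, map_sub, untwist_evenGen, untwist_evenGen, LinearMap.sub_apply,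
    neg_zero, Module.End.mul_apply, Module.End.mul_apply, hσ.la_t_zero]

omit hσ [LieSuperalgebra g] [SuperSpace M] in
theorem untwist_odd {p : ZMod 2} {δ : ℂ × ℂ × g} (hδ : IsHom p δ) (i : ℤ) (m : M) :
    untwist σ (a0.oddGen p i δ : LTilde g) m = actFn σ (A.t (-i)) (σ (oddGen p i δ) m) -
      actFn σ (A.tξ (-i)) (σ (evenGen i δ) m) := by
  rw [a0.oddGen, untwist_oddGen σ hδ]
  rfl

/-- The supercommutator of `t ^ (-i) (t ^ i δ)` with `a` is `δ(a)`, which is also that of the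
subtracted constant derivation. Likewise `t ^ (-i) (t ^ i ξ δ)` and `t ^ (-i) ξ (t ^ i δ)` both give
`ξ δ(a)`. -/
theorem untwist_la {p r : ZMod 2} {X : a0 g} {a : A} (hX : X ∈ (part p : Submodule ℂ (a0 g)))
    (ha : a ∈ (part r : Submodule ℂ A)) (m : M) :
    untwist σ (X : LTilde g) (actFn σ a m) =
      sgn (p * r) • actFn σ a (untwist σ (X : LTilde g) m) := by
  refine a0.hom_ext_part (f := (untwist σ ∘ₗ (a0 g).subtype).flip (actFn σ a m))
    (f' := sgn (p * r) • actFn σ a ∘ₗ (untwist σ ∘ₗ (a0 g).subtype).flip m) (fun {δ} hδ i => ?_)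
    (fun {q δ} hδ hq i => ?_) X hX
  · have s1 := hδ.sgn_mul_mul r
    have s4 := hδ.sgn_mul_mul_snd r
    simp only [LinearMap.flip_apply, LinearMap.comp_apply, Submodule.subtype_apply,
      hσ.untwist_even, LinearMap.smul_apply, hσ.act_la (evenGen_mem hδ i) ha, act_evenGen,
      hσ.la_mul, hσ.D_la, hσ.Q_la ha, map_add, map_sub, map_smul, LinearMap.add_apply,
      hσ.la_comm a, hσ.la_t_t, neg_add_cancel, hσ.la_t_zero]
    match_scalars <;> grind
  · subst hq
    have hc : ∀ m, actFn σ a (actFn σ (A.tξ (-i)) m) =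
        sgn r • actFn σ (A.tξ (-i)) (actFn σ a m) := fun m => by
      rw [← hσ.la_mul, A.mul_comm_super ha (A.tξ_mem _), map_smul, LinearMap.smul_apply, mul_one,
        hσ.la_mul]
    have s7 := sgn_mul_self r
    simp only [LinearMap.flip_apply, LinearMap.comp_apply, Submodule.subtype_apply,
      untwist_odd hδ, LinearMap.smul_apply, hσ.act_la (evenGen_mem hδ i) ha,
      hσ.act_la (oddGen_mem hδ i) ha, act_evenGen, act_oddGen, hσ.la_mul, map_add, map_sub,
      map_smul, hσ.la_comm a, hc, hσ.la_t_tξ, hσ.la_tξ_t, neg_add_cancel, add_mul, one_mul,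
      sgn_add]
    match_scalars <;> grind

/-- Each generator acts with weight zero: the weight `-i` of `t ^ (-i)` or `t ^ (-i) ξ` cancels the
weight `i` of the element it multiplies. -/
theorem D_untwist (X : a0 g) (m : M) :
    σ (d 0) (untwist σ (X : LTilde g) m) = untwist σ (X : LTilde g) (σ (d 0) m) := by
  refine DFunLike.congr_fun (f := σ (d 0) ∘ₗ (untwist σ ∘ₗ (a0 g).subtype).flip m)
    (g := (untwist σ ∘ₗ (a0 g).subtype).flip (σ (d 0) m)) ?_ X
  refine hom_ext_parts fun p => a0.hom_ext_part (fun {δ} hδ i => ?_) (fun {q δ} hδ hq i => ?_)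
  · simp only [LinearMap.flip_apply, LinearMap.comp_apply, Submodule.subtype_apply,
      hσ.untwist_even, map_add, map_sub, map_smul, hσ.D_la, hσ.D_even hδ, A.D_t,
      LinearMap.smul_apply, hσ.Q_D]
    push_cast
    module
  · simp only [LinearMap.flip_apply, LinearMap.comp_apply, Submodule.subtype_apply,
      untwist_odd hδ, map_add, map_sub, map_smul, hσ.D_la, hσ.D_even hδ, hσ.D_odd hδ, A.D_t,
      A.D_tξ, LinearMap.smul_apply]
    push_cast
    module

/-- `Q_0` supercommutes with `t ^ (-i)` and with `t ^ i δ`. In the odd case `[Q_0, t ^ i ξ δ] = t ^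
i δ` produces an extra term, cancelled by the derivative `t ^ (-i)` of the factor `t ^ (-i) ξ` in
the subtracted term. -/
theorem Q_untwist {p : ZMod 2} {X : a0 g} (hX : X ∈ (part p : Submodule ℂ (a0 g))) (m : M) :
    σ (Q 0) (untwist σ (X : LTilde g) m) = sgn p • untwist σ (X : LTilde g) (σ (Q 0) m) := by
  refine a0.hom_ext_part (f := σ (Q 0) ∘ₗ (untwist σ ∘ₗ (a0 g).subtype).flip m)
    (f' := sgn p • (untwist σ ∘ₗ (a0 g).subtype).flip (σ (Q 0) m))
    (fun {δ} hδ i => ?_) (fun {q δ} hδ hq i => ?_) X hX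
  · have s1 := hδ.sgn_mul
    simp only [LinearMap.flip_apply, LinearMap.comp_apply, Submodule.subtype_apply,
      hσ.untwist_even, map_add, map_sub, map_smul, hσ.Q_la (A.t_mem _), hσ.Q_even hδ, A.dξ_t,
      LinearMap.smul_apply, hσ.Q_D, hσ.Q_Q, map_zero, LinearMap.zero_apply, sgn_zero]
    match_scalars <;> grind
  · subst hq
    simp only [LinearMap.flip_apply, LinearMap.comp_apply, Submodule.subtype_apply,
      untwist_odd hδ, map_add, map_sub, map_smul, map_neg, hσ.Q_la (A.t_mem _),
      hσ.Q_la (A.tξ_mem _), hσ.Q_even hδ, hσ.Q_odd hδ, A.dξ_t, A.dξ_tξ, LinearMap.smul_apply,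
      map_zero, LinearMap.zero_apply, sgn_add, sgn_zero, sgn_one]
    module

/-- Every `𝒜ℒ`-module is given by commuting actions of the super Weyl algebra and of `𝔞₀`. -/
theorem isTwist :
    IsTwist (actFn σ) (σ (d 0)) (σ (Q 0)) (untwist σ ∘ₗ (a0 g).subtype) σ where
  la_one := hσ.one_act
  la_mul := hσ.la_mul
  D_la := hσ.D_la
  q_la := hσ.Q_la
  q_D := hσ.Q_D
  q_q := hσ.Q_Q
  T_la := hσ.untwist_la
  D_T := hσ.D_untwist
  q_T := hσ.Q_untwist
  even hδ i m := by
    rw [LinearMap.comp_apply, Submodule.subtype_apply, hσ.untwist_even, sub_add_cancel, hσ.la_t_t,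
      add_neg_cancel, hσ.la_t_zero]
  odd hδ i m := by
    rw [LinearMap.comp_apply, LinearMap.comp_apply, Submodule.subtype_apply,
      Submodule.subtype_apply, hσ.untwist_even, untwist_odd hδ, sub_add_cancel, map_sub,
      hσ.la_t_t, hσ.la_t_tξ, hσ.la_tξ_t, add_neg_cancel, hσ.la_t_zero, sub_add_cancel]
  fn a m := rfl

end IsALModule
end untwist

/-! ### Restriction to stable graded subspaces, and transport along even isomorphisms. -/

section restrict
variable {L V : Type*} [AddCommGroup L] [Module ℂ L] [AddCommGroup V] [Module ℂ V]

/-- A module restricted to a stable subspace. -/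
def restrictRep (T : L →ₗ[ℂ] Module.End ℂ V) (N : Submodule ℂ V)
    (hN : ∀ X, ∀ v ∈ N, T X v ∈ N) : L →ₗ[ℂ] Module.End ℂ N where
  toFun X := (T X).restrict (hN X)
  map_add' X Y := by ext; simp
  map_smul' c X := by ext; simp

theorem coe_restrictRep (T : L →ₗ[ℂ] Module.End ℂ V) (N : Submodule ℂ V)
    (hN : ∀ X, ∀ v ∈ N, T X v ∈ N) (X : L) (v : N) :
    (restrictRep T N hN X v : V) = T X v := rfl

end restrict

section graded
variable {V V' : Type*} [AddCommGroup V] [Module ℂ V] [SuperSpace V] [AddCommGroup V'] [Module ℂ V']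
  [SuperSpace V']

/-- A graded subspace of a super vector space. -/
@[reducible] def SuperSpace.ofGraded (N : Submodule ℂ V) (hN : ∀ p, ∀ v ∈ N, proj p v ∈ N) :
    SuperSpace N where
  part p := (part p).comap N.subtype
  isCompl_part := by
    have h := SuperSpace.isCompl_part (V := V)
    constructor
    · exact Submodule.disjoint_def.2 fun v h0 h1 =>
        Subtype.ext (Submodule.disjoint_def.1 h.disjoint _ h0 h1)
    · rw [codisjoint_iff, eq_top_iff]
      intro v _
      have : v = ⟨proj 0 v.1, hN 0 _ v.2⟩ + ⟨proj 1 v.1, hN 1 _ v.2⟩ :=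
        Subtype.ext (proj_add_proj v.1).symm
      rw [this]
      exact Submodule.add_mem_sup (proj_mem 0 v.1) (proj_mem 1 v.1)

theorem map_proj_of_map_part {e : V →ₗ[ℂ] V'}
    (he : ∀ p, ∀ v ∈ (part p : Submodule ℂ V), e v ∈ (part p : Submodule ℂ V')) (p : ZMod 2)
    (v : V) : e (proj p v) = proj p (e v) := by
  have : ∀ r, proj p (e (proj r v)) = e (proj p (proj r v)) := fun r => by
    rw [proj_of_mem (he r _ (proj_mem r v)), proj_of_mem (proj_mem r v)]
    split_ifs <;> simp
  conv_rhs => rw [← proj_add_proj v, map_add, map_add, this, this, ← map_add, ← map_add,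
    proj_add_proj]

theorem proj_map_of_even {f : Module.End ℂ V}
    (hf : ∀ p, ∀ v ∈ (part p : Submodule ℂ V), f v ∈ (part p : Submodule ℂ V)) (p : ZMod 2)
    (v : V) : f (proj p v) = proj p (f v) := map_proj_of_map_part hf p v

theorem proj_map_of_odd {f : Module.End ℂ V}
    (hf : ∀ p, ∀ v ∈ (part p : Submodule ℂ V), f v ∈ (part (1 + p) : Submodule ℂ V)) (p : ZMod 2)
    (v : V) : f (proj p v) = proj (1 + p) (f v) := by
  have : ∀ r, proj (1 + p) (f (proj r v)) = f (proj p (proj r v)) := fun r => by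
    rw [proj_of_mem (hf r _ (proj_mem r v)), proj_of_mem (proj_mem r v)]
    by_cases hpr : p = r <;> simp [hpr]
  conv_rhs => rw [← proj_add_proj v, map_add, map_add, this, this, ← map_add, ← map_add,
    proj_add_proj]

variable {L : Type*} [AddCommGroup L] [Module ℂ L]

theorem IsSimpleRep.of_equiv {ρ : L →ₗ[ℂ] Module.End ℂ V} {ρ' : L →ₗ[ℂ] Module.End ℂ V'}
    (h : IsSimpleRep ρ) (e : V' ≃ₗ[ℂ] V)
    (he : ∀ p, ∀ v ∈ (part p : Submodule ℂ V'), e v ∈ (part p : Submodule ℂ V))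
    (hρ : ∀ X v, e (ρ' X v) = ρ X (e v)) : IsSimpleRep ρ' := by
  obtain ⟨hV, hS⟩ := h
  refine ⟨e.toEquiv.nontrivial, fun N hp hN => ?_⟩
  have hN' := hS (N.map e.toLinearMap)
    (by
      rintro p _ ⟨v, hv, rfl⟩
      exact ⟨proj p v, hp p v hv, map_proj_of_map_part (e := e.toLinearMap) he p v⟩)
    (by
      rintro X _ ⟨v, hv, rfl⟩
      exact ⟨ρ' X v, hN X v hv, hρ X v⟩)
  rcases hN' with h | h
  · exact .inl (Submodule.map_injective_of_injective e.injective (h.trans (Submodule.map_bot _).symm))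
  · refine .inr (Submodule.map_injective_of_injective e.injective ?_)
    rw [h, Submodule.map_top, LinearEquiv.range]

theorem IsRep.restrictRep [SuperSpace L] [LieSuperalgebra L] {T : L →ₗ[ℂ] Module.End ℂ V}
    (hT : IsRep T) (N : Submodule ℂ V) (hp : ∀ p, ∀ v ∈ N, proj p v ∈ N)
    (hN : ∀ X, ∀ v ∈ N, T X v ∈ N) :
    letI := SuperSpace.ofGraded N hp
    IsRep (restrictRep T N hN) :=
  letI := SuperSpace.ofGraded N hp
  { map_part := fun hX hv => hT.map_part hX hv
    map_br := fun hX hY v => Subtype.ext (hT.map_br hX hY v.1) }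

end graded

/-! ### Reconstruction of a simple weight module from its vectors of fixed weight killed by `Q_0`.
-/

section reconstruct
variable {g : Type*} [AddCommGroup g] [Module ℂ g] [SuperSpace g]
  {M : Type*} [AddCommGroup M] [Module ℂ M]
  {la : A →ₗ[ℂ] Module.End ℂ M} {D₀ q : Module.End ℂ M}
  {T : a0 g →ₗ[ℂ] Module.End ℂ M} {σ : LTilde g →ₗ[ℂ] Module.End ℂ M}

/-- The vectors of weight `lam` killed by `q`. -/
def singular (D₀ q : Module.End ℂ M) (lam : ℂ) : Submodule ℂ M :=
  D₀.eigenspace lam ⊓ LinearMap.ker q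

theorem mem_singular {lam : ℂ} {m : M} :
    m ∈ singular D₀ q lam ↔ D₀ m = lam • m ∧ q m = 0 := by
  rw [singular, Submodule.mem_inf, Module.End.mem_eigenspace_iff, LinearMap.mem_ker]

/-- The map `𝒜 ⊗ N → M`, `a ⊗ v ↦ a v`. -/
def actMap (la : A →ₗ[ℂ] Module.End ℂ M) (N : Submodule ℂ M) : A ⊗[ℂ] N →ₗ[ℂ] M :=
  TensorProduct.lift (LinearMap.compl₂ la N.subtype)

@[simp] theorem actMap_tmul (N : Submodule ℂ M) (a : A) (v : N) :
    actMap la N (a ⊗ₜ v) = la a v := rfl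

namespace IsTwist
variable (ht : IsTwist la D₀ q T σ) (lam : ℂ)
include ht

/-- `T X` commutes with `D₀` and, for homogeneous `X`, with `q` up to sign. Since the sign depends
on the parity, `X` is split into its two components. -/
theorem T_mem_singular (X : a0 g) : ∀ m ∈ singular D₀ q lam, T X m ∈ singular D₀ q lam := by
  intro m hm
  obtain ⟨h1, h2⟩ := mem_singular.1 hm
  have e : ∀ r, q (T (proj r X) m) = 0 := fun r => by
    rw [ht.q_T (proj_mem r X), h2, map_zero, smul_zero]
  refine mem_singular.2 ⟨by rw [ht.D_T, h1, map_smul], ?_⟩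
  rw [← proj_add_proj X, map_add, LinearMap.add_apply, map_add, e, e, add_zero]

theorem actMap_opla (N : Submodule ℂ M) (a : A) (m : A ⊗[ℂ] N) :
    actMap la N (Gamma.opla N a m) = la a (actMap la N m) := by
  induction m using TensorProduct.induction_on <;> simp_all [ht.la_mul]

theorem actMap_D (m : A ⊗[ℂ] singular D₀ q lam) :
    actMap la _ (onA (lam • LinearMap.id + A.D) m) = D₀ (actMap la _ m) := by
  induction m using TensorProduct.induction_on with
  | zero => simp
  | add x y hx hy => simp [hx, hy]
  | tmul a v => simp [ht.D_la, (mem_singular.1 v.2).1]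

theorem actMap_q (m : A ⊗[ℂ] singular D₀ q lam) :
    actMap la _ (onA A.dξ m) = q (actMap la _ m) := by
  refine DFunLike.congr_fun (f := actMap la _ ∘ₗ onA A.dξ) (g := q ∘ₗ actMap la _)
    (tensor_hom_ext fun r a ha v => ?_) m
  simp [ht.q_la ha, (mem_singular.1 v.2).2]

theorem actMap_T (X : a0 g) (m : A ⊗[ℂ] singular D₀ q lam) :
    actMap la _ (Gamma.opT (restrictRep T _ (ht.T_mem_singular lam)) X m) =
      T X (actMap la _ m) := by
  have key : ∀ p, ∀ X ∈ (part p : Submodule ℂ (a0 g)),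
      actMap la _ (Gamma.opT (restrictRep T _ (ht.T_mem_singular lam)) X m) =
        T X (actMap la _ m) := fun p X hX =>
    DFunLike.congr_fun (f := actMap la _ ∘ₗ Gamma.opT (restrictRep T _ (ht.T_mem_singular lam)) X)
      (g := T X ∘ₗ actMap la _) (tensor_hom_ext fun r a ha v => by
        simp [Gamma.opT_tmul _ hX ha, ht.T_la hX ha, coe_restrictRep]) m
  rw [← proj_add_proj X]
  simp only [map_add, LinearMap.add_apply, key _ _ (proj_mem _ X)]

/-- Both modules arise from the dictionary, so it is enough that `a ⊗ v ↦ a v` respects `𝒜`, `D₀`,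
`q` and `T`. For `D₀` and `q` this is where the conditions `D₀ v = λ v` and `q v = 0` are used. -/
theorem actMap_Gamma (X : LTilde g) (m : A ⊗[ℂ] singular D₀ q lam) :
    actMap la _ (Gamma lam (restrictRep T _ (ht.T_mem_singular lam)) X m) =
      σ X (actMap la _ m) :=
  (Gamma.isTwist lam _).intertwine ht (ht.actMap_opla _) (ht.actMap_D lam) (ht.actMap_q lam)
    (ht.actMap_T lam) X m

/-- The kernel is stable under the Weyl algebra and contains no nonzero `1 ⊗ v`, as `1 ⊗ v ↦ v`;
hence it vanishes by `eq_bot_of_forall_one_tmul`. -/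
theorem actMap_injective : Function.Injective (actMap la (singular D₀ q lam)) := by
  refine LinearMap.ker_eq_bot.1 (eq_bot_of_forall_one_tmul (lam := lam) (fun a m hm => ?_)
    (fun m hm => ?_) (fun m hm => ?_) (fun v hv => ?_))
  · rw [LinearMap.mem_ker] at hm ⊢
    rw [ht.actMap_opla, hm, map_zero]
  · rw [LinearMap.mem_ker] at hm ⊢
    rw [ht.actMap_D, hm, map_zero]
  · rw [LinearMap.mem_ker] at hm ⊢
    rw [ht.actMap_q, hm, map_zero]
  · rw [LinearMap.mem_ker, actMap_tmul, ht.la_one] at hv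
    exact Subtype.ext hv

/-- Given a weight vector `m ≠ 0`, either `q m = 0` and `m` serves, or `q m` does: `q` preserves the
weight and has square zero. -/
theorem singular_ne_bot (h : D₀.eigenspace lam ≠ ⊥) : singular D₀ q lam ≠ ⊥ := by
  obtain ⟨m, hm, hm0⟩ := Submodule.exists_mem_ne_zero_of_ne_bot h
  rw [Module.End.mem_eigenspace_iff] at hm
  rw [Submodule.ne_bot_iff]
  by_cases hq : q m = 0
  · exact ⟨m, mem_singular.2 ⟨hm, hq⟩, hm0⟩
  · exact ⟨q m, mem_singular.2 ⟨by rw [← ht.q_D, hm, map_smul], ht.q_q m⟩, hq⟩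

end IsTwist

variable [LieSuperalgebra g] [SuperSpace M]

/-- A simple weight `𝒜ℒ`-module is isomorphic to `Γ(λ, V)`, with `V` the space of vectors of weight
`λ` killed by `Q 0`. -/
theorem IsALModule.exists_isoRep_Gamma (hσ : IsALModule σ) (hw : IsWeight σ)
    (hs : IsSimpleRep σ) : ∃ lam ∈ supp σ, ∃ (N : Submodule ℂ M) (_ : SuperSpace N)
      (ρ : a0 g →ₗ[ℂ] Module.End ℂ N), IsRep ρ ∧ IsSimpleRep ρ ∧ IsoRep σ (Gamma lam ρ) := by
  have ht := hσ.isTwist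
  have hM := hs.1
  -- The eigenspaces span the nonzero space `M`, so they cannot all vanish; any weight will do.
  obtain ⟨lam, hlam⟩ : ∃ lam, (σ (d 0)).eigenspace lam ≠ ⊥ := by
    by_contra! h0
    rw [IsWeight, iSup_congr h0, iSup_bot] at hw
    exact bot_ne_top hw
  have hp : ∀ p, ∀ v ∈ singular (σ (d 0)) (σ (Q 0)) lam,
      proj p v ∈ singular (σ (d 0)) (σ (Q 0)) lam := fun p v hv => by
    obtain ⟨h1, h2⟩ := mem_singular.1 hv
    refine mem_singular.2 ⟨?_, ?_⟩
    · rw [proj_map_of_even (fun r m hm => by simpa using hσ.map_part d_zero_mem hm), h1, map_smul]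
    · rw [proj_map_of_odd (fun r m hm => hσ.map_part Q_zero_mem hm), h2, map_zero]
  let _ := SuperSpace.ofGraded _ hp
  have he : ∀ p, ∀ m ∈ (part p : Submodule ℂ (A ⊗[ℂ] singular (σ (d 0)) (σ (Q 0)) lam)),
      actMap (actFn σ) _ m ∈ (part p : Submodule ℂ M) := fun p m hm => by
    refine map_mem_of_part_tensor (actMap (actFn σ) _) (fun i j hij a ha v hv => ?_) hm
    subst hij
    exact hσ.map_part (fn_mem ha) hv
  -- The image is a graded submodule containing every `1 v = v` with `v` singular, so it is nonzero
  -- and simplicity of `M` makes it everything.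
  have hsurj : LinearMap.range (actMap (actFn σ) (singular (σ (d 0)) (σ (Q 0)) lam)) = ⊤ := by
    refine (hs.2 _ ?_ ?_).resolve_left fun h0 => ?_
    · rintro p _ ⟨m, rfl⟩
      exact ⟨proj p m, map_proj_of_map_part he p m⟩
    · rintro X _ ⟨m, rfl⟩
      exact ⟨_, ht.actMap_Gamma lam X m⟩
    · obtain ⟨v, hv, hv0⟩ := Submodule.exists_mem_ne_zero_of_ne_bot (ht.singular_ne_bot lam hlam)
      refine hv0 ?_
      have : actMap (actFn σ) _ ((1 : A) ⊗ₜ (⟨v, hv⟩ : singular (σ (d 0)) (σ (Q 0)) lam)) ∈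
        (⊥ : Submodule ℂ M) := h0 ▸ LinearMap.mem_range_self _ _
      rwa [actMap_tmul, ht.la_one, Submodule.mem_bot] at this
  let e := LinearEquiv.ofBijective (actMap (actFn σ) (singular (σ (d 0)) (σ (Q 0)) lam))
    ⟨ht.actMap_injective lam, LinearMap.range_eq_top.1 hsurj⟩
  have hΓ : IsSimpleRep (Gamma lam (restrictRep _ _ (ht.T_mem_singular lam))) :=
    hs.of_equiv e he (ht.actMap_Gamma lam)
  refine ⟨lam, hlam, _, inferInstance, restrictRep _ _ (ht.T_mem_singular lam),
    (ht.isRep_T hσ.toIsRep).restrictRep _ hp _, Gamma.isSimpleRep_of_isSimpleRep hΓ, e.symm,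
    fun p v hv => ?_, fun X v => ?_⟩
  -- The inverse of an even bijection is even, because `e` commutes with the parity projections.
  · have : e.symm v = proj p (e.symm v) := e.injective <| by
      refine Eq.trans ?_ (map_proj_of_map_part (e := e.toLinearMap) he p (e.symm v)).symm
      change e (e.symm v) = proj p (e (e.symm v))
      rw [e.apply_symm_apply, proj_of_mem hv, if_pos rfl]
    rw [this]
    exact proj_mem _ _
  · rw [LinearEquiv.symm_apply_eq]
    refine Eq.trans ?_ (ht.actMap_Gamma lam X (e.symm v)).symm
    exact congrArg (σ X) (e.apply_symm_apply v).symm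

end reconstruct
end
end SuperAffine

theorem lemma4p7 {g : Type u} [AddCommGroup g] [Module ℂ g] [SuperSpace g] [LieSuperalgebra g]
    [FiniteDimensional ℂ g] (hg : IsPerfect g) :
    (∀ (lam : ℂ) (V : Type v) [AddCommGroup V] [Module ℂ V] [SuperSpace V]
      (ρ : a0 g →ₗ[ℂ] Module.End ℂ V), IsRep ρ → IsSimpleRep ρ →
        IsALModule (Gamma lam ρ) ∧ IsWeight (Gamma lam ρ) ∧ IsSimpleRep (Gamma lam ρ)) ∧
    (∀ (M : Type w) [AddCommGroup M] [Module ℂ M] [SuperSpace M]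
      (σ : LTilde g →ₗ[ℂ] Module.End ℂ M), IsALModule σ → IsWeight σ → IsSimpleRep σ →
        ∃ lam ∈ supp σ, ∃ (V : Type w) (_ : AddCommGroup V) (_ : Module ℂ V) (_ : SuperSpace V)
          (ρ : a0 g →ₗ[ℂ] Module.End ℂ V),
          IsRep ρ ∧ IsSimpleRep ρ ∧ IsoRep σ (Gamma lam ρ)) := by
  refine ⟨fun lam V _ _ _ ρ hρ hs =>
    ⟨Gamma.isALModule lam hρ, Gamma.isWeight, Gamma.isSimpleRep hs⟩, fun M _ _ _ σ hσ hw hs => ?_⟩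
  obtain ⟨lam, hlam, N, hN, ρ, hρ, hρs, e⟩ := hσ.exists_isoRep_Gamma hw hs
  exact ⟨lam, hlam, N, inferInstance, inferInstance, hN, ρ, hρ, hρs, e⟩
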